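/- Let $V(z)=-iz^3/3$, $Q(z)=-\tfrac14(z+i)^2(z^2-2iz-3)$, $z_1=-\sqrt2+i$ and $z_2=\sqrt2+i$. A critical trajectory from $z_1$ to $z_2$ is a simple regular analytic arc $\gamma$ with starting point $z_1$ and end point $z_2$ along whose interior $Q(z)\,dz^2<0$. For a contour $\Gamma\subset\mathbb C$, the equilibrium measure on $\Gamma$ in the external field $\operatorname{Re}V$ is the unique minimizer of $$I_V(\nu)=\iint\log\frac1{|z-s|}\,d\nu(z)\,d\nu(s)+\operatorname{Re}\int V(s)\,d\nu(s)$$ among all Borel probability measures $\nu$ on $\Gamma$. Write $U^\mu(z)=\int\log\frac1{|z-s|}\,d\mu(s)$. An analytic contour $\Gamma$ has the $S$-property in the external field $\operatorname{Re}V$ if the support of its equilibrium measure $\mu$ is a finite union of analytic arcs of $\Gamma$, and at every interior point of these arcs the two normal derivatives of $2U^\mu+\operatorname{Re}V$, taken on the two sides of $\Gamma$ (each in the direction away from $\Gamma$), exist and are equal. **Theorem.** There is a critical trajectory from $z_1$ to $z_2$. Let $\gamma$ be any such trajectory, oriented from $z_1$ to $z_2$. There is a branch of $Q^{1/2}$,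 analytic in $\mathbb C\setminus\gamma$, with $$Q^{1/2}(z)=-\tfrac12iz^2-\tfrac1z+O(z^{-2}),\qquad z\to\infty.$$ For this branch the following hold. 1. The arc $\gamma$ has an extension to a simple regular analytic contour $\Gamma=\gamma_1\cup\gamma\cup\gamma_2$ that is unbounded at both ends, where $\gamma_1$ joins $\infty$ to $z_1$ and $\gamma_2$ joins $z_2$ to $\infty$, such that $\phi_1(z)=\int_{z_1}^zQ^{1/2}(s)\,ds$ (integrated along $\gamma_1$) is real and positive for $z\in\gamma_1$, and $\phi_2(z)=\int_{z_2}^zQ^{1/2}(s)\,ds$ (integrated along $\gamma_2$) is real and positive for $z\in\gamma_2$. 2. The limit $Q^{1/2}_+(s)$ of $Q^{1/2}(z)$ as $z$ tends to $s$ from the left side of $\gamma$ exists for every interior point $s$ of $\gamma$, and $$d\mu(s)=\frac1{\pi i}\,Q^{1/2}_+(s)\,ds$$ is real and positive along $\gamma$ and is a probability measure with support $\gamma$. 3. For every $\Gamma$ as in 1, the measure $\mu$ is the equilibrium measure on $\Gamma$ in the external field $\operatorname{Re}V$, and $\Gamma$ has the $S$-property in the external field $\operatorname{Re}V$. -/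

import Mathlib

open Complex Set Filter Topology MeasureTheory
open scoped ENNReal Asymptotics

noncomputable section

namespace CubicSCurve

/-! ### Logarithmic potential theory with an external field -/

/-- The symmetrized weighted logarithmic kernel
`log (1 / |z - s|) + (h z + h s) / 2`, with value `+∞` on the diagonal. -/
def energyKernel (h : ℂ → ℝ) (z s : ℂ) : EReal :=
  -ENNReal.log (edist z s) + (((h z + h s) / 2 : ℝ) : EReal)

/-- The weighted energy `∬ log (1 / |z - s|) dν(z) dν(s) + ∫ h dν` of a probability measure `ν`,
in the extended reals. The two terms are put under one double integral, as is usual for measures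
on unbounded sets, and that integral is the integral of the positive part minus the integral of
the negative part. (The negative part is bounded for the fields and contours of interest.) -/
def weightedEnergy (h : ℂ → ℝ) (ν : Measure ℂ) : EReal :=
  ((∫⁻ p : ℂ × ℂ, (energyKernel h p.1 p.2).toENNReal ∂(ν.prod ν) : ℝ≥0∞) : EReal) -
    ((∫⁻ p : ℂ × ℂ, (-energyKernel h p.1 p.2).toENNReal ∂(ν.prod ν) : ℝ≥0∞) : EReal)

/-- `μ` is the equilibrium measure on the closed set `S` in the external field `h`: the unique
minimizer of the weighted energy among all Borel probability measures carried by `S`. -/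
structure IsEquilibriumMeasure (S : Set ℂ) (h : ℂ → ℝ) (μ : Measure ℂ) : Prop where
  isProbability : IsProbabilityMeasure μ
  carried : μ Sᶜ = 0
  minimal : ∀ ν : Measure ℂ, IsProbabilityMeasure ν → ν Sᶜ = 0 → ν ≠ μ →
    weightedEnergy h μ < weightedEnergy h ν

/-- The logarithmic potential `U^μ(z) = ∫ log (1 / |z - s|) dμ(s)`. -/
def logPotential (μ : Measure ℂ) (z : ℂ) : ℝ :=
  ∫ s, Real.log (1 / ‖z - s‖) ∂μ

/-- The total potential `2 U^μ + h`. -/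
def totalPotential (h : ℂ → ℝ) (μ : Measure ℂ) (z : ℂ) : ℝ :=
  2 * logPotential μ z + h z

/-- `F` has one-sided derivative `d` at `z` in the direction `n`, that is,
`(F (z + ε n) - F z) / ε → d` as `ε ↓ 0`. -/
def HasOneSidedDeriv (F : ℂ → ℝ) (z n : ℂ) (d : ℝ) : Prop :=
  HasDerivWithinAt (fun ε : ℝ => F (z + (ε : ℂ) * n)) d (Ici 0) 0

/-- The unit normal of the parametrized curve `G` at `G t`, pointing to the left. -/
def leftNormal (G : ℝ → ℂ) (t : ℝ) : ℂ :=
  I * deriv G t / ((‖deriv G t‖ : ℝ) : ℂ)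

/-- A simple, regular, real-analytic curve that goes to infinity at both ends. -/
structure IsAnalyticContour (G : ℝ → ℂ) : Prop where
  analytic : AnalyticOnNhd ℝ G univ
  regular : ∀ t, deriv G t ≠ 0
  injective : Function.Injective G
  atTop : Tendsto G atTop (cocompact ℂ)
  atBot : Tendsto G atBot (cocompact ℂ)

/-- The analytic contour `G` has the S-property in the external field `h`. The support of the
equilibrium measure `μ` on `G` is a finite union of disjoint arcs of `G`, and at each interior
point of these arcs the two normal derivatives of `2 U^μ + h`, on the left side and on the right
side of the contour, exist and are equal. -/
def HasSProperty (G : ℝ → ℂ) (h : ℂ → ℝ) : Prop :=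
  IsAnalyticContour G ∧
  ∃ μ : Measure ℂ, IsEquilibriumMeasure (range G) h μ ∧
    ∃ (N : ℕ) (a b : Fin N → ℝ),
      (∀ k, a k < b k) ∧
      Pairwise (fun j k => Disjoint (Icc (a j) (b j)) (Icc (a k) (b k))) ∧
      μ.support = ⋃ k, G '' Icc (a k) (b k) ∧
      ∀ k, ∀ t ∈ Ioo (a k) (b k),
        Integrable (fun s => Real.log (1 / ‖G t - s‖)) μ ∧
        ∃ d : ℝ,
          HasOneSidedDeriv (totalPotential h μ) (G t) (leftNormal G t) d ∧
          HasOneSidedDeriv (totalPotential h μ) (G t) (-leftNormal G t) d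

/-! ### Critical trajectories -/

/-- The curve `c`, restricted to `[0, 1]`, is a critical trajectory of the quadratic differential
`Q(z) dz²` from the zero `p` of `Q` to the zero `q` of `Q`: a simple regular analytic arc along
whose interior `Q(z) dz² < 0`, so that `(1 / (π i)) ∫ Q^{1/2} ds` is real along it. -/
structure IsCriticalTrajectory (Q : ℂ → ℂ) (p q : ℂ) (c : ℝ → ℂ) : Prop where
  analytic : AnalyticOnNhd ℝ c (Icc 0 1)
  regular : ∀ t ∈ Icc (0 : ℝ) 1, deriv c t ≠ 0
  injOn : InjOn c (Icc 0 1)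
  source : c 0 = p
  target : c 1 = q
  zero_source : Q p = 0
  zero_target : Q q = 0
  trajectory : ∀ t ∈ Ioo (0 : ℝ) 1,
    (Q (c t) * deriv c t ^ 2).im = 0 ∧ (Q (c t) * deriv c t ^ 2).re < 0

/-- `L` is the limit of `R(z)` as `z` tends to `c t` from the left side of the curve `c`. (The
points `c u + ε i c'(u)` with `u` near `t` and small `ε > 0` fill that side near `c t`.) -/
def HasLeftLimit (R : ℂ → ℂ) (c : ℝ → ℂ) (t : ℝ) (L : ℂ) : Prop :=
  Tendsto (fun x : ℝ × ℝ => R (c x.1 + (x.2 : ℂ) * (I * deriv c x.1)))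
    (𝓝 t ×ˢ 𝓝[>] (0 : ℝ)) (𝓝 L)

/-- The measure `f(s) ds` on the arc `c` over `[0, 1]`, when `f(s) ds` is real and nonnegative
along the arc. -/
def arcMeasure (c : ℝ → ℂ) (f : ℂ → ℂ) : Measure ℂ :=
  Measure.map c ((volume.restrict (Ioo (0 : ℝ) 1)).withDensity
    fun t => ENNReal.ofReal (f (c t) * deriv c t).re)

/-! ### The cubic case -/

/-- The potential `V(z) = -i z³ / 3`. -/
def V (z : ℂ) : ℂ := -I * z ^ 3 / 3

/-- The external field `Re V`. -/
def field (z : ℂ) : ℝ := (V z).re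

/-- `Q(z) = -(1/4) (z + i)² (z² - 2 i z - 3)`. -/
def Q (z : ℂ) : ℂ := -(1 / 4) * (z + I) ^ 2 * (z ^ 2 - 2 * I * z - 3)

/-- The zero `-√2 + i` of `Q`. -/
def z₁ : ℂ := -((Real.sqrt 2 : ℝ) : ℂ) + I

/-- The zero `√2 + i` of `Q`. -/
def z₂ : ℂ := ((Real.sqrt 2 : ℝ) : ℂ) + I

/-- `R` is the branch of `Q^{1/2}` with cut `γ` and
`R(z) = -i z² / 2 - 1 / z + O(1 / z²)` as `z → ∞`. -/
structure IsSqrtBranch (γ : Set ℂ) (R : ℂ → ℂ) : Prop where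
  analytic : AnalyticOnNhd ℂ R γᶜ
  sq : ∀ z ∈ γᶜ, R z ^ 2 = Q z
  asymptotic : (fun z => R z - (-(I / 2) * z ^ 2 - 1 / z)) =O[cocompact ℂ] fun z => 1 / z ^ 2

/-- `G` is an analytic extension `Γ = γ₁ ∪ γ ∪ γ₂` of the arc `γ` from `z₁` to `z₂`, where
`γ₁ = G (-∞, 0)`, `γ = G [0, 1]`, `γ₂ = G (1, ∞)`. The integrals of the branch `R` of `Q^{1/2}`
from `z₁` along `γ₁` (which is `φ₁`) and from `z₂` along `γ₂` (which is `φ₂`) are real and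
positive. -/
structure IsContourExtension (γ : Set ℂ) (R : ℂ → ℂ) (G : ℝ → ℂ) : Prop where
  contour : IsAnalyticContour G
  middle : G '' Icc 0 1 = γ
  start : G 0 = z₁
  finish : G 1 = z₂
  phi_one : ∀ t < 0, (∫ u in (0 : ℝ)..t, R (G u) * deriv G u).im = 0 ∧
    0 < (∫ u in (0 : ℝ)..t, R (G u) * deriv G u).re
  phi_two : ∀ t > 1, (∫ u in (1 : ℝ)..t, R (G u) * deriv G u).im = 0 ∧
    0 < (∫ u in (1 : ℝ)..t, R (G u) * deriv G u).re

end CubicSCurve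

end

noncomputable section

namespace CubicSCurve

/-! ### The primitive of `Q^{1/2}` in the doubly slit plane

The normalized variable is `p = (z - i) / √2`, so that the simple zeros of `Q` become `±1`. -/

/-! In the coordinate `p = nrm z` the simple zeros of `Q` are ±1, the double zero is -√2 i, and
Q^{1/2} dz has an explicit primitive `phi` in the doubly slit plane. Trajectories are level lines of
Re phi, and the curves along which Q^{1/2} dz is real are level lines of Im phi. Re phi is monotone
on vertical segments of the strip |Re p| ≤ 1, -√2 ≤ Im p ≤ 0, and Im phi is monotone on vertical
rays of the first quadrant. Together with a reflection this makes the arc and its two continuations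
the graph of a single function `height`. The graph is analytic even at p = 1, hence at p = -1,
because phi² is the cube of a conformal map ψ there (`exists_conformal_cube_root`): the curve on
which ψ is real passes from ψ³ < 0, where Re phi = 0, to ψ³ > 0, where Im phi = 0. Conversely, the
signs of Re phi on the sides of a box confine every critical trajectory to this graph
(`trajectory_mem_arc`). All trajectories thus have the same image `arc` and carry the same measure
`mu`.

The branch of Q^{1/2} is obtained as V'/2 minus the Cauchy transform of `mu`. After the substitution
p = cos η the Cauchy integral at a large point has an analytic integrand and can be moved to the
real segment [0, π], where it is computed. So the square of the branch is Q near infinity, and by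
the identity theorem everywhere off the arc (`branch_sq`). Consequently 2U^μ + Re V has differential
Re(2 Q^{1/2} dz): it equals a constant l on the arc and l ± 2 Re phi on its two sides
(`exists_totalPotential_eq`). The opposite signs give the S-property. The positivity of φ₁ and φ₂
gives the inequality 2U^μ + Re V ≥ l on the rest of Γ.

For minimality, the energy of ν minus that of μ is the logarithmic energy of ν - μ plus the integral
of a nonnegative function. The former is positive for ν ≠ μ (`integral_reducedK_pos`): log(1/r) is a
superposition of Gaussians in r, up to constants that cancel for a signed measure of mass zero, and
the Gaussian energy of ν - μ is the integral of the squared modulus of its Fourier transform against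
a positive weight. Measures without compact support are reached by truncation and Fatou's lemma. -/

/-- The plane without the real rays `(-∞, -1]` and `[1, ∞)`. -/
def slit : Set ℂ := {p | 1 - p ^ 2 ∈ slitPlane}

/-- The principal square root of `1 - p²`. -/
def root (p : ℂ) : ℂ := (1 - p ^ 2) ^ (1 / 2 : ℂ)

/-- The multivalued primitive of `√2 s (p + √2 i)`, as a function on the curve `s² = 1 - p²`;
only its real part does not depend on the choice of the logarithm. -/
def phiAux (p s : ℂ) : ℂ := -(√2 / 3 : ℝ) * s ^ 3 + I * p * s - log (p + I * s)

/-- The primitive of `√2 (1 - p²)^{1/2} (p + √2 i)` in the doubly slit plane. -/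
def phi (p : ℂ) : ℂ := phiAux p (root p)

/-- The derivative of `phi`. -/
def phiDeriv (p : ℂ) : ℂ := √2 * root p * (p + √2 * I)

theorem sqrt_two_sq : ((√2 : ℝ) : ℂ) ^ 2 = 2 := by
  rw [← ofReal_pow, Real.sq_sqrt (by norm_num)]; norm_num

theorem sqrt_two_mul_self : ((√2 : ℝ) : ℂ) * (√2 : ℝ) = 2 := by
  rw [← sq, sqrt_two_sq]

theorem sqrt_two_ne : ((√2 : ℝ) : ℂ) ≠ 0 := by
  rw [ofReal_ne_zero]; positivity

theorem mem_slit_iff {p : ℂ} : p ∈ slit ↔ p.im ≠ 0 ∨ |p.re| < 1 := by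
  have h1 : (1 - p ^ 2).re = 1 - p.re ^ 2 + p.im ^ 2 := by simp [sq]; ring
  have h2 : (1 - p ^ 2).im = -2 * p.re * p.im := by simp [sq]; ring
  rw [slit, mem_ofPred_eq, mem_slitPlane_iff, h1, h2]
  constructor
  · rintro (h | h)
    · by_cases hi : p.im = 0
      · right; rw [hi] at h; rw [← sq_lt_one_iff_abs_lt_one]; nlinarith
      · exact Or.inl hi
    · left; intro hi; simp [hi] at h
  · rintro (h | h)
    · by_cases hr : p.re = 0
      · left; rw [hr]; positivity
      · right; simp [h, hr]
    · left; rw [← sq_lt_one_iff_abs_lt_one] at h; nlinarith [sq_nonneg p.im]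

theorem isOpen_slit : IsOpen slit :=
  isOpen_slitPlane.preimage (by fun_prop)

theorem root_sq (p : ℂ) : root p ^ 2 = 1 - p ^ 2 := by
  rw [root, ← cpow_nat_mul]; norm_num

theorem root_re_pos {p : ℂ} (hp : p ∈ slit) : 0 < (root p).re := by
  have h0 : (1 - p ^ 2) ≠ 0 := slitPlane_ne_zero hp
  rw [root, cpow_def_of_ne_zero h0, exp_re]
  refine mul_pos (Real.exp_pos _) (Real.cos_pos_of_mem_Ioo ?_)
  have h1 := (mem_slitPlane_iff_arg.1 hp).1
  have h2 := neg_pi_lt_arg (1 - p ^ 2)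
  have h3 := lt_of_le_of_ne (arg_le_pi (1 - p ^ 2)) h1
  have : (log (1 - p ^ 2) * (1 / 2)).im = arg (1 - p ^ 2) / 2 := by
    rw [show (1 / 2 : ℂ) = ((1 / 2 : ℝ) : ℂ) by norm_num, mul_comm, im_ofReal_mul, log_im]; ring
  rw [this]; constructor <;> linarith

theorem root_ne_zero {p : ℂ} (hp : p ∈ slit) : root p ≠ 0 := fun h => by
  have := root_re_pos hp; simp [h] at this

theorem root_re_nonneg (p : ℂ) : 0 ≤ (root p).re := by
  rw [root]
  by_cases h0 : 1 - p ^ 2 = 0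
  · rw [h0, zero_cpow (by norm_num)]; simp
  rw [cpow_def_of_ne_zero h0, exp_re]
  refine mul_nonneg (Real.exp_pos _).le (Real.cos_nonneg_of_mem_Icc ?_)
  have h2 := neg_pi_lt_arg (1 - p ^ 2)
  have h3 := arg_le_pi (1 - p ^ 2)
  have : (log (1 - p ^ 2) * (1 / 2)).im = arg (1 - p ^ 2) / 2 := by
    rw [show (1 / 2 : ℂ) = ((1 / 2 : ℝ) : ℂ) by norm_num, mul_comm, im_ofReal_mul, log_im]; ring
  rw [this]; constructor <;> linarith

theorem root_re_mul_im (p : ℂ) : (root p).re * (root p).im = -(p.re * p.im) := by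
  have h := congrArg im (root_sq p)
  simp [sq] at h
  linarith

/-- A square root of `1 - p²` with positive real part is the principal one. -/
theorem eq_root_of_sq {p s : ℂ} (h : s ^ 2 = 1 - p ^ 2) :
    s = root p ∨ s = -root p := by
  rw [← root_sq] at h; exact sq_eq_sq_iff_eq_or_eq_neg.1 h

/-- The sign of the real part tells the two roots apart; every explicit formula for `root` below is
verified through this criterion. -/
theorem eq_root_of_sq_of_re_pos {p s : ℂ} (hp : p ∈ slit) (h : s ^ 2 = 1 - p ^ 2)
    (hs : 0 < s.re) : s = root p := by
  rcases eq_root_of_sq h with h | h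
  · exact h
  · rw [h, neg_re] at hs
    have := root_re_pos hp
    linarith

theorem add_mul_sub_of_sq {p s : ℂ} (h : s ^ 2 = 1 - p ^ 2) : (p + I * s) * (p - I * s) = 1 := by
  linear_combination h - s ^ 2 * I_sq

theorem add_root_ne_zero {p s : ℂ} (h : s ^ 2 = 1 - p ^ 2) : p + I * s ≠ 0 := fun h0 => by
  have := add_mul_sub_of_sq h; simp [h0] at this

/-- Inverse Joukowski map: u = p + is has inverse p - is, and comparing imaginary parts of u and 1/u
gives the identity. Hence Im u has the sign of Re s, which keeps the logarithm in `phi` off its cut.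
-/
theorem im_add_pos_iff {p s : ℂ} (h : s ^ 2 = 1 - p ^ 2) :
    (p + I * s).im * (1 + (normSq (p + I * s))⁻¹) = 2 * s.re := by
  set u := p + I * s with hu
  have h1 : u⁻¹ = p - I * s := inv_eq_of_mul_eq_one_right (add_mul_sub_of_sq h)
  have h2 := congrArg im h1
  rw [inv_im] at h2
  have h3 : u.im = p.im + s.re := by simp [hu]
  have h4 : (p - I * s).im = p.im - s.re := by simp
  rw [h4] at h2
  rw [mul_add, ← div_eq_mul_inv]
  have : -u.im / normSq u = - (u.im / normSq u) := neg_div _ _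
  linarith

theorem im_add_root_pos {p : ℂ} (hp : p ∈ slit) : 0 < (p + I * root p).im := by
  have h := im_add_pos_iff (root_sq p)
  have h1 := root_re_pos hp
  have h2 : 0 < 1 + (normSq (p + I * root p))⁻¹ := by
    have := normSq_nonneg (p + I * root p); positivity
  by_contra hc
  nlinarith [mul_nonneg_of_nonpos_of_nonpos (not_lt.1 hc) (neg_nonpos.2 h2.le)]

theorem im_add_root_nonneg (p : ℂ) : 0 ≤ (p + I * root p).im := by
  have h := im_add_pos_iff (root_sq p)
  have h1 := root_re_nonneg p
  have h2 : 0 < 1 + (normSq (p + I * root p))⁻¹ := by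
    have := normSq_nonneg (p + I * root p); positivity
  by_contra hc
  nlinarith [mul_pos (neg_pos.2 (not_le.1 hc)) h2]

theorem hasDerivAt_root {p : ℂ} (hp : p ∈ slit) : HasDerivAt root (-p / root p) p := by
  have h1 : HasDerivAt (fun p : ℂ => 1 - p ^ 2) (-(2 * p)) p := by
    simpa using ((hasDerivAt_id p).pow 2).const_sub 1
  have h2 := h1.cpow_const (c := (1 / 2 : ℂ)) hp
  refine h2.congr_deriv ?_
  have h0 : (1 - p ^ 2) ≠ 0 := slitPlane_ne_zero hp
  have h3 : root p ≠ 0 := root_ne_zero hp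
  rw [cpow_sub _ _ h0, cpow_one, ← root, ← root_sq]
  field_simp

theorem hasDerivAt_phi {p : ℂ} (hp : p ∈ slit) : HasDerivAt phi (phiDeriv p) p := by
  have hr := hasDerivAt_root hp
  have h0 := root_ne_zero hp
  have hu : p + I * root p ≠ 0 := add_root_ne_zero (root_sq p)
  have hl : p + I * root p ∈ slitPlane := Or.inr (im_add_root_pos hp).ne'
  have h1 : HasDerivAt (fun p => p + I * root p) (1 + I * (-p / root p)) p :=
    (hasDerivAt_id p).add (hr.const_mul I)
  have h2 := h1.clog hl
  have h3 := (((hr.pow 3).const_mul (-(√2 / 3 : ℝ) : ℂ)).add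
    (((hasDerivAt_id p).const_mul I).mul hr)).sub h2
  refine h3.congr_deriv ?_
  -- Since s' = -p/s, the logarithmic derivative of p + is collapses to -i/s.
  have h4 : (1 + I * (-p / root p)) / (p + I * root p) = -I / root p := by
    rw [div_eq_div_iff hu h0]
    field_simp
    linear_combination root p * I_sq
  rw [h4]
  have hs := root_sq p
  simp only [phiDeriv, id]
  push_cast
  field_simp
  linear_combination -I * hs - root p ^ 2 * I * sqrt_two_sq

theorem differentiableOn_phi : DifferentiableOn ℂ phi slit := fun _ hp =>
  (hasDerivAt_phi hp).differentiableAt.differentiableWithinAt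

/-- The branch points lie on the cuts, but ‖root q‖ = √‖1 - q²‖ does not see the choice of sign and
tends to 0. -/
theorem continuousAt_root_of_sq_eq_one {p : ℂ} (hp : p ^ 2 = 1) : ContinuousAt root p := by
  have h0 : root p = 0 := by
    have := root_sq p; rw [hp, sub_self] at this; exact pow_eq_zero_iff (two_ne_zero) |>.1 this
  rw [ContinuousAt, h0, tendsto_zero_iff_norm_tendsto_zero]
  have h1 : ∀ q, ‖root q‖ = √‖1 - q ^ 2‖ := fun q => by
    rw [← root_sq, norm_pow, Real.sqrt_sq (norm_nonneg _)]
  simp_rw [h1]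
  have : ContinuousAt (fun q : ℂ => √‖1 - q ^ 2‖) p := by fun_prop
  simpa [ContinuousAt, hp] using this

theorem root_one : root 1 = 0 := by simp [root]
theorem root_neg_one : root (-1) = 0 := by simp [root]

theorem phi_one : phi 1 = 0 := by simp [phi, phiAux, root_one]
theorem phi_neg_one : phi (-1) = -(Real.pi * I) := by
  simp [phi, phiAux, root_neg_one, log_neg_one]

theorem continuousAt_phi_one : ContinuousAt phi 1 := by
  have hr := continuousAt_root_of_sq_eq_one (p := 1) (by norm_num)
  have : ContinuousAt (fun p => log (p + I * root p)) 1 := by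
    refine ContinuousAt.clog (by fun_prop) ?_
    simp [root_one]
  unfold phi phiAux
  fun_prop

/-- Here p + i root p tends to -1, a point of the cut of the logarithm. It does so inside the closed
upper half-plane, where the principal logarithm is continuous up to the negative axis. -/
theorem continuousAt_phi_neg_one : ContinuousAt phi (-1) := by
  have hr := continuousAt_root_of_sq_eq_one (p := -1) (by norm_num)
  have : ContinuousAt (fun p => log (p + I * root p)) (-1) := by
    have h1 : Tendsto (fun p => p + I * root p) (𝓝 (-1)) (𝓝[{z : ℂ | 0 ≤ z.im}] (-1)) := by
      refine tendsto_nhdsWithin_iff.2 ⟨?_, Eventually.of_forall im_add_root_nonneg⟩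
      have : ContinuousAt (fun p => p + I * root p) (-1) := by fun_prop
      simpa [ContinuousAt, root_neg_one] using this
    have h2 := (continuousWithinAt_log_of_re_neg_of_im_zero (z := -1) (by simp) (by simp))
    have h3 := h2.tendsto.comp h1
    simpa [ContinuousAt, root_neg_one, Function.comp_def] using h3
  unfold phi phiAux
  fun_prop

/-! ### Signs of the real and imaginary parts of the primitive -/

theorem phiDeriv_im (p : ℂ) :
    (phiDeriv p).im = √2 * ((root p).re * (p.im + √2) + (root p).im * p.re) := by
  simp [phiDeriv]; ring

theorem phiDeriv_re (p : ℂ) :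
    (phiDeriv p).re = √2 * ((root p).re * p.re - (root p).im * (p.im + √2)) := by
  simp [phiDeriv]; ring

/-- Multiplied by Re(root p) > 0, the term Im(root p) · Re p becomes -(Re p)² Im p ≥ 0. By the
Cauchy–Riemann equations the conclusion makes Re phi decrease upwards below the real axis. -/
theorem phiDeriv_im_pos {p : ℂ} (hp : p ∈ slit) (h0 : p.im ≤ 0) (h1 : -√2 < p.im) :
    0 < (phiDeriv p).im := by
  have h := root_re_mul_im p
  have h2 := root_re_pos hp
  rw [phiDeriv_im]
  have h3 : 0 ≤ (root p).im * p.re := by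
    have e : (root p).re * ((root p).im * p.re) = p.re ^ 2 * -p.im := by linear_combination p.re * h
    have : 0 ≤ (root p).re * ((root p).im * p.re) := by
      rw [e]; exact mul_nonneg (sq_nonneg _) (by linarith)
    exact nonneg_of_mul_nonneg_right this h2
  have h4 : 0 < (root p).re * (p.im + √2) := mul_pos h2 (by linarith)
  positivity

/-- With root p = a + ib and p = x + iy one has ab = -xy, so (ax - by)² = (ax + by)² + (2xy)². A
quantitative bound, and not only positivity, is needed to force Im phi to become positive high up on
vertical rays. -/
theorem two_mul_le_phiDeriv_re {p : ℂ} (hx : 0 < p.re) (hy : 0 < p.im) :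
    2 * √2 * (p.re * p.im) ≤ (phiDeriv p).re := by
  have hp : p ∈ slit := mem_slit_iff.2 (Or.inl hy.ne')
  have h := root_re_mul_im p
  have h2 := root_re_pos hp
  rw [phiDeriv_re]
  set a := (root p).re
  set b := (root p).im
  have hb : b < 0 := by
    by_contra hc
    nlinarith [mul_nonneg h2.le (not_lt.1 hc), mul_pos hx hy]
  have hs : 0 < √2 := by positivity
  have key : 2 * (p.re * p.im) ≤ a * p.re - b * p.im := by
    have h5 : 0 < a * p.re - b * p.im := by nlinarith [mul_pos h2 hx, mul_pos (neg_pos.2 hb) hy]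
    have h6 : (2 * (p.re * p.im)) ^ 2 ≤ (a * p.re - b * p.im) ^ 2 := by
      have : (a * p.re - b * p.im) ^ 2 = (a * p.re + b * p.im) ^ 2 + (2 * (p.re * p.im)) ^ 2 := by
        linear_combination (-4 * p.re * p.im) * h
      nlinarith [sq_nonneg (a * p.re + b * p.im)]
    exact le_of_sq_le_sq h6 h5.le
  nlinarith [mul_pos hs hs, mul_nonneg (neg_nonneg.2 hb.le) hs.le]

theorem phiDeriv_re_pos {p : ℂ} (hx : 0 < p.re) (hy : 0 < p.im) : 0 < (phiDeriv p).re :=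
  lt_of_lt_of_le (by positivity) (two_mul_le_phiDeriv_re hx hy)

theorem hasDerivAt_phi_vertical {x y : ℝ} (hp : (x + y * I : ℂ) ∈ slit) :
    HasDerivAt (fun y : ℝ => phi (x + y * I)) (phiDeriv (x + y * I) * I) y := by
  have h1 : HasDerivAt (fun y : ℝ => (x + y * I : ℂ)) I y := by
    simpa using ((hasDerivAt_id y).ofReal_comp.mul_const I).const_add (x : ℂ)
  exact (hasDerivAt_phi hp).comp y h1

theorem hasDerivAt_phi_horizontal {x y : ℝ} (hp : (x + y * I : ℂ) ∈ slit) :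
    HasDerivAt (fun x : ℝ => phi (x + y * I)) (phiDeriv (x + y * I)) x := by
  have h1 : HasDerivAt (fun x : ℝ => (x + y * I : ℂ)) 1 x := by
    simpa using ((hasDerivAt_id x).ofReal_comp).add_const (y * I : ℂ)
  rw [← mul_one (phiDeriv _)]
  exact (hasDerivAt_phi hp).comp x h1

theorem hasDerivAt_re {f : ℝ → ℂ} {f' : ℂ} {x : ℝ} (h : HasDerivAt f f' x) :
    HasDerivAt (fun t => (f t).re) f'.re x :=
  reCLM.hasFDerivAt.comp_hasDerivAt x h

theorem hasDerivAt_im {f : ℝ → ℂ} {f' : ℂ} {x : ℝ} (h : HasDerivAt f f' x) :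
    HasDerivAt (fun t => (f t).im) f'.im x :=
  imCLM.hasFDerivAt.comp_hasDerivAt x h

theorem slit_of_im_ne {x y : ℝ} (h : y ≠ 0) : (x + y * I : ℂ) ∈ slit :=
  mem_slit_iff.2 (Or.inl (by simpa using h))

theorem slit_of_abs_lt {x y : ℝ} (h : |x| < 1) : (x + y * I : ℂ) ∈ slit :=
  mem_slit_iff.2 (Or.inr (by simpa using h))

theorem strictAntiOn_phi_re {x : ℝ} (hx : |x| ≤ 1) :
    StrictAntiOn (fun y : ℝ => (phi (x + y * I)).re) (Icc (-√2) 0) := by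
  have hd : ∀ y : ℝ, (x + y * I : ℂ) ∈ slit →
      HasDerivAt (fun y : ℝ => (phi (x + y * I)).re) (-(phiDeriv (x + y * I)).im) y := fun y hy => by
    simpa using hasDerivAt_re (hasDerivAt_phi_vertical hy)
  refine strictAntiOn_of_deriv_neg (convex_Icc _ _) (fun y hy => ?_) fun y hy => ?_
  · by_cases h : (x + y * I : ℂ) ∈ slit
    · exact (hd y h).continuousAt.continuousWithinAt
    -- The only points of these segments outside the slit plane are the branch points ±1.
    · have h1 : y = 0 := by by_contra h0; exact h (slit_of_im_ne h0)
      have h2 : |x| = 1 := le_antisymm hx (not_lt.1 fun h0 => h (slit_of_abs_lt h0))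
      have h3 : ContinuousAt phi (x + y * I) := by
        rcases eq_or_eq_neg_of_abs_eq h2 with h2 | h2
        · simpa [h1, h2] using continuousAt_phi_one
        · simpa [h1, h2] using continuousAt_phi_neg_one
      have h4 : ContinuousAt (fun y : ℝ => (x + y * I : ℂ)) y := by fun_prop
      exact (continuous_re.continuousAt.comp
        (ContinuousAt.comp (f := fun y : ℝ => (x + y * I : ℂ)) h3 h4)).continuousWithinAt
  · rw [interior_Icc] at hy
    have hs : (x + y * I : ℂ) ∈ slit := slit_of_im_ne hy.2.ne
    rw [(hd y hs).deriv, neg_lt_zero]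
    exact phiDeriv_im_pos hs (by simpa using hy.2.le) (by simpa using hy.1)

theorem root_ofReal {x : ℝ} (hx : |x| < 1) : root x = (√(1 - x ^ 2) : ℝ) := by
  rw [← sq_lt_one_iff_abs_lt_one] at hx
  refine (eq_root_of_sq_of_re_pos (mem_slit_iff.2 (Or.inr ?_)) ?_ ?_).symm
  · rw [ofReal_re, ← sq_lt_one_iff_abs_lt_one]; exact hx
  · rw [← ofReal_pow, Real.sq_sqrt (by linarith)]; push_cast; ring
  · rw [ofReal_re]; exact Real.sqrt_pos.2 (by linarith)

/-- On (-1, 1) the root is real, |p + is| = 1 and ips is imaginary, so only the cubic term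
contributes to the real part. -/
theorem phi_re_ofReal_neg {x : ℝ} (hx : |x| < 1) : (phi x).re < 0 := by
  have h := hx
  rw [← sq_lt_one_iff_abs_lt_one] at hx
  have hs : 0 < √(1 - x ^ 2) := Real.sqrt_pos.2 (by linarith)
  have h1 : ‖(x + I * (√(1 - x ^ 2) : ℝ) : ℂ)‖ = 1 := by
    rw [mul_comm, norm_add_mul_I, Real.sq_sqrt (by linarith)]; simp
  rw [phi, root_ofReal h, phiAux, sub_re, log_re, h1, Real.log_one, ← ofReal_pow, add_re,
    ← ofReal_neg, re_ofReal_mul]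
  simp only [ofReal_re, mul_re, I_re, I_im, ofReal_im, mul_im]
  have : 0 < √2 / 3 * √(1 - x ^ 2) ^ 3 := by positivity
  linarith

theorem root_mul_I (y : ℝ) : root (y * I) = (√(1 + y ^ 2) : ℝ) := by
  refine (eq_root_of_sq_of_re_pos (mem_slit_iff.2 (Or.inr ?_)) ?_ ?_).symm
  · simp
  · rw [← ofReal_pow, Real.sq_sqrt (by positivity), mul_pow, I_sq]; push_cast; ring
  · rw [ofReal_re]; positivity

theorem phi_re_mul_I (y : ℝ) : (phi (y * I)).re =
    -(√2 / 3 * √(1 + y ^ 2) ^ 3) - y * √(1 + y ^ 2) - Real.log (y + √(1 + y ^ 2)) := by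
  have h0 : 0 < y + √(1 + y ^ 2) := by
    have : |y| < √(1 + y ^ 2) := by
      rw [← Real.sqrt_sq_eq_abs]; exact Real.sqrt_lt_sqrt (sq_nonneg _) (by linarith)
    linarith [neg_abs_le y]
  have h1 : (y * I + I * (√(1 + y ^ 2) : ℝ) : ℂ) = (y + √(1 + y ^ 2) : ℝ) * I := by push_cast; ring
  rw [phi, root_mul_I, phiAux, sub_re, log_re, h1, norm_mul, norm_I, mul_one, norm_real,
    Real.norm_of_nonneg h0.le, ← ofReal_pow, add_re, ← ofReal_neg, re_ofReal_mul, ofReal_re]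
  simp
  ring

theorem phi_re_mul_I_neg {y : ℝ} (hy : 0 ≤ y) : (phi (y * I)).re < 0 := by
  rw [phi_re_mul_I]
  have h1 : 1 ≤ √(1 + y ^ 2) := Real.one_le_sqrt.2 (by nlinarith)
  have h2 : 0 ≤ Real.log (y + √(1 + y ^ 2)) := Real.log_nonneg (by linarith)
  have : 0 < √2 / 3 * √(1 + y ^ 2) ^ 3 := by positivity
  have := mul_nonneg hy (by linarith : (0 : ℝ) ≤ √(1 + y ^ 2))
  linarith

/-- At p = -√2 i the root is √3, the algebraic terms cancel, and -log(√3 - √2) > 0 remains. -/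
theorem phi_re_double_zero_pos : 0 < (phi ((-√2 : ℝ) * I)).re := by
  rw [phi_re_mul_I]
  have h2 : √2 * √2 = 2 := Real.mul_self_sqrt (by norm_num)
  have h3 : √3 * √3 = 3 := Real.mul_self_sqrt (by norm_num)
  have e : √(1 + (-√2) ^ 2) = √3 := by rw [neg_sq, Real.sq_sqrt (by norm_num)]; norm_num
  rw [e]
  have h4 : √2 < √3 := Real.sqrt_lt_sqrt (by norm_num) (by norm_num)
  have h6 : √3 - √2 < 1 := by
    have : 0 < √2 := by positivity
    nlinarith
  have h5 : Real.log (-√2 + √3) < 0 := Real.log_neg (by linarith) (by linarith)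
  have : √3 ^ 3 = 3 * √3 := by rw [pow_succ, sq, h3]
  rw [this]
  nlinarith

/-- On the horizontal line through the double zero p + √2 i is the real number x, so the
x-derivative of Re phi has the sign of x and the minimum is at the double zero itself. -/
theorem phi_re_line_pos (x : ℝ) : 0 < (phi (x + (-√2 : ℝ) * I)).re := by
  have hs : ∀ x : ℝ, (x + (-√2 : ℝ) * I : ℂ) ∈ slit := fun x =>
    slit_of_im_ne (neg_ne_zero.2 (by positivity))
  have hd : ∀ x : ℝ, HasDerivAt (fun x : ℝ => (phi (x + (-√2 : ℝ) * I)).re)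
      (√2 * ((root (x + (-√2 : ℝ) * I)).re * x)) x := fun x => by
    have := hasDerivAt_re (hasDerivAt_phi_horizontal (hs x))
    rw [phiDeriv_re] at this
    simpa using this
  have h0 := phi_re_double_zero_pos
  have hc : ContinuousOn (fun x : ℝ => (phi (x + (-√2 : ℝ) * I)).re) univ := fun x _ =>
    (hd x).continuousAt.continuousWithinAt
  rcases le_total 0 x with hx | hx
  · have hm : MonotoneOn (fun x : ℝ => (phi (x + (-√2 : ℝ) * I)).re) (Ici 0) := by
      refine monotoneOn_of_deriv_nonneg (convex_Ici 0) (hc.mono (subset_univ _))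
        (fun x _ => (hd x).differentiableAt.differentiableWithinAt) fun x hx => ?_
      rw [interior_Ici] at hx
      rw [(hd x).deriv]
      have := root_re_pos (hs x)
      have : (0 : ℝ) < x := hx
      positivity
    have := hm (self_mem_Ici) (mem_Ici.2 hx) hx
    simp only [ofReal_zero, zero_add] at this
    linarith
  · have hm : AntitoneOn (fun x : ℝ => (phi (x + (-√2 : ℝ) * I)).re) (Iic 0) := by
      refine antitoneOn_of_deriv_nonpos (convex_Iic 0) (hc.mono (subset_univ _))
        (fun x _ => (hd x).differentiableAt.differentiableWithinAt) fun x hx => ?_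
      rw [interior_Iic] at hx
      rw [(hd x).deriv]
      have h1 := root_re_pos (hs x)
      have h2 : x < 0 := hx
      exact mul_nonpos_of_nonneg_of_nonpos (by positivity)
        (mul_nonpos_of_nonneg_of_nonpos h1.le h2.le)
    have := hm (mem_Iic.2 hx) (self_mem_Iic) hx
    simp only [ofReal_zero, zero_add] at this
    linarith

/-- On the cuts s = iσ is imaginary, and with w = (x - σ)² the real part is (sinh(log w) - log w)/2,
which vanishes only for w = 1, that is, never when |x| > 1. This bars trajectories from crossing the
cuts, for either sign of s. -/
theorem phiAux_re_ne_zero_of_ray {x : ℝ} (hx : 1 < |x|) {s : ℂ} (hs : s ^ 2 = 1 - (x : ℂ) ^ 2) :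
    (phiAux x s).re ≠ 0 := by
  rw [← one_lt_sq_iff_one_lt_abs] at hx
  have hsr : s.re = 0 := by
    have h1 := congrArg im hs
    have h2 := congrArg re hs
    simp [sq] at h1 h2
    by_contra h
    have h3 : s.im = 0 := by
      have : s.re * s.im = 0 := by linarith
      exact (mul_eq_zero.1 this).resolve_left h
    rw [h3] at h2
    nlinarith [sq_nonneg s.re]
  set σ := s.im with hσ
  have hs' : s = σ * I := by apply Complex.ext <;> simp [hsr, hσ]
  have hσ2 : σ ^ 2 = x ^ 2 - 1 := by
    have h2 := congrArg re hs
    rw [hs'] at h2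
    simp [sq] at h2
    linarith
  have hu : (x + I * s : ℂ) = (x - σ : ℝ) := by
    rw [hs']; push_cast; linear_combination σ * I_sq
  have huv : (x - σ) * (x + σ) = 1 := by nlinarith
  have h0 : x - σ ≠ 0 := fun h => by rw [h] at huv; simp at huv
  have hw0 : 0 < (x - σ) ^ 2 := by positivity
  have hre : (phiAux x s).re = (Real.sinh (Real.log ((x - σ) ^ 2)) - Real.log ((x - σ) ^ 2)) / 2 := by
    rw [phiAux, sub_re, log_re, hu, norm_real, Real.norm_eq_abs, Real.log_abs, hs', add_re,
      ← ofReal_neg, re_ofReal_mul, Real.sinh_log hw0, Real.log_pow]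
    have e1 : ((σ * I : ℂ) ^ 3).re = 0 := by
      have : (σ * I : ℂ) ^ 3 = (-σ ^ 3 : ℝ) * I := by
        push_cast; linear_combination (σ : ℂ) ^ 3 * I * I_sq
      rw [this, re_ofReal_mul, I_re, mul_zero]
    have e2 : (I * x * (σ * I) : ℂ).re = -(x * σ) := by
      have : (I * x * (σ * I) : ℂ) = (-(x * σ) : ℝ) := by
        push_cast; linear_combination (x : ℂ) * σ * I_sq
      rw [this, ofReal_re]
    have e3 : ((x - σ) ^ 2)⁻¹ = (x + σ) ^ 2 := by
      rw [← inv_pow, inv_eq_of_mul_eq_one_right huv]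
    rw [e1, e2, e3]
    push_cast
    ring
  rw [hre]
  have hne : Real.log ((x - σ) ^ 2) ≠ 0 := by
    intro h
    have h1 := Real.eq_one_of_pos_of_log_eq_zero hw0 h
    have h2 : (x - σ) ^ 2 * (x + σ) ^ 2 = 1 := by rw [← mul_pow, huv, one_pow]
    rw [h1, one_mul] at h2
    nlinarith
  intro h
  rcases lt_or_gt_of_ne hne with h1 | h1
  · have := Real.sinh_lt_self_iff.2 h1; linarith
  · have := Real.self_lt_sinh_iff.2 h1; linarith

/-! ### Reflection in the imaginary axis -/

theorem neg_conj_mem_slit {p : ℂ} (hp : p ∈ slit) : -(starRingEnd ℂ) p ∈ slit := by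
  rw [mem_slit_iff] at hp ⊢; simpa using hp

theorem root_neg_conj {p : ℂ} (hp : p ∈ slit) :
    root (-(starRingEnd ℂ) p) = (starRingEnd ℂ) (root p) := by
  refine (eq_root_of_sq_of_re_pos (neg_conj_mem_slit hp) ?_ ?_).symm
  · rw [← map_pow, root_sq]; simp
  · simpa using root_re_pos hp

/-- The shift comes from arg(-ū) = π - arg u for u = p + i root p in the upper half-plane. It is
imaginary, so Re phi is even in Re p while the level Im phi = 0 is not symmetric; for this reason
the outer part of the contour is defined through |x|. -/
theorem phi_neg_conj {p : ℂ} (hp : p ∈ slit) :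
    phi (-(starRingEnd ℂ) p) = (starRingEnd ℂ) (phi p) - Real.pi * I := by
  have hl : log (-(starRingEnd ℂ) p + I * (starRingEnd ℂ) (root p)) =
      (starRingEnd ℂ) (log (p + I * root p)) + Real.pi * I := by
    have h1 : (-(starRingEnd ℂ) p + I * (starRingEnd ℂ) (root p)) =
        -(starRingEnd ℂ) (p + I * root p) := by simp; ring
    have h2 := im_add_root_pos hp
    have h3 : arg (p + I * root p) ≠ Real.pi := fun h => by
      rw [arg_eq_pi_iff] at h; exact h2.ne' h.2
    rw [h1, ← log_conj _ h3]
    apply Complex.ext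
    · rw [log_re, add_re, log_re, norm_neg]; simp
    · rw [log_im, add_im, log_im, arg_neg_eq_arg_add_pi_of_im_neg (by rw [conj_im]; linarith)]; simp
  rw [phi, phiAux, root_neg_conj hp, hl, phi, phiAux]
  simp only [map_sub, map_add, map_mul, map_pow, map_neg, conj_ofReal, conj_I]
  ring

theorem phi_re_neg {x y : ℝ} (h : (x + y * I : ℂ) ∈ slit) :
    (phi ((-x : ℝ) + y * I)).re = (phi (x + y * I)).re := by
  have := congrArg re (phi_neg_conj h)
  have e : ((-x : ℝ) + y * I : ℂ) = -(starRingEnd ℂ) (x + y * I) := by simp; ring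
  rw [e, this]
  simp

/-! ### The height function of the contour -/

theorem exists_phi_re_eq_zero {x : ℝ} (hx : |x| < 1) :
    ∃ y ∈ Ioo (-√2) 0, (phi (x + y * I)).re = 0 := by
  have hs : 0 < √2 := by positivity
  have hc : ContinuousOn (fun y : ℝ => (phi (x + y * I)).re) (Icc (-√2) 0) := fun y _ =>
    (hasDerivAt_re (hasDerivAt_phi_vertical (slit_of_abs_lt hx))).continuousAt.continuousWithinAt
  have h := intermediate_value_Ioo' (neg_nonpos.2 hs.le) hc
  have h0 := phi_re_ofReal_neg hx
  have h1 := phi_re_line_pos x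
  obtain ⟨y, hy, hy0⟩ := h (show (0 : ℝ) ∈ Ioo _ _ from ⟨by simpa using h0, h1⟩)
  exact ⟨y, hy, hy0⟩

theorem tendsto_phi_im_ray {x : ℝ} (hx : 1 < x) :
    ∃ c < 0, Tendsto (fun y : ℝ => (phi (x + y * I)).im) (𝓝[>] 0) (𝓝 c) := by
  -- Above the ray `root` equals -i times this function, which is continuous across the ray and so
  -- yields the boundary values. At the limit s = -iσ only the cubic term of `phiAux` has an
  -- imaginary part, namely -(√2/3)σ³.
  set up : ℂ → ℂ := fun p => (p ^ 2 - 1) ^ (1 / 2 : ℂ) with hup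
  have hx2 : 0 < x ^ 2 - 1 := by nlinarith
  set σ : ℝ := (x ^ 2 - 1) ^ (1 / 2 : ℝ) with hσ
  have hσ0 : 0 < σ := Real.rpow_pos_of_pos hx2 _
  have hux : up x = σ := by
    have : (x : ℂ) ^ 2 - 1 = ((x ^ 2 - 1 : ℝ) : ℂ) := by push_cast; rfl
    rw [hup, hσ, ofReal_cpow hx2.le]
    simp
  have hroot : ∀ y : ℝ, 0 < y → root (x + y * I) = -I * up (x + y * I) := by
    intro y hy
    set p : ℂ := x + y * I with hp
    have hre : p.re = x := by simp [hp]
    have him : p.im = y := by simp [hp]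
    have hw : 0 < (p ^ 2 - 1).im := by
      have : (p ^ 2 - 1).im = 2 * x * y := by simp [hp, sq]; ring
      rw [this]; positivity
    have hw0 : p ^ 2 - 1 ≠ 0 := fun h => by rw [h] at hw; simp at hw
    refine (eq_root_of_sq_of_re_pos (slit_of_im_ne hy.ne') ?_ ?_).symm
    · rw [mul_pow, hup]
      simp only
      rw [← cpow_nat_mul]
      norm_num [hp]
    · have h1 : 0 < (up p).im := by
        rw [hup]
        simp only
        rw [cpow_def_of_ne_zero hw0, exp_im]
        have e : (log (p ^ 2 - 1) * (1 / 2)).im = arg (p ^ 2 - 1) / 2 := by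
          rw [show (1 / 2 : ℂ) = ((1 / 2 : ℝ) : ℂ) by norm_num, mul_comm, im_ofReal_mul, log_im]
          ring
        have h2 : 0 < arg (p ^ 2 - 1) := by
          refine lt_of_le_of_ne (arg_nonneg_iff.2 hw.le) fun h => ?_
          have := arg_eq_zero_iff.1 h.symm
          exact hw.ne' this.2
        rw [e]
        refine mul_pos (Real.exp_pos _) (Real.sin_pos_of_pos_of_lt_pi (by linarith) ?_)
        linarith [arg_le_pi (p ^ 2 - 1), Real.pi_pos]
      simpa using h1
  have hc : ContinuousAt (fun p => phiAux p (-I * up p)) x := by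
    have h1 : ContinuousAt up x := by
      refine ContinuousAt.cpow (by fun_prop) continuousAt_const (Or.inl ?_)
      have : (x : ℂ) ^ 2 - 1 = ((x ^ 2 - 1 : ℝ) : ℂ) := by push_cast; rfl
      rw [this, ofReal_re]; exact hx2
    have h2 : ContinuousAt (fun p => log (p + I * (-I * up p))) x := by
      refine ContinuousAt.clog (by fun_prop) (Or.inl ?_)
      rw [hux]
      have : (x + I * (-I * σ) : ℂ) = (x + σ : ℝ) := by
        push_cast; linear_combination (-σ : ℂ) * I_sq
      rw [this, ofReal_re]; linarith
    unfold phiAux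
    fun_prop
  refine ⟨(phiAux x (-I * up x)).im, ?_, ?_⟩
  · have e1 : (x + I * (-I * σ) : ℂ) = (x + σ : ℝ) := by
      push_cast; linear_combination (-σ : ℂ) * I_sq
    have e2 : I * x * (-I * σ) = ((x * σ : ℝ) : ℂ) := by
      push_cast; linear_combination (-x * σ : ℂ) * I_sq
    have e3 : (-I * σ) ^ 3 = ((σ ^ 3 : ℝ) : ℂ) * I := by
      push_cast; linear_combination (-σ ^ 3 * I : ℂ) * I_sq
    rw [hux, phiAux, e1, e2, e3, sub_im, add_im, ofReal_im, log_im, arg_ofReal_of_nonneg (by linarith),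
      ← ofReal_neg, im_ofReal_mul, im_ofReal_mul, I_im]
    have : 0 < √2 / 3 * σ ^ 3 := by positivity
    linarith
  · have h1 : Tendsto (fun y : ℝ => (x + y * I : ℂ)) (𝓝[>] 0) (𝓝 x) := by
      have : ContinuousAt (fun y : ℝ => (x + y * I : ℂ)) 0 := by fun_prop
      have h := this.tendsto
      simp only [ofReal_zero, zero_mul, add_zero] at h
      exact h.mono_left nhdsWithin_le_nhds
    have h2 := (continuous_im.continuousAt.comp hc).tendsto.comp h1
    refine h2.congr' ?_
    filter_upwards [self_mem_nhdsWithin] with y hy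
    simp only [Function.comp]
    rw [phi, hroot y hy]

theorem hasDerivAt_phi_im_vertical {x y : ℝ} (hy : 0 < y) :
    HasDerivAt (fun y : ℝ => (phi (x + y * I)).im) (phiDeriv (x + y * I)).re y := by
  simpa using hasDerivAt_im (hasDerivAt_phi_vertical (slit_of_im_ne hy.ne'))

theorem strictMonoOn_phi_im {x : ℝ} (hx : 0 < x) :
    StrictMonoOn (fun y : ℝ => (phi (x + y * I)).im) (Ioi 0) := by
  refine strictMonoOn_of_deriv_pos (convex_Ioi 0)
    (fun y hy => (hasDerivAt_phi_im_vertical hy).continuousAt.continuousWithinAt) fun y hy => ?_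
  rw [interior_Ioi] at hy
  rw [(hasDerivAt_phi_im_vertical hy).deriv]
  exact phiDeriv_re_pos (by simpa using hx) (by simpa using hy)

theorem exists_phi_im_eq_zero {x : ℝ} (hx : 1 < x) :
    ∃ y : ℝ, 0 < y ∧ (phi (x + y * I)).im = 0 := by
  obtain ⟨c, hc, ht⟩ := tendsto_phi_im_ray hx
  obtain ⟨a, ha, ha0⟩ : ∃ a : ℝ, 0 < a ∧ (phi (x + a * I)).im < 0 := by
    have h1 := ht.eventually (gt_mem_nhds hc)
    obtain ⟨a, h, h'⟩ := (h1.and self_mem_nhdsWithin).exists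
    exact ⟨a, h', h⟩
  set f : ℝ → ℝ := fun y => (phi (x + y * I)).im with hf
  -- The derivative of f is at least 2√2 xy ≥ 2y, so f grows at least as fast as y².
  have hm : MonotoneOn (fun y => f y - y ^ 2) (Ioi 0) := by
    have hd : ∀ y : ℝ, 0 < y → HasDerivAt (fun y => f y - y ^ 2)
        ((phiDeriv (x + y * I)).re - 2 * y) y := fun y hy => by
      exact ((hasDerivAt_phi_im_vertical hy).fun_sub (hasDerivAt_pow 2 y)).congr_deriv (by simp)
    refine monotoneOn_of_deriv_nonneg (convex_Ioi 0)
      (fun y hy => (hd y hy).continuousAt.continuousWithinAt) (fun y hy => ?_) fun y hy => ?_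
    · rw [interior_Ioi] at hy; exact (hd y hy).differentiableAt.differentiableWithinAt
    · rw [interior_Ioi] at hy
      have hy' : 0 < y := hy
      rw [(hd y hy).deriv]
      have h := two_mul_le_phiDeriv_re (p := x + y * I) (by simp; linarith) (by simpa using hy)
      simp at h
      have h2 : 1 ≤ √2 := Real.one_le_sqrt.2 (by norm_num)
      have h3 : y ≤ x * y := by nlinarith
      have h4 : x * y ≤ √2 * (x * y) := by nlinarith
      linarith
  -- Chosen so that b² - a² > -f(a), whence f(b) > 0.
  set b := a + √(-f a) + 1 with hb
  have hfa : 0 < -f a := by simpa [hf] using ha0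
  have hsq : √(-f a) ^ 2 = -f a := Real.sq_sqrt hfa.le
  have hs0 : 0 ≤ √(-f a) := Real.sqrt_nonneg _
  have hab : a ≤ b := by linarith
  have hfb : 0 < f b := by
    have := hm (mem_Ioi.2 ha) (mem_Ioi.2 (by linarith)) hab
    simp only at this
    nlinarith
  have hcont : ContinuousOn f (Icc a b) := fun y hy =>
    (hasDerivAt_phi_im_vertical (lt_of_lt_of_le ha hy.1)).continuousAt.continuousWithinAt
  obtain ⟨y, hy, hy0⟩ := intermediate_value_Ioo hab hcont
    (show (0 : ℝ) ∈ Ioo _ _ from ⟨by linarith, hfb⟩)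
  exact ⟨y, lt_trans ha hy.1, hy0⟩

/-- The equation of the contour in normalized coordinates. -/
def OnContour (x y : ℝ) : Prop :=
  (|x| < 1 ∧ y ∈ Ioo (-√2) 0 ∧ (phi (x + y * I)).re = 0) ∨ (|x| = 1 ∧ y = 0) ∨
    (1 < |x| ∧ 0 < y ∧ (phi ((|x| : ℝ) + y * I)).im = 0)

theorem exists_onContour (x : ℝ) : ∃ y, OnContour x y := by
  rcases lt_trichotomy |x| 1 with h | h | h
  · obtain ⟨y, hy, hy0⟩ := exists_phi_re_eq_zero h
    exact ⟨y, Or.inl ⟨h, hy, hy0⟩⟩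
  · exact ⟨0, Or.inr (Or.inl ⟨h, rfl⟩)⟩
  · obtain ⟨y, hy, hy0⟩ := exists_phi_im_eq_zero h
    exact ⟨y, Or.inr (Or.inr ⟨h, hy, hy0⟩)⟩

/-- The contour is the graph of this function in normalized coordinates. -/
def height (x : ℝ) : ℝ := (exists_onContour x).choose

theorem onContour_height (x : ℝ) : OnContour x (height x) := (exists_onContour x).choose_spec

theorem height_mid {x : ℝ} (hx : |x| < 1) :
    height x ∈ Ioo (-√2) 0 ∧ (phi (x + height x * I)).re = 0 := by
  rcases onContour_height x with h | h | h
  · exact h.2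
  · exact absurd h.1 hx.ne
  · exact absurd h.1 hx.not_gt

theorem height_of_abs_eq_one {x : ℝ} (hx : |x| = 1) : height x = 0 := by
  rcases onContour_height x with h | h | h
  · exact absurd hx h.1.ne
  · exact h.2
  · exact absurd hx h.1.ne'

theorem height_out {x : ℝ} (hx : 1 < |x|) :
    0 < height x ∧ (phi ((|x| : ℝ) + height x * I)).im = 0 := by
  rcases onContour_height x with h | h | h
  · exact absurd h.1 hx.not_gt
  · exact absurd h.1 hx.ne'
  · exact h.2

theorem eq_height_of_mid {x y : ℝ} (hx : |x| < 1) (hy : y ∈ Icc (-√2) 0)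
    (h : (phi (x + y * I)).re = 0) : y = height x :=
  (strictAntiOn_phi_re hx.le).injOn hy (Ioo_subset_Icc_self (height_mid hx).1)
    (h.trans (height_mid hx).2.symm)

theorem eq_height_of_out {x y : ℝ} (hx : 1 < |x|) (hy : 0 < y)
    (h : (phi ((|x| : ℝ) + y * I)).im = 0) : y = height x :=
  (strictMonoOn_phi_im (by linarith)).injOn (mem_Ioi.2 hy) (height_out hx).1
    (h.trans (height_out hx).2.symm)

theorem height_neg (x : ℝ) : height (-x) = height x := by
  rcases lt_trichotomy |x| 1 with h | h | h
  · refine eq_height_of_mid h (Ioo_subset_Icc_self (height_mid ((abs_neg x).symm ▸ h)).1) ?_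
    have h1 := (height_mid (x := -x) (by rwa [abs_neg])).2
    rw [phi_re_neg (slit_of_abs_lt h)] at h1
    exact h1
  · rw [height_of_abs_eq_one h, height_of_abs_eq_one (by rwa [abs_neg])]
  · have h1 := height_out (x := -x) (by rwa [abs_neg])
    rw [abs_neg] at h1
    exact eq_height_of_out h h1.1 h1.2

theorem height_nonneg {x : ℝ} (hx : 1 ≤ |x|) : 0 ≤ height x := by
  rcases hx.eq_or_lt with h | h
  · rw [height_of_abs_eq_one h.symm]
  · exact (height_out h).1.le

theorem neg_sqrt_two_lt_height (x : ℝ) : -√2 < height x := by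
  have : 0 < √2 := by positivity
  rcases lt_or_ge |x| 1 with h | h
  · exact (height_mid h).1.1
  · linarith [height_nonneg h]

/-- The case |x| = 1 is the one used later: it gives the sign of Re phi on the lateral sides of the
box that encloses the trajectory. -/
theorem phi_re_pos_below {x y : ℝ} (hx : |x| ≤ 1) (hy : y ∈ Icc (-√2) 0) (h : y < height x) :
    0 < (phi (x + y * I)).re := by
  have h1 : height x ∈ Icc (-√2) 0 ∧ (phi (x + height x * I)).re = 0 := by
    rcases hx.lt_or_eq with h | h
    · exact ⟨Ioo_subset_Icc_self (height_mid h).1, (height_mid h).2⟩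
    · rw [height_of_abs_eq_one h]
      refine ⟨⟨by simp, le_rfl⟩, ?_⟩
      rcases eq_or_eq_neg_of_abs_eq h with h | h
      · simp [h, phi_one]
      · simp [h, phi_neg_one]
  have := strictAntiOn_phi_re hx hy h1.1 h
  simp only at this
  linarith [h1.2]

/-! ### Analyticity of the height function -/

/-- A level set of the imaginary part of a holomorphic function `f` is, near a point where
`Re f' ≠ 0`, the graph of a real-analytic function. -/
theorem exists_analytic_graph {f : ℂ → ℂ} {p : ℂ} (hf : AnalyticAt ℂ f p)
    (h : (deriv f p).re ≠ 0) :
    ∃ γ : ℝ → ℝ, AnalyticAt ℝ γ p.re ∧ γ p.re = p.im ∧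
      HasDerivAt γ (-(deriv f p).im / (deriv f p).re) p.re ∧
      ∀ᶠ x in 𝓝 p.re, (f (x + γ x * I)).im = (f p).im := by
  have h0 : deriv f p ≠ 0 := fun h' => h (by rw [h']; rfl)
  set q := hf.hasStrictDerivAt.localInverse _ _ _ h0 with hq
  have hqa : AnalyticAt ℂ q (f p) := hf.analyticAt_localInverse h0
  have hqp : q (f p) = p := HasStrictFDerivAt.localInverse_apply_image ..
  have hqi : ∀ᶠ w in 𝓝 (f p), f (q w) = w := HasStrictDerivAt.eventually_right_inverse ..
  have hqd : HasDerivAt q (deriv f p)⁻¹ (f p) := (hf.hasStrictDerivAt.to_localInverse h0).hasDerivAt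
  -- The level curve is the image under the local inverse q of the horizontal line through f(p). Its
  -- abscissa X(τ) has derivative Re(1/f'(p)) ≠ 0 at τ = 0, so it can be reparametrized by X.
  set s : ℝ → ℂ := fun τ => f p + τ with hs
  have hs0 : s 0 = f p := by simp [hs]
  have hsa : AnalyticAt ℝ s 0 := by
    have : AnalyticAt ℝ (fun τ : ℝ => (τ : ℂ)) 0 := ofRealCLM.analyticAt 0
    exact analyticAt_const.add this
  have hqs : AnalyticAt ℝ (fun τ => q (s τ)) 0 := by
    refine AnalyticAt.comp (g := q) ?_ hsa
    rw [hs0]; exact hqa.restrictScalars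
  have hsd : HasDerivAt s 1 0 := by
    exact (((hasDerivAt_id (0 : ℝ)).ofReal_comp).const_add (f p)).congr_deriv (by simp)
  have hqsd : HasDerivAt (fun τ => q (s τ)) (deriv f p)⁻¹ 0 := by
    have := HasDerivAt.comp (0 : ℝ) (h₂ := q) (by rw [hs0]; exact hqd) hsd
    rwa [mul_one] at this
  set X : ℝ → ℝ := fun τ => (q (s τ)).re with hX
  have hXa : AnalyticAt ℝ X 0 := (reCLM.analyticAt _).comp hqs
  have hXd : HasDerivAt X ((deriv f p)⁻¹).re 0 := hasDerivAt_re hqsd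
  have hn : normSq (deriv f p) ≠ 0 := fun h' => h0 (normSq_eq_zero.1 h')
  have hX0 : deriv X 0 ≠ 0 := by
    rw [hXd.deriv, inv_re]; exact div_ne_zero h hn
  have hX00 : X 0 = p.re := by simp [hX, hs0, hqp]
  set τ := hXa.hasStrictDerivAt.localInverse _ _ _ hX0 with hτ
  have hτa : AnalyticAt ℝ τ p.re := hX00 ▸ hXa.analyticAt_localInverse hX0
  have hτ0 : τ p.re = 0 := by rw [← hX00]; exact HasStrictFDerivAt.localInverse_apply_image ..
  have hτi : ∀ᶠ x in 𝓝 p.re, X (τ x) = x := by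
    rw [← hX00]; exact HasStrictDerivAt.eventually_right_inverse ..
  have hτd : HasDerivAt τ (deriv X 0)⁻¹ p.re := by
    have := (hXa.hasStrictDerivAt.to_localInverse hX0).hasDerivAt
    rwa [hX00] at this
  refine ⟨fun x => (q (s (τ x))).im, ?_, ?_, ?_, ?_⟩
  · refine (imCLM.analyticAt _).comp (AnalyticAt.comp (g := fun τ => q (s τ)) ?_ hτa)
    rw [hτ0]; exact hqs
  · simp only [hτ0, hs0, hqp]
  · have h1 : HasDerivAt (fun x => q (s (τ x))) ((deriv X 0)⁻¹ • (deriv f p)⁻¹) p.re :=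
      HasDerivAt.scomp p.re (g₁ := fun τ => q (s τ)) (by rw [hτ0]; exact hqsd) hτd
    have h2 := hasDerivAt_im h1
    refine h2.congr_deriv ?_
    rw [smul_im, inv_im, hXd.deriv, inv_re, smul_eq_mul]
    field_simp
  · have hτc : Tendsto (fun x => s (τ x)) (𝓝 p.re) (𝓝 (f p)) := by
      have h1 : ContinuousAt (fun x => s (τ x)) p.re :=
        ContinuousAt.comp (g := s) (by rw [hτ0]; exact hsa.continuousAt) hτa.continuousAt
      simpa [ContinuousAt, hτ0, hs0] using h1
    filter_upwards [hτi, hτc.eventually hqi] with x hx hx'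
    have e : (x + ((q (s (τ x))).im : ℝ) * I : ℂ) = q (s (τ x)) := by
      conv_rhs => rw [← re_add_im (q (s (τ x)))]
      rw [show (q (s (τ x))).re = x from hx]
    rw [e, hx']
    simp [hs]

theorem analyticAt_phi {p : ℂ} (hp : p ∈ slit) : AnalyticAt ℂ phi p :=
  differentiableOn_phi.analyticAt (isOpen_slit.mem_nhds hp)

theorem analyticAt_height_mid {x : ℝ} (hx : |x| < 1) : AnalyticAt ℝ height x := by
  obtain ⟨hy, h0⟩ := height_mid hx
  set p : ℂ := x + height x * I with hp
  have hre : p.re = x := by simp [hp]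
  have him : p.im = height x := by simp [hp]
  have hps : p ∈ slit := slit_of_abs_lt hx
  -- The factor i turns the level line of Re phi into one of an imaginary part.
  have hd : HasDerivAt (fun p => I * phi p) (I * phiDeriv p) p := (hasDerivAt_phi hps).const_mul I
  obtain ⟨γ, hγ, hγ0, -, hγe⟩ := exists_analytic_graph (f := fun p => I * phi p) (p := p)
    (analyticAt_const.mul (analyticAt_phi hps)) (by
      rw [hd.deriv]
      have := phiDeriv_im_pos hps (by rw [him]; exact hy.2.le) (by rw [him]; exact hy.1)
      simpa using this.ne')
  rw [hre] at hγ hγ0 hγe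
  rw [him] at hγ0
  refine hγ.congr ?_
  have h1 : ∀ᶠ t in 𝓝 x, |t| < 1 := continuous_abs.continuousAt.eventually (gt_mem_nhds hx)
  have h2 : ∀ᶠ t in 𝓝 x, γ t ∈ Ioo (-√2) 0 :=
    hγ.continuousAt.eventually (by rw [hγ0]; exact Ioo_mem_nhds hy.1 hy.2)
  filter_upwards [h1, h2, hγe] with t ht1 ht2 ht3
  refine eq_height_of_mid ht1 (Ioo_subset_Icc_self ht2) ?_
  simpa [h0] using ht3

theorem analyticAt_height_gt {x : ℝ} (hx : 1 < x) : AnalyticAt ℝ height x := by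
  have hx' : 1 < |x| := lt_of_lt_of_le hx (le_abs_self x)
  obtain ⟨hy, h0⟩ := height_out hx'
  rw [abs_of_pos (by linarith)] at h0
  set p : ℂ := x + height x * I with hp
  have hre : p.re = x := by simp [hp]
  have him : p.im = height x := by simp [hp]
  have hps : p ∈ slit := slit_of_im_ne hy.ne'
  obtain ⟨γ, hγ, hγ0, -, hγe⟩ := exists_analytic_graph (f := phi) (p := p) (analyticAt_phi hps) (by
      rw [(hasDerivAt_phi hps).deriv]
      exact (phiDeriv_re_pos (by rw [hre]; linarith) (by rw [him]; exact hy)).ne')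
  rw [hre] at hγ hγ0 hγe
  rw [him] at hγ0
  refine hγ.congr ?_
  have h2 : ∀ᶠ t in 𝓝 x, 0 < γ t := hγ.continuousAt.eventually (by rw [hγ0]; exact lt_mem_nhds hy)
  filter_upwards [lt_mem_nhds hx, h2, hγe] with t ht1 ht2 ht3
  refine eq_height_of_out (lt_of_lt_of_le ht1 (le_abs_self t)) ht2 ?_
  rw [abs_of_pos (by linarith), ht3, h0]

/-! #### The branch point -/

theorem cpow_half_sq (w : ℂ) : (w ^ (1 / 2 : ℂ)) ^ 2 = w := by
  rw [← cpow_nat_mul]; norm_num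

theorem cpow_half_re_pos {w : ℂ} (hw : w ∈ slitPlane) : 0 < (w ^ (1 / 2 : ℂ)).re := by
  have h0 := slitPlane_ne_zero hw
  rw [cpow_def_of_ne_zero h0, exp_re]
  refine mul_pos (Real.exp_pos _) (Real.cos_pos_of_mem_Ioo ?_)
  have h1 := (mem_slitPlane_iff_arg.1 hw).1
  have h2 := neg_pi_lt_arg w
  have h3 := lt_of_le_of_ne (arg_le_pi w) h1
  have : (log w * (1 / 2)).im = arg w / 2 := by
    rw [show (1 / 2 : ℂ) = ((1 / 2 : ℝ) : ℂ) by norm_num, mul_comm, im_ofReal_mul, log_im]; ring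
  rw [this]; constructor <;> linarith

/-- The regular factor of `phiDeriv` at the branch point `1`. -/
def regFactor (p : ℂ) : ℂ := √2 * (1 + p) ^ (1 / 2 : ℂ) * (p + √2 * I)

/-- The regular factor of `phi` at the branch point `1`. -/
def regPrimitive (p : ℂ) : ℂ := -∫ s in (0 : ℝ)..1, (√s : ℂ) * regFactor (1 + s * (p - 1))

theorem analyticOnNhd_regFactor : AnalyticOnNhd ℂ regFactor (Metric.ball 1 1) := fun p hp => by
  have : 1 + p ∈ slitPlane := by
    left
    have h1 := abs_re_le_norm (p - 1)
    rw [Metric.mem_ball, dist_eq] at hp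
    have h2 := neg_abs_le (p - 1).re
    simp at h1 h2 ⊢
    linarith
  refine (analyticAt_const.mul ?_).mul (analyticAt_id.add analyticAt_const)
  exact (analyticAt_const.add analyticAt_id).cpow analyticAt_const this

theorem segment_mem_ball {p : ℂ} {r : ℝ} (hp : p ∈ Metric.ball (1 : ℂ) r) {s : ℝ}
    (hs : s ∈ Icc (0 : ℝ) 1) : (1 + s * (p - 1) : ℂ) ∈ Metric.ball (1 : ℂ) r := by
  rw [Metric.mem_ball, dist_eq] at hp ⊢
  rw [add_sub_cancel_left, norm_mul, norm_real, Real.norm_of_nonneg hs.1]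
  nlinarith [norm_nonneg (p - 1), hs.1, hs.2]

theorem regPrimitive_one : regPrimitive 1 = -(4 / 3 : ℝ) * (1 + √2 * I) := by
  have h1 : regFactor 1 = 2 * (1 + √2 * I) := by
    have : (1 + 1 : ℂ) ^ (1 / 2 : ℂ) = (√2 : ℝ) := by
      rw [Real.sqrt_eq_rpow, ofReal_cpow (by norm_num)]; norm_num
    rw [regFactor, this, sqrt_two_mul_self]
  have h2 : ∫ s in (0 : ℝ)..1, (√s : ℂ) = (2 / 3 : ℝ) := by
    rw [intervalIntegral.integral_ofReal]
    congr 1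
    simp_rw [Real.sqrt_eq_rpow]
    rw [integral_rpow (Or.inl (by norm_num))]
    norm_num
  simp only [regPrimitive, sub_self, mul_zero, add_zero]
  rw [intervalIntegral.integral_mul_const, h2, h1]
  push_cast; ring

theorem analyticAt_regPrimitive : AnalyticAt ℂ regPrimitive 1 := by
  have hcont := analyticOnNhd_regFactor.continuousOn
  have hdc := analyticOnNhd_regFactor.deriv.continuousOn
  -- On this compact disk the derivative of `regFactor` is bounded, which justifies differentiation
  -- under the integral.
  have hsub : Metric.closedBall (1 : ℂ) (1 / 2) ⊆ Metric.ball 1 1 :=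
    Metric.closedBall_subset_ball (by norm_num)
  obtain ⟨M, hM⟩ := (isCompact_closedBall (1 : ℂ) (1 / 2)).exists_bound_of_continuousOn
    (hdc.mono hsub)
  have hIcc : ∀ s : ℝ, s ∈ uIoc (0 : ℝ) 1 → s ∈ Icc (0 : ℝ) 1 := fun s hs => by
    rw [uIoc_of_le zero_le_one] at hs; exact Ioc_subset_Icc_self hs
  have hcs : ∀ {f : ℂ → ℂ}, ContinuousOn f (Metric.ball 1 1) → ∀ p ∈ Metric.ball (1 : ℂ) 1,
      ContinuousOn (fun s : ℝ => f (1 + s * (p - 1))) (Icc 0 1) := fun hf p hp =>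
    hf.comp (by fun_prop) fun s hs => segment_mem_ball hp hs
  have hd : DifferentiableOn ℂ regPrimitive (Metric.ball 1 (1 / 2)) := by
    intro p hp
    have hp1 := hsub (Metric.ball_subset_closedBall hp)
    refine (HasDerivAt.neg (intervalIntegral.hasDerivAt_integral_of_dominated_loc_of_deriv_le
      (F := fun p (s : ℝ) => (√s : ℂ) * regFactor (1 + s * (p - 1)))
      (F' := fun p (s : ℝ) => (√s : ℂ) * (deriv regFactor (1 + s * (p - 1)) * s))
      (bound := fun _ => M) (μ := volume) (Metric.isOpen_ball.mem_nhds hp) ?_ ?_ ?_ ?_ ?_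
      ?_).2).differentiableAt.differentiableWithinAt
    · filter_upwards [Metric.isOpen_ball.mem_nhds hp] with q hq
      have hq1 := hsub (Metric.ball_subset_closedBall hq)
      refine ContinuousOn.aestronglyMeasurable ?_ measurableSet_uIoc
      rw [uIoc_of_le zero_le_one]
      refine (ContinuousOn.mul (by fun_prop) (hcs hcont q hq1)).mono Ioc_subset_Icc_self
    · refine ContinuousOn.intervalIntegrable_of_Icc zero_le_one ?_
      exact (ContinuousOn.mul (by fun_prop) (hcs hcont p hp1))
    · refine ContinuousOn.aestronglyMeasurable ?_ measurableSet_uIoc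
      rw [uIoc_of_le zero_le_one]
      exact (ContinuousOn.mul (by fun_prop) ((hcs hdc p hp1).mul (by fun_prop))).mono
        Ioc_subset_Icc_self
    · refine Eventually.of_forall fun s hs q hq => ?_
      have hs' := hIcc s hs
      have h1 := hM _ (Metric.ball_subset_closedBall (segment_mem_ball hq hs'))
      have hM0 : 0 ≤ M := (norm_nonneg _).trans h1
      have h2 : ‖(√s : ℂ)‖ ≤ 1 := by
        rw [norm_real, Real.norm_of_nonneg (Real.sqrt_nonneg _)]
        exact Real.sqrt_le_one.2 hs'.2
      have h3 : ‖(s : ℂ)‖ ≤ 1 := by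
        rw [norm_real, Real.norm_of_nonneg hs'.1]; exact hs'.2
      calc _ = ‖(√s : ℂ)‖ * (‖deriv regFactor (1 + s * (q - 1))‖ * ‖(s : ℂ)‖) := by
            rw [norm_mul, norm_mul]
        _ ≤ 1 * (M * 1) := by gcongr
        _ = M := by ring
    · exact intervalIntegrable_const
    · refine Eventually.of_forall fun s hs q hq => ?_
      have hs' := hIcc s hs
      have h1 := (analyticOnNhd_regFactor _ (hsub (Metric.ball_subset_closedBall
        (segment_mem_ball hq hs')))).differentiableAt.hasDerivAt
      have h2 : HasDerivAt (fun q : ℂ => 1 + s * (q - 1)) (s : ℂ) q := by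
        simpa using (((hasDerivAt_id q).sub_const 1).const_mul (s : ℂ)).const_add 1
      exact (h1.comp q h2).const_mul _
  exact hd.analyticAt (Metric.ball_mem_nhds 1 (by norm_num))

/-- Integrating phi' along the segment from 1 to p, the root factors as √s (1 - p)^{1/2} times a
regular factor, so phi(p) is (p - 1)(1 - p)^{1/2} times an integral analytic in p. Squaring removes
the half-integer power. -/
theorem phi_sq_eq {p : ℂ} (hp : p ∈ Metric.ball (1 : ℂ) 1) (hps : p ∈ slit) :
    phi p ^ 2 = (1 - p) ^ 3 * regPrimitive p ^ 2 := by
  have hs : ∀ s : ℝ, 0 < s → (1 + s * (p - 1) : ℂ) = (1 + s * (p.re - 1) : ℝ) + (s * p.im : ℝ) * I :=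
    fun s _ => by apply Complex.ext <;> simp
  have habs : |p.re| < 1 → 0 < p.re := fun h => by
    have h1 := abs_re_le_norm (p - 1)
    rw [Metric.mem_ball, dist_eq] at hp
    have h2 := neg_abs_le (p - 1).re
    simp at h1 h2
    linarith
  have hmem : ∀ s : ℝ, s ∈ Ioc (0 : ℝ) 1 → (1 + s * (p - 1) : ℂ) ∈ slit := fun s h => by
    rw [hs s h.1]
    by_cases hi : p.im = 0
    · refine slit_of_abs_lt ?_
      have h1 : |p.re| < 1 := (mem_slit_iff.1 hps).resolve_left (by simpa using hi)
      have h2 := habs h1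
      rw [abs_lt] at h1 ⊢
      constructor <;> nlinarith [h.1, h.2]
    · exact slit_of_im_ne (mul_ne_zero h.1.ne' hi)
  set A := (1 - p) ^ (1 / 2 : ℂ) with hA
  have hAs : 1 - p ∈ slitPlane := by
    rcases mem_slit_iff.1 hps with h | h
    · right; simpa using h
    · left; simp; linarith [(abs_lt.1 h).2]
  have hA0 := cpow_half_re_pos hAs
  have hA2 : A ^ 2 = 1 - p := cpow_half_sq _
  have hroot : ∀ s : ℝ, s ∈ Ioc (0 : ℝ) 1 →
      root (1 + s * (p - 1)) = √s * A * (1 + (1 + s * (p - 1))) ^ (1 / 2 : ℂ) := fun s h => by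
    set B := (1 + (1 + s * (p - 1))) ^ (1 / 2 : ℂ) with hB
    have hB2 : B ^ 2 = 1 + (1 + s * (p - 1)) := cpow_half_sq _
    have hBs : 1 + (1 + s * (p - 1)) ∈ slitPlane := by
      left
      have h1 := abs_re_le_norm (p - 1)
      rw [Metric.mem_ball, dist_eq] at hp
      have h2 := neg_abs_le (p - 1).re
      simp at h1 h2 ⊢
      nlinarith [h.1, h.2]
    have hB0 := cpow_half_re_pos hBs
    have e : ((√s : ℝ) : ℂ) ^ 2 = s := by rw [← ofReal_pow, Real.sq_sqrt h.1.le]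
    have hs0 : 0 < √s := Real.sqrt_pos.2 h.1
    refine (eq_root_of_sq_of_re_pos (hmem s h) ?_ ?_).symm
    · rw [mul_pow, mul_pow, hA2, hB2, e]; ring
    · rw [mul_assoc, re_ofReal_mul, mul_re]
      have hAi := congrArg im hA2
      have hBi := congrArg im hB2
      simp [sq] at hAi hBi
      -- Im A and Im B have opposite signs, so A B has positive real part and is the principal root.
      have h5 : (A.re * B.re) * (A.im * B.im) ≤ 0 := by
        have : (A.re * B.re) * (A.im * B.im) = -(s * p.im ^ 2) / 4 := by
          have h6 : A.re * A.im = -p.im / 2 := by linarith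
          have h7 : B.re * B.im = s * p.im / 2 := by linarith
          calc _ = (A.re * A.im) * (B.re * B.im) := by ring
            _ = _ := by rw [h6, h7]; ring
        rw [this]
        have := mul_nonneg h.1.le (sq_nonneg p.im)
        linarith
      have h6 : 0 < A.re * B.re := mul_pos hA0 hB0
      have h7 : A.im * B.im ≤ 0 := by
        by_contra hc
        exact absurd h5 (not_le.2 (mul_pos h6 (not_le.1 hc)))
      exact mul_pos hs0 (by linarith)
  have hcont : ContinuousOn (fun s : ℝ => phi (1 + s * (p - 1))) (Icc 0 1) := fun s hs => by
    have h1 : ContinuousAt (fun s : ℝ => (1 + s * (p - 1) : ℂ)) s := by fun_prop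
    refine (ContinuousAt.comp (g := phi) ?_ h1).continuousWithinAt
    rcases hs.1.eq_or_lt with h | h
    · rw [← h]; simpa using continuousAt_phi_one
    · exact (hasDerivAt_phi (hmem s ⟨h, hs.2⟩)).continuousAt
  have hball : ∀ s ∈ Icc (0 : ℝ) 1, (1 + s * (p - 1) : ℂ) ∈ Metric.ball (1 : ℂ) 1 :=
    fun s h => segment_mem_ball hp h
  have hderiv : ∀ s ∈ Ioo (0 : ℝ) 1, HasDerivAt (fun s : ℝ => phi (1 + s * (p - 1)))
      ((p - 1) * A * ((√s : ℂ) * regFactor (1 + s * (p - 1)))) s := fun s h => by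
    have h2 : HasDerivAt (fun s : ℝ => (1 + s * (p - 1) : ℂ)) (p - 1) s := by
      simpa using ((hasDerivAt_id s).ofReal_comp.mul_const (p - 1)).const_add 1
    refine ((hasDerivAt_phi (hmem s (Ioo_subset_Ioc_self h))).comp s h2).congr_deriv ?_
    rw [phiDeriv, hroot s (Ioo_subset_Ioc_self h), regFactor]
    ring
  have hint : IntervalIntegrable
      (fun s : ℝ => (p - 1) * A * ((√s : ℂ) * regFactor (1 + s * (p - 1)))) volume 0 1 := by
    refine ContinuousOn.intervalIntegrable_of_Icc zero_le_one ?_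
    refine ContinuousOn.mul (by fun_prop) (ContinuousOn.mul (by fun_prop) ?_)
    exact analyticOnNhd_regFactor.continuousOn.comp (by fun_prop) hball
  have hftc := intervalIntegral.integral_eq_sub_of_hasDerivAt_of_le zero_le_one hcont hderiv hint
  rw [intervalIntegral.integral_const_mul] at hftc
  have e1 : (1 + (1 : ℝ) * (p - 1) : ℂ) = p := by push_cast; ring
  have e0 : (1 + (0 : ℝ) * (p - 1) : ℂ) = 1 := by push_cast; ring
  rw [e1, e0, phi_one, sub_zero] at hftc
  rw [← hftc, regPrimitive, neg_sq, mul_pow, mul_pow, hA2]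
  ring

theorem eventually_sign_of_hasDerivAt_pos {f : ℝ → ℝ} {f' x : ℝ} (hf : HasDerivAt f f' x)
    (h0 : f x = 0) (h : 0 < f') : ∀ᶠ y in 𝓝 x, (x < y → 0 < f y) ∧ (y < x → f y < 0) := by
  have h1 := (hasDerivAt_iff_tendsto_slope.1 hf).eventually (lt_mem_nhds h)
  rw [eventually_nhdsWithin_iff] at h1
  filter_upwards [h1] with y hy
  constructor
  · intro hxy
    have := hy hxy.ne'
    rw [slope_def_field, h0, sub_zero] at this
    exact (div_pos_iff_of_pos_right (sub_pos.2 hxy)).1 this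
  · intro hxy
    have := hy hxy.ne
    rw [slope_def_field, h0, sub_zero] at this
    by_contra hc
    exact absurd this (not_lt.2 (div_nonpos_of_nonneg_of_nonpos (not_lt.1 hc) (by linarith)))

/-- The square of `phi` is locally the cube of a conformal map at the branch point. -/
theorem exists_conformal_cube_root : ∃ ψ : ℂ → ℂ, AnalyticAt ℂ ψ 1 ∧ ψ 1 = 0 ∧
    0 < (deriv ψ 1).re ∧ (deriv ψ 1).im < 0 ∧
    ∀ᶠ p in 𝓝 (1 : ℂ), p ∈ slit → phi p ^ 2 = ψ p ^ 3 := by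
  set a : ℂ := regPrimitive 1 with ha
  have ha1 : a = -(4 / 3 : ℝ) * (1 + √2 * I) := regPrimitive_one
  have ha0 : a ≠ 0 := by
    rw [ha1]
    intro h
    have := congrArg re h
    simp at this
  have hW : (a ^ 2).re < 0 ∧ 0 < (a ^ 2).im := by
    have : a ^ 2 = ((-16 / 9 : ℝ) : ℂ) + ((32 / 9 * √2 : ℝ) : ℂ) * I := by
      rw [ha1]; push_cast
      linear_combination (16 / 9 * √2 ^ 2 : ℂ) * I_sq - 16 / 9 * sqrt_two_sq
    rw [this, add_re, add_im, re_ofReal_mul, im_ofReal_mul, I_re, I_im, ofReal_re, ofReal_im]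
    constructor
    · norm_num
    · simp
  have harg1 : Real.pi / 2 < arg (a ^ 2) := by
    by_contra hc
    have h1 : 0 ≤ arg (a ^ 2) := arg_nonneg_iff.2 hW.2.le
    have := abs_arg_le_pi_div_two_iff.1
      (abs_le.2 ⟨by linarith [Real.pi_pos], not_lt.1 hc⟩ : |arg (a ^ 2)| ≤ Real.pi / 2)
    linarith [hW.1]
  have harg2 : arg (a ^ 2) < Real.pi := by
    refine lt_of_le_of_ne (arg_le_pi _) fun h => ?_
    exact hW.2.ne' (arg_eq_pi_iff.1 h).2
  -- Of the three cube roots of a² this one is selected: arg(a²) lies in (π/2, π), so the argument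
  -- of e lies in (5π/6, π) and the derivative -e of ψ at 1 is in the fourth quadrant.
  set e : ℂ := exp (log (a ^ 2) / 3 + 2 * Real.pi / 3 * I) with he
  have he3 : e ^ 3 = a ^ 2 := by
    have : ((3 : ℕ) : ℂ) * (log (a ^ 2) / 3 + 2 * Real.pi / 3 * I) =
        log (a ^ 2) + 2 * Real.pi * I := by push_cast; ring
    rw [he, ← exp_nat_mul, this, exp_periodic, exp_log (pow_ne_zero 2 ha0)]
  have heim : (log (a ^ 2) / 3 + 2 * Real.pi / 3 * I).im = arg (a ^ 2) / 3 + 2 * Real.pi / 3 := by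
    have h3 : (log (a ^ 2) / 3 : ℂ) = ((1 / 3 : ℝ) : ℂ) * log (a ^ 2) := by push_cast; ring
    have h4 : (2 * Real.pi / 3 * I : ℂ) = ((2 * Real.pi / 3 : ℝ) : ℂ) * I := by push_cast; ring
    rw [h3, h4, add_im, im_ofReal_mul, im_ofReal_mul, log_im, I_im]; ring
  have here : e.re < 0 := by
    rw [he, exp_re, heim]
    refine mul_neg_of_pos_of_neg (Real.exp_pos _)
      (Real.cos_neg_of_pi_div_two_lt_of_lt ?_ ?_) <;> linarith
  have heim' : 0 < e.im := by
    rw [he, exp_im, heim]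
    refine mul_pos (Real.exp_pos _) (Real.sin_pos_of_pos_of_lt_pi ?_ ?_) <;> linarith
  set κ : ℂ → ℂ := fun p => (regPrimitive p / a) ^ (2 / 3 : ℂ) with hκ
  have hκa : AnalyticAt ℂ κ 1 := by
    refine (analyticAt_regPrimitive.div_const).cpow analyticAt_const ?_
    rw [← ha, div_self ha0]; simp
  have hκ1 : κ 1 = 1 := by simp only [hκ]; rw [← ha, div_self ha0, one_cpow]
  have hκ3 : ∀ p, κ p ^ 3 = (regPrimitive p / a) ^ 2 := fun p => by
    simp only [hκ]
    rw [← cpow_nat_mul]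
    norm_num
  have hψa : AnalyticAt ℂ (fun p => (1 - p) * (κ p * e)) 1 :=
    (analyticAt_const.sub analyticAt_id).mul (hκa.mul analyticAt_const)
  have hψd : HasDerivAt (fun p => (1 - p) * (κ p * e)) (-e) 1 := by
    have h1 : HasDerivAt (fun p : ℂ => 1 - p) (-1) 1 := (hasDerivAt_id (1 : ℂ)).const_sub 1
    have h2 := (hκa.differentiableAt.hasDerivAt.mul_const e)
    refine (h1.fun_mul h2).congr_deriv ?_
    rw [hκ1]; ring
  refine ⟨_, hψa, by simp, by rw [hψd.deriv, neg_re]; linarith,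
    by rw [hψd.deriv, neg_im]; linarith, ?_⟩
  filter_upwards [Metric.ball_mem_nhds (1 : ℂ) one_pos] with p hp hps
  rw [phi_sq_eq hp hps, mul_pow, mul_pow, he3, hκ3]
  field_simp

/-- The curve Im ψ = 0 has positive slope at 1 and Re ψ increases along it. To the left it is below
the axis with phi² = ψ³ < 0, so Re phi = 0; to the right it is above the axis with phi² > 0, so Im
phi = 0. Uniqueness of the heights identifies it with the graph on both sides. -/
theorem analyticAt_height_one : AnalyticAt ℝ height 1 := by
  obtain ⟨ψ, hψ, hψ1, hre, him, hev⟩ := exists_conformal_cube_root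
  obtain ⟨γ, hγ, hγ0, hγd, hγe⟩ := exists_analytic_graph hψ hre.ne'
  rw [one_re] at hγ hγ0 hγd hγe
  rw [one_im] at hγ0
  rw [hψ1, zero_im] at hγe
  have hslope : 0 < -(deriv ψ 1).im / (deriv ψ 1).re := div_pos (by linarith) hre
  have hγs := eventually_sign_of_hasDerivAt_pos hγd hγ0 hslope
  have hpath : HasDerivAt (fun x : ℝ => (x + γ x * I : ℂ))
      (1 + ((-(deriv ψ 1).im / (deriv ψ 1).re : ℝ) : ℂ) * I) 1 := by
    exact ((hasDerivAt_id (1 : ℝ)).ofReal_comp.add (hγd.ofReal_comp.mul_const I)).congr_deriv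
      (by simp)
  have hp1 : ((1 : ℝ) + γ 1 * I : ℂ) = 1 := by simp [hγ0]
  have hψp : HasDerivAt (fun x : ℝ => ψ (x + γ x * I))
      (deriv ψ 1 * (1 + ((-(deriv ψ 1).im / (deriv ψ 1).re : ℝ) : ℂ) * I)) 1 := by
    refine HasDerivAt.comp (1 : ℝ) (h₂ := ψ) ?_ hpath
    rw [hp1]; exact hψ.differentiableAt.hasDerivAt
  have hψs := eventually_sign_of_hasDerivAt_pos (hasDerivAt_re hψp) (by rw [hp1, hψ1, zero_re]) (by
    simp only [mul_re, add_re, one_re, I_re, ofReal_re, ofReal_im, add_im, one_im, mul_im, I_im]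
    have := mul_pos_of_neg_of_neg him (by linarith : -(-(deriv ψ 1).im / (deriv ψ 1).re) < 0)
    linarith)
  have hcont : Tendsto (fun x : ℝ => (x + γ x * I : ℂ)) (𝓝 1) (𝓝 1) := by
    have := hpath.continuousAt
    rwa [ContinuousAt, hp1] at this
  have hγc := hγ.continuousAt.eventually (lt_mem_nhds (b := γ 1) (a := -√2) (by simp [hγ0]))
  refine hγ.congr ?_
  filter_upwards [hγe, hγs, hψs, hcont.eventually hev, hγc, lt_mem_nhds (zero_lt_one' ℝ)]
    with x h1 h2 h3 h4 h5 h6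
  have hψr : ψ (x + γ x * I) = ((ψ (x + γ x * I)).re : ℝ) := by
    apply Complex.ext <;> simp [h1]
  set r := (ψ (x + γ x * I)).re with hr
  have hsq : x ∈ ({1} : Set ℝ)ᶜ → phi (x + γ x * I) ^ 2 = ((r ^ 3 : ℝ) : ℂ) := fun hx => by
    rw [h4 (slit_of_im_ne ?_), hψr]
    · push_cast; rfl
    · rcases lt_or_gt_of_ne (show x ≠ 1 from hx) with h | h
      · exact (h2.2 h).ne
      · exact (h2.1 h).ne'
  rcases lt_trichotomy x 1 with hx | hx | hx
  · have h7 := hsq hx.ne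
    have h8 : r ^ 3 < 0 := Odd.pow_neg ⟨1, by norm_num⟩ (h3.2 hx)
    refine eq_height_of_mid (by rw [abs_lt]; constructor <;> linarith) ⟨h5.le, (h2.2 hx).le⟩ ?_
    have e1 := congrArg re h7
    have e2 := congrArg im h7
    rw [ofReal_re] at e1
    rw [ofReal_im] at e2
    simp only [sq, mul_re, mul_im] at e1 e2
    by_contra hc
    have : (phi (x + γ x * I)).im = 0 := by
      have : (phi (x + γ x * I)).re * (phi (x + γ x * I)).im = 0 := by linarith
      exact (mul_eq_zero.1 this).resolve_left hc
    rw [this] at e1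
    nlinarith [mul_self_nonneg (phi (x + γ x * I)).re]
  · rw [hx, hγ0, height_of_abs_eq_one (by simp)]
  · have h7 := hsq hx.ne'
    have h8 : 0 < r ^ 3 := pow_pos (h3.1 hx) 3
    refine eq_height_of_out (lt_of_lt_of_le hx (le_abs_self x)) (h2.1 hx) ?_
    rw [abs_of_pos (by linarith)]
    have e1 := congrArg re h7
    have e2 := congrArg im h7
    rw [ofReal_re] at e1
    rw [ofReal_im] at e2
    simp only [sq, mul_re, mul_im] at e1 e2
    by_contra hc
    have : (phi (x + γ x * I)).re = 0 := by
      have : (phi (x + γ x * I)).re * (phi (x + γ x * I)).im = 0 := by linarith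
      exact (mul_eq_zero.1 this).resolve_right hc
    rw [this] at e1
    nlinarith [mul_self_nonneg (phi (x + γ x * I)).im]

theorem analyticAt_height_neg {x : ℝ} (h : AnalyticAt ℝ height x) : AnalyticAt ℝ height (-x) := by
  have h1 : AnalyticAt ℝ (fun t : ℝ => height (-t)) (-x) :=
    AnalyticAt.comp (g := height) (by rwa [neg_neg]) (analyticAt_id.neg)
  exact h1.congr (Eventually.of_forall height_neg)

theorem analyticAt_height (x : ℝ) : AnalyticAt ℝ height x := by
  have key : ∀ x : ℝ, 0 ≤ x → AnalyticAt ℝ height x := fun x hx => by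
    rcases lt_trichotomy x 1 with h | h | h
    · exact analyticAt_height_mid (by rwa [abs_of_nonneg hx])
    · rw [h]; exact analyticAt_height_one
    · exact analyticAt_height_gt h
  rcases le_total 0 x with h | h
  · exact key x h
  · rw [← neg_neg x]; exact analyticAt_height_neg (key _ (by linarith))

/-! ### The contour as a graph -/

/-- The normalized coordinate `(z - i) / √2`. -/
def nrm (z : ℂ) : ℂ := (z - I) / √2

/-- The point with a given normalized coordinate. -/
def denrm (p : ℂ) : ℂ := √2 * p + I

theorem nrm_denrm (p : ℂ) : nrm (denrm p) = p := by
  have := sqrt_two_ne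
  simp only [nrm, denrm]; field_simp; ring

theorem denrm_nrm (z : ℂ) : denrm (nrm z) = z := by
  have := sqrt_two_ne
  simp only [nrm, denrm]; field_simp; ring

theorem continuous_nrm : Continuous nrm := by unfold nrm; fun_prop

theorem continuous_denrm : Continuous denrm := by unfold denrm; fun_prop

theorem hasDerivAt_nrm (z : ℂ) : HasDerivAt nrm (1 / √2) z :=
  ((hasDerivAt_id z).sub_const I).div_const _

theorem hasDerivAt_denrm (p : ℂ) : HasDerivAt denrm √2 p := by
  unfold denrm
  simpa using ((hasDerivAt_id p).const_mul (√2 : ℂ)).add_const I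

theorem nrm_z₁ : nrm z₁ = -1 := by
  have := sqrt_two_ne
  simp only [nrm, z₁]; field_simp; ring

theorem nrm_z₂ : nrm z₂ = 1 := by
  have := sqrt_two_ne
  simp only [nrm, z₂]; field_simp; ring

theorem nrm_injective : Function.Injective nrm := Function.LeftInverse.injective denrm_nrm

theorem Q_eq (z : ℂ) : Q z = (1 - nrm z ^ 2) * (nrm z + √2 * I) ^ 2 := by
  have h := sqrt_two_sq
  conv_lhs => rw [← denrm_nrm z]
  set p := nrm z
  rw [Q, denrm]
  have e : (√2 * p + I + I : ℂ) = √2 * (p + √2 * I) := by linear_combination -I * h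
  rw [e, mul_pow, h]
  have e2 : ((√2 * p + I) ^ 2 - 2 * I * (√2 * p + I) - 3 : ℂ) = 2 * (p ^ 2 - 1) := by
    linear_combination p ^ 2 * h - I_sq
  rw [e2]; ring

/-- The branch of `Q^{1/2}` in the doubly slit plane. -/
def sqrtQ (z : ℂ) : ℂ := phiDeriv (nrm z) / √2

theorem sqrtQ_sq (z : ℂ) : sqrtQ z ^ 2 = Q z := by
  rw [Q_eq, ← root_sq, sqrtQ, phiDeriv]
  have := sqrt_two_ne
  field_simp

theorem hasDerivAt_phi_nrm {z : ℂ} (hz : nrm z ∈ slit) :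
    HasDerivAt (fun z => phi (nrm z)) (sqrtQ z) z := by
  refine ((hasDerivAt_phi hz).comp z (hasDerivAt_nrm z)).congr_deriv ?_
  rw [sqrtQ]; ring

theorem analyticAt_sqrtQ {z : ℂ} (hz : nrm z ∈ slit) : AnalyticAt ℂ sqrtQ z := by
  have hd : DifferentiableOn ℂ (fun z => phi (nrm z)) (nrm ⁻¹' slit) := fun w hw =>
    (hasDerivAt_phi_nrm hw).differentiableAt.differentiableWithinAt
  have ho : IsOpen (nrm ⁻¹' slit) := isOpen_slit.preimage continuous_nrm
  have h1 := (hd.analyticAt (ho.mem_nhds hz)).deriv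
  refine h1.congr ?_
  filter_upwards [ho.mem_nhds hz] with w hw
  exact (hasDerivAt_phi_nrm hw).deriv

/-- The contour in normalized coordinates, parametrized by the real part. -/
def graphPoint (x : ℝ) : ℂ := x + height x * I

theorem graphPoint_re (x : ℝ) : (graphPoint x).re = x := by simp [graphPoint]
theorem graphPoint_im (x : ℝ) : (graphPoint x).im = height x := by simp [graphPoint]

theorem graphPoint_neg (x : ℝ) : graphPoint (-x) = -(starRingEnd ℂ) (graphPoint x) := by
  apply Complex.ext <;> simp [graphPoint, height_neg]

theorem analyticAt_graphPoint (x : ℝ) : AnalyticAt ℝ graphPoint x :=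
  (ofRealCLM.analyticAt x).add
    (((ofRealCLM.analyticAt _).comp (analyticAt_height x)).mul analyticAt_const)

theorem hasDerivAt_height (x : ℝ) : HasDerivAt height (deriv height x) x :=
  (analyticAt_height x).differentiableAt.hasDerivAt

theorem hasDerivAt_graphPoint (x : ℝ) : HasDerivAt graphPoint (1 + deriv height x * I) x :=
  ((hasDerivAt_id x).ofReal_comp.add ((hasDerivAt_height x).ofReal_comp.mul_const I)).congr_deriv
    (by simp)

theorem continuous_height : Continuous height :=
  continuous_iff_continuousAt.2 fun x => (analyticAt_height x).continuousAt

theorem continuous_graphPoint : Continuous graphPoint :=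
  continuous_iff_continuousAt.2 fun x => (analyticAt_graphPoint x).continuousAt

theorem graphPoint_mem_slit {x : ℝ} (hx : |x| ≠ 1) : graphPoint x ∈ slit := by
  rcases lt_or_gt_of_ne hx with h | h
  · exact slit_of_abs_lt h
  · exact slit_of_im_ne (height_out h).1.ne'

theorem hasDerivAt_phi_graphPoint {x : ℝ} (hx : |x| ≠ 1) :
    HasDerivAt (fun x => phi (graphPoint x))
      (phiDeriv (graphPoint x) * (1 + deriv height x * I)) x :=
  HasDerivAt.comp x (h₂ := phi) (hasDerivAt_phi (graphPoint_mem_slit hx)) (hasDerivAt_graphPoint x)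

theorem phi_graphPoint_re {x : ℝ} (hx : |x| ≤ 1) : (phi (graphPoint x)).re = 0 := by
  rcases hx.lt_or_eq with h | h
  · exact (height_mid h).2
  · rw [graphPoint, height_of_abs_eq_one h]
    rcases eq_or_eq_neg_of_abs_eq h with h | h
    · simp [h, phi_one]
    · simp [h, phi_neg_one]

/-- The differential `Q^{1/2} dz` is positive imaginary along the trajectory. -/
theorem phiDeriv_graphPoint_mid {x : ℝ} (hx : |x| < 1) :
    (phiDeriv (graphPoint x) * (1 + deriv height x * I)).re = 0 ∧
      0 < (phiDeriv (graphPoint x) * (1 + deriv height x * I)).im := by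
  have h1 : (phiDeriv (graphPoint x) * (1 + deriv height x * I)).re = 0 := by
    refine (hasDerivAt_re (hasDerivAt_phi_graphPoint hx.ne)).unique ?_
    refine (hasDerivAt_const x (0 : ℝ)).congr_of_eventuallyEq ?_
    filter_upwards [continuous_abs.continuousAt.eventually (gt_mem_nhds hx)] with t ht
    exact phi_graphPoint_re ht.le
  refine ⟨h1, ?_⟩
  have hy := (height_mid hx).1
  have h2 := phiDeriv_im_pos (graphPoint_mem_slit hx.ne) (by rw [graphPoint_im]; exact hy.2.le)
    (by rw [graphPoint_im]; exact hy.1)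
  simp at h1 ⊢
  -- The vanishing real part expresses Re phi' through Im phi', so the imaginary part becomes Im
  -- phi' · (1 + height'²).
  have h3 : (phiDeriv (graphPoint x)).re = (phiDeriv (graphPoint x)).im * deriv height x := by
    linarith
  rw [h3]
  nlinarith [mul_nonneg h2.le (sq_nonneg (deriv height x))]

/-- The differential `Q^{1/2} dz` is positive along the right end of the contour. -/
theorem phiDeriv_graphPoint_gt {x : ℝ} (hx : 1 < x) :
    (phiDeriv (graphPoint x) * (1 + deriv height x * I)).im = 0 ∧
      0 < (phiDeriv (graphPoint x) * (1 + deriv height x * I)).re := by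
  have hx' : 1 < |x| := lt_of_lt_of_le hx (le_abs_self x)
  have h1 : (phiDeriv (graphPoint x) * (1 + deriv height x * I)).im = 0 := by
    refine (hasDerivAt_im (hasDerivAt_phi_graphPoint hx'.ne')).unique ?_
    refine (hasDerivAt_const x (0 : ℝ)).congr_of_eventuallyEq ?_
    filter_upwards [lt_mem_nhds hx] with t ht
    have := (height_out (lt_of_lt_of_le ht (le_abs_self t))).2
    rwa [abs_of_pos (by linarith)] at this
  refine ⟨h1, ?_⟩
  have h2 := phiDeriv_re_pos (p := graphPoint x) (by rw [graphPoint_re]; linarith)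
    (by rw [graphPoint_im]; exact (height_out hx').1)
  simp at h1 ⊢
  have h3 : (phiDeriv (graphPoint x)).im = -((phiDeriv (graphPoint x)).re * deriv height x) := by
    linarith
  rw [h3]
  nlinarith [mul_nonneg h2.le (sq_nonneg (deriv height x))]

theorem phiDeriv_neg_conj {p : ℂ} (hp : p ∈ slit) :
    phiDeriv (-(starRingEnd ℂ) p) = -(starRingEnd ℂ) (phiDeriv p) := by
  rw [phiDeriv, root_neg_conj hp, phiDeriv]
  simp only [map_mul, map_add, conj_ofReal, conj_I]
  ring

theorem deriv_height_neg (x : ℝ) : deriv height (-x) = -deriv height x := by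
  have h := (hasDerivAt_height x).neg.neg
  have h1 : HasDerivAt (fun t => height (-t)) (-deriv height (-x)) x := by
    rw [← mul_neg_one]
    exact HasDerivAt.comp x (hasDerivAt_height (-x)) (hasDerivAt_neg x)
  have h2 : (fun t => height (-t)) = height := funext height_neg
  rw [h2] at h1
  have := h1.unique (hasDerivAt_height x)
  linarith

/-- Reflection reverses the direction of travel, hence the sign: increasing x moves towards z₁ here,
while φ₁ is integrated away from z₁. -/
theorem phiDeriv_graphPoint_lt {x : ℝ} (hx : x < -1) :
    (phiDeriv (graphPoint x) * (1 + deriv height x * I)).im = 0 ∧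
      (phiDeriv (graphPoint x) * (1 + deriv height x * I)).re < 0 := by
  have h := phiDeriv_graphPoint_gt (x := -x) (by linarith)
  have hs : graphPoint (-x) ∈ slit :=
    graphPoint_mem_slit (by rw [abs_neg, abs_of_neg (by linarith)]; linarith)
  have e1 : graphPoint x = -(starRingEnd ℂ) (graphPoint (-x)) := by
    rw [← graphPoint_neg, neg_neg]
  have e2 : deriv height x = -deriv height (-x) := by rw [deriv_height_neg, neg_neg]
  have e : phiDeriv (graphPoint x) * (1 + deriv height x * I) =
      -(starRingEnd ℂ) (phiDeriv (graphPoint (-x)) * (1 + deriv height (-x) * I)) := by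
    rw [e1, phiDeriv_neg_conj hs, e2]
    simp
  rw [e, neg_im, conj_im, neg_re, conj_re, neg_neg]
  exact ⟨h.1, by linarith [h.2]⟩

/-! ### Regions on the two sides of the trajectory -/

/-- The trajectory in normalized coordinates. -/
def midArc : Set ℂ := {p | |p.re| ≤ 1} ∩ {p | p.im = height p.re}

/-- The region above the trajectory, together with the upper half-plane. -/
def upperRegion : Set ℂ := {p | 0 < p.im} ∪ ({p | |p.re| < 1} ∩ {p | height p.re < p.im})

/-- The part of the strip `|x| < 1` below the trajectory. -/
def lowerRegion : Set ℂ := {p | |p.re| < 1} ∩ {p | p.im < height p.re}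

theorem mem_midArc {p : ℂ} : p ∈ midArc ↔ |p.re| ≤ 1 ∧ p.im = height p.re := Iff.rfl
theorem mem_upperRegion {p : ℂ} :
    p ∈ upperRegion ↔ 0 < p.im ∨ |p.re| < 1 ∧ height p.re < p.im := Iff.rfl
theorem mem_lowerRegion {p : ℂ} : p ∈ lowerRegion ↔ |p.re| < 1 ∧ p.im < height p.re := Iff.rfl

theorem height_nonpos {x : ℝ} (hx : |x| ≤ 1) : height x ≤ 0 := by
  rcases hx.lt_or_eq with h | h
  · exact (height_mid h).1.2.le
  · rw [height_of_abs_eq_one h]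

theorem isOpen_upperRegion : IsOpen upperRegion := by
  refine (isOpen_lt continuous_const continuous_im).union
    ((isOpen_lt (continuous_abs.comp continuous_re) continuous_const).inter
    (isOpen_lt (continuous_height.comp continuous_re) continuous_im))

theorem isOpen_lowerRegion : IsOpen lowerRegion :=
  (isOpen_lt (continuous_abs.comp continuous_re) continuous_const).inter
    (isOpen_lt continuous_im (continuous_height.comp continuous_re))

theorem upperRegion_subset_slit : upperRegion ⊆ slit := by
  rintro p (h | h)
  · exact mem_slit_iff.2 (Or.inl h.ne')
  · exact mem_slit_iff.2 (Or.inr h.1)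

theorem lowerRegion_subset_slit : lowerRegion ⊆ slit := fun _ h => mem_slit_iff.2 (Or.inr h.1)

theorem upperRegion_subset_compl : upperRegion ⊆ midArcᶜ := by
  intro p hp hm
  rw [mem_midArc] at hm
  rcases mem_upperRegion.1 hp with h | h
  · linarith [height_nonpos hm.1]
  · exact h.2.ne' hm.2

theorem lowerRegion_subset_compl : lowerRegion ⊆ midArcᶜ := fun _ h h' => h.2.ne h'.2

/-- The vertical ray upwards from `p`. -/
def upRay (p : ℂ) : Set ℂ := {w | w.re = p.re ∧ p.im ≤ w.im}

/-- The vertical ray downwards from `p`. -/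
def downRay (p : ℂ) : Set ℂ := {w | w.re = p.re ∧ w.im ≤ p.im}

theorem isPreconnected_upRay (p : ℂ) : IsPreconnected (upRay p) := by
  refine Convex.isPreconnected (Convex.inter ?_ ?_)
  · exact (convex_singleton p.re).is_linear_preimage (f := Complex.re) ⟨by simp, by simp⟩
  · exact convex_halfSpace_ge (f := Complex.im) ⟨by simp, by simp⟩ _

theorem isPreconnected_downRay (p : ℂ) : IsPreconnected (downRay p) := by
  refine Convex.isPreconnected (Convex.inter ?_ ?_)
  · exact (convex_singleton p.re).is_linear_preimage (f := Complex.re) ⟨by simp, by simp⟩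
  · exact convex_halfSpace_le (f := Complex.im) ⟨by simp, by simp⟩ _

theorem isPreconnected_re_gt (r : ℝ) : IsPreconnected {w : ℂ | r < w.re} :=
  (convex_halfSpace_re_gt r).isPreconnected
theorem isPreconnected_re_lt (r : ℝ) : IsPreconnected {w : ℂ | w.re < r} :=
  (convex_halfSpace_re_lt r).isPreconnected
theorem isPreconnected_im_gt (r : ℝ) : IsPreconnected {w : ℂ | r < w.im} :=
  (convex_halfSpace_im_gt r).isPreconnected
theorem isPreconnected_im_lt (r : ℝ) : IsPreconnected {w : ℂ | w.im < r} :=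
  (convex_halfSpace_im_lt r).isPreconnected

/-- A vertical ray joins each point to the upper half-plane without leaving the region. -/
theorem isPreconnected_upperRegion : IsPreconnected upperRegion := by
  refine isPreconnected_of_forall I fun p hp => ?_
  refine ⟨upRay p ∪ {w | 0 < w.im}, ?_, Or.inr (by simp), Or.inl ⟨rfl, le_rfl⟩, ?_⟩
  · rintro w (⟨h1, h2⟩ | h)
    · rw [mem_upperRegion, h1]
      rcases mem_upperRegion.1 hp with h | h
      · exact Or.inl (lt_of_lt_of_le h h2)
      · exact Or.inr ⟨h.1, lt_of_lt_of_le h.2 h2⟩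
    · exact Or.inl h
  · exact IsPreconnected.union ⟨p.re, max p.im 1⟩ ⟨rfl, le_max_left _ _⟩
      (mem_ofPred_eq.mpr (lt_of_lt_of_le one_pos (le_max_right p.im 1))) (isPreconnected_upRay p) (isPreconnected_im_gt 0)

theorem isPreconnected_lowerRegion : IsPreconnected lowerRegion := by
  refine isPreconnected_of_forall ((-√2 - 1 : ℝ) * I) fun p hp => ?_
  refine ⟨downRay p ∪ ({w | |w.re| < 1} ∩ {w | w.im < -√2}), ?_,
    Or.inr ⟨by simp, ?_⟩, Or.inl ⟨rfl, le_rfl⟩, ?_⟩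
  · rintro w (⟨h1, h2⟩ | ⟨h1, h2⟩)
    · rw [mem_lowerRegion, h1]
      exact ⟨hp.1, lt_of_le_of_lt h2 hp.2⟩
    · exact ⟨h1, lt_trans h2 (neg_sqrt_two_lt_height _)⟩
  · rw [mem_ofPred_eq, im_ofReal_mul, I_im]; linarith
  · refine IsPreconnected.union ⟨p.re, min p.im (-√2 - 1)⟩ ⟨rfl, min_le_left _ _⟩
      ⟨hp.1, lt_of_le_of_lt (min_le_right p.im (-√2 - 1)) (by linarith)⟩ (isPreconnected_downRay p)
      (Convex.isPreconnected (Convex.inter ?_ (convex_halfSpace_im_lt _)))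
    have : {w : ℂ | |w.re| < 1} = {w | -1 < w.re} ∩ {w | w.re < 1} := by
      ext w; exact abs_lt (a := w.re) (b := 1)
    rw [this]
    exact (convex_halfSpace_re_gt _).inter (convex_halfSpace_re_lt _)

/-- Points above or below the arc escape vertically into Im p > 0 or Im p < -√2, and both
half-planes meet Re p > 1. Connectedness is what lets identities near infinity spread to the whole
complement. -/
theorem isPreconnected_compl_midArc : IsPreconnected midArcᶜ := by
  have hr : {w : ℂ | 1 < w.re} ⊆ midArcᶜ := fun w hw h => by
    have : 1 < w.re := hw
    linarith [(mem_midArc.1 h).1, le_abs_self w.re]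
  have hl : {w : ℂ | w.re < -1} ⊆ midArcᶜ := fun w hw h => by
    have : w.re < -1 := hw
    linarith [(mem_midArc.1 h).1, neg_abs_le w.re]
  have hu : {w : ℂ | 0 < w.im} ⊆ midArcᶜ := fun w hw => upperRegion_subset_compl (Or.inl hw)
  have hd : {w : ℂ | w.im < -√2} ⊆ midArcᶜ := fun w hw h => by
    have h1 : w.im < -√2 := hw
    linarith [(mem_midArc.1 h).2, neg_sqrt_two_lt_height w.re]
  refine isPreconnected_of_forall 2 fun p hp => ?_
  have h2 : (2 : ℂ) ∈ {w : ℂ | 1 < w.re} := by simp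
  have hru : IsPreconnected ({w : ℂ | 1 < w.re} ∪ {w : ℂ | 0 < w.im}) :=
    IsPreconnected.union ⟨2, 1⟩ (by simp) (by simp) (isPreconnected_re_gt 1) (isPreconnected_im_gt 0)
  by_cases h1 : |p.re| ≤ 1
  · rcases lt_or_gt_of_ne (fun h => hp ⟨h1, h⟩ : p.im ≠ height p.re) with h | h
    · refine ⟨downRay p ∪ ({w | w.im < -√2} ∪ {w : ℂ | 1 < w.re}),
        union_subset ?_ (union_subset hd hr), Or.inr (Or.inr h2), Or.inl ⟨rfl, le_rfl⟩, ?_⟩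
      · rintro w ⟨e1, e2⟩ e3
        rw [mem_midArc, e1] at e3
        replace e3 := e3.2
        linarith
      · refine IsPreconnected.union ⟨p.re, min p.im (-√2 - 1)⟩ ⟨rfl, min_le_left _ _⟩
          (Or.inl (lt_of_le_of_lt (min_le_right p.im (-√2 - 1)) (by linarith))) (isPreconnected_downRay p) ?_
        exact IsPreconnected.union ⟨2, -√2 - 1⟩ (by simp) (by simp)
          (isPreconnected_im_lt _) (isPreconnected_re_gt 1)
    · refine ⟨upRay p ∪ ({w : ℂ | 1 < w.re} ∪ {w | 0 < w.im}),
        union_subset ?_ (union_subset hr hu), Or.inr (Or.inl h2), Or.inl ⟨rfl, le_rfl⟩, ?_⟩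
      · rintro w ⟨e1, e2⟩ e3
        rw [mem_midArc, e1] at e3
        replace e3 := e3.2
        linarith
      · exact IsPreconnected.union ⟨p.re, max p.im 1⟩ ⟨rfl, le_max_left _ _⟩
          (Or.inr (mem_ofPred_eq.mpr (lt_of_lt_of_le one_pos (le_max_right p.im 1)))) (isPreconnected_upRay p) hru
  · rcases lt_abs.1 (not_le.1 h1) with h | h
    · exact ⟨_, hr, h2, h, isPreconnected_re_gt 1⟩
    · refine ⟨{w | w.re < -1} ∪ ({w : ℂ | 1 < w.re} ∪ {w | 0 < w.im}),
        union_subset hl (union_subset hr hu), Or.inr (Or.inl h2),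
        Or.inl (by rw [mem_ofPred_eq]; linarith), ?_⟩
      exact IsPreconnected.union ⟨-2, 1⟩ (by simp) (Or.inr (by simp)) (isPreconnected_re_lt _) hru

/-! ### Uniqueness of the critical trajectory -/

/-- The critical trajectory. -/
def arc : Set ℂ := nrm ⁻¹' midArc

theorem mem_arc {z : ℂ} : z ∈ arc ↔ |(nrm z).re| ≤ 1 ∧ (nrm z).im = height (nrm z).re := Iff.rfl

/-- Dividing by u(t) places the argument of the logarithm near 1, so no branch of log u is needed
along the curve. -/
theorem hasDerivAt_log_norm {u : ℝ → ℂ} {u' : ℂ} {t : ℝ} (hu : HasDerivAt u u' t)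
    (h0 : u t ≠ 0) : HasDerivAt (fun τ => Real.log ‖u τ‖) (u' / u t).re t := by
  have h1 : HasDerivAt (fun τ => log (u τ / u t)) (u' / u t / (u t / u t)) t :=
    (hu.div_const (u t)).clog_real (by rw [div_self h0]; simp)
  have h2 := (hasDerivAt_re h1).add_const (Real.log ‖u t‖)
  rw [div_self h0, div_one] at h2
  refine h2.congr_of_eventuallyEq ?_
  filter_upwards [hu.continuousAt.eventually_ne h0] with τ hτ
  rw [log_re, norm_div, Real.log_div (norm_ne_zero_iff.2 hτ) (norm_ne_zero_iff.2 h0)]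
  ring

theorem phiAux_re (p s : ℂ) :
    (phiAux p s).re = (-(√2 / 3 : ℝ) * s ^ 3 + I * p * s).re - Real.log ‖p + I * s‖ := by
  rw [phiAux, sub_re, log_re]

/-- Changing the sheet inverts p + is. The zero set of the real part therefore does not depend on
the sheet. -/
theorem phiAux_re_neg {p s : ℂ} (h : s ^ 2 = 1 - p ^ 2) :
    (phiAux p (-s)).re = -(phiAux p s).re := by
  have h1 : p + I * -s = (p + I * s)⁻¹ := by
    rw [inv_eq_of_mul_eq_one_right (add_mul_sub_of_sq h)]; ring
  have h2 : (-(√2 / 3 : ℝ) * (-s) ^ 3 + I * p * -s : ℂ) = -(-(√2 / 3 : ℝ) * s ^ 3 + I * p * s) := by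
    ring
  rw [phiAux_re, phiAux_re, h1, h2, norm_inv, Real.log_inv, neg_re]
  ring

/-- The real part of the primitive along a curve on the Riemann surface `s² = 1 - p²`. -/
theorem hasDerivAt_phiAux_re {p s : ℝ → ℂ} {p' s' : ℂ} {t : ℝ} (hp : HasDerivAt p p' t)
    (hs : HasDerivAt s s' t) (h : ∀ᶠ τ in 𝓝 t, s τ ^ 2 = 1 - p τ ^ 2) (h0 : s t ≠ 0) :
    HasDerivAt (fun τ => (phiAux (p τ) (s τ)).re) (√2 * s t * (p t + √2 * I) * p').re t := by
  have ht := h.self_of_nhds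
  have hss : s' = -p t * p' / s t := by
    have h1 := hs.fun_pow 2
    have h2 : HasDerivAt (fun τ => 1 - p τ ^ 2) _ t := (hp.fun_pow 2).const_sub 1
    have := (h1.congr_of_eventuallyEq (h.mono fun _ h => h.symm)).unique h2
    rw [eq_div_iff h0]
    simp at this
    linear_combination this / 2
  have hu : p t + I * s t ≠ 0 := add_root_ne_zero ht
  have h1 := hasDerivAt_log_norm (hp.add (hs.const_mul I)) hu
  have h2 := hasDerivAt_re (((hs.fun_pow 3).const_mul (-(√2 / 3 : ℝ) : ℂ)).add
    ((hp.const_mul I).mul hs))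
  have h3 := h2.sub h1
  simp_rw [phiAux_re]
  refine h3.congr_deriv ?_
  rw [← sub_re]
  congr 1
  have h4 : (p' + I * s') / (p t + I * s t) = -I * p' / s t := by
    rw [hss, div_eq_div_iff hu h0]
    field_simp
    linear_combination p' * s t * I_sq
  simp only [Pi.add_apply] at *
  rw [h4, hss]
  push_cast
  field_simp
  linear_combination -I * ht * p' - s t ^ 2 * I * p' * sqrt_two_sq

section Trajectory

variable {c : ℝ → ℂ}

theorem trajectory_nrm_ne (hc : IsCriticalTrajectory Q z₁ z₂ c) {t : ℝ} (ht : t ∈ Ioo (0 : ℝ) 1) :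
    nrm (c t) ≠ 1 ∧ nrm (c t) ≠ -1 := by
  have ht' := Ioo_subset_Icc_self ht
  constructor
  · intro h
    rw [← nrm_z₂, ← hc.target] at h
    exact ht.2.ne (hc.injOn ht' ⟨zero_le_one, le_rfl⟩ (nrm_injective h))
  · intro h
    rw [← nrm_z₁, ← hc.source] at h
    exact ht.1.ne' (hc.injOn ht' ⟨le_rfl, zero_le_one⟩ (nrm_injective h))

/-- The curve is lifted to the surface s² = 1 - p². There Q^{1/2} dz is imaginary, so Re phiAux is
constant, and its limit at z₁ is 0. Points on the cuts are then excluded by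
`phiAux_re_ne_zero_of_ray`, and passing to the principal sheet changes at most the sign. -/
theorem trajectory_phi_re_eq_zero (hc : IsCriticalTrajectory Q z₁ z₂ c) {t : ℝ}
    (ht : t ∈ Ioo (0 : ℝ) 1) : nrm (c t) ∈ slit ∧ (phi (nrm (c t))).re = 0 := by
  set p : ℝ → ℂ := fun t => nrm (c t) with hp
  set q : ℝ → ℝ := fun t => -(Q (c t) * deriv c t ^ 2).re with hq
  -- The sheet is fixed by requiring √2 s (p + √2 i) p' = i√q, with q = -Q(c) c'² > 0.
  set s : ℝ → ℂ := fun t => I * √(q t) / ((p t + √2 * I) * deriv c t) with hs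
  have hca : ∀ t ∈ Ioo (0 : ℝ) 1, AnalyticAt ℝ c t := fun t ht =>
    hc.analytic t (Ioo_subset_Icc_self ht)
  have hq0 : ∀ t ∈ Ioo (0 : ℝ) 1, 0 < q t := fun t ht => neg_pos.2 (hc.trajectory t ht).2
  have hqQ : ∀ t ∈ Ioo (0 : ℝ) 1, Q (c t) * deriv c t ^ 2 = -(q t : ℂ) := fun t ht => by
    have := (hc.trajectory t ht).1
    apply Complex.ext
    · simp only [hq, neg_re, ofReal_re, neg_neg]
    · rw [this]; simp
  have hpn : ∀ t ∈ Ioo (0 : ℝ) 1, p t + √2 * I ≠ 0 := fun t ht h0 => by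
    have h1 := hqQ t ht
    rw [Q_eq, show nrm (c t) + √2 * I = 0 from h0] at h1
    have : ((q t : ℝ) : ℂ) = 0 := by linear_combination h1
    exact (hq0 t ht).ne' (ofReal_eq_zero.1 this)
  have hcr : ∀ t ∈ Ioo (0 : ℝ) 1, deriv c t ≠ 0 := fun t ht =>
    hc.regular t (Ioo_subset_Icc_self ht)
  have hs2 : ∀ t ∈ Ioo (0 : ℝ) 1, s t ^ 2 = 1 - p t ^ 2 := fun t ht => by
    have h1 := hqQ t ht
    rw [Q_eq] at h1
    have h2 : ((√(q t) : ℝ) : ℂ) ^ 2 = q t := by rw [← ofReal_pow, Real.sq_sqrt (hq0 t ht).le]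
    have h3 := hpn t ht
    have h4 := hcr t ht
    simp only [hs]
    rw [div_pow, mul_pow, h2, div_eq_iff (pow_ne_zero 2 (mul_ne_zero h3 h4)), I_sq]
    linear_combination -h1
  have hs0 : ∀ t ∈ Ioo (0 : ℝ) 1, s t ≠ 0 := fun t ht =>
    div_ne_zero (mul_ne_zero I_ne_zero (ofReal_ne_zero.2 (Real.sqrt_pos.2 (hq0 t ht)).ne'))
      (mul_ne_zero (hpn t ht) (hcr t ht))
  have hpd : ∀ t ∈ Ioo (0 : ℝ) 1, HasDerivAt p (deriv c t / √2) t := fun t ht => by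
    refine ((hasDerivAt_nrm (c t)).comp t (hca t ht).differentiableAt.hasDerivAt).congr_deriv ?_
    ring
  have hQd : Differentiable ℂ Q := by unfold Q; fun_prop
  have hsd : ∀ t ∈ Ioo (0 : ℝ) 1, DifferentiableAt ℝ s t := fun t ht => by
    have h1 : DifferentiableAt ℝ (deriv c) t := (hca t ht).deriv.differentiableAt
    have h2 : DifferentiableAt ℝ c t := (hca t ht).differentiableAt
    have h3 : DifferentiableAt ℝ (fun t => Q (c t)) t :=
      ((hQd (c t)).restrictScalars ℝ).comp t h2
    have h4 : DifferentiableAt ℝ q t :=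
      (reCLM.differentiableAt.comp t (h3.mul (h1.pow 2))).neg
    have h5 : DifferentiableAt ℝ (fun t => ((√(q t) : ℝ) : ℂ)) t :=
      ofRealCLM.differentiableAt.comp t (h4.sqrt (hq0 t ht).ne')
    exact ((differentiableAt_const I).mul h5).div
      (((hpd t ht).differentiableAt.add_const _).mul h1) (mul_ne_zero (hpn t ht) (hcr t ht))
  set f : ℝ → ℝ := fun t => (phiAux (p t) (s t)).re with hf
  have hfd : ∀ t ∈ Ioo (0 : ℝ) 1, HasDerivAt f 0 t := fun t ht => by
    have h1 := hasDerivAt_phiAux_re (hpd t ht) (hsd t ht).hasDerivAt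
      (by filter_upwards [Ioo_mem_nhds ht.1 ht.2] with τ hτ using hs2 τ hτ) (hs0 t ht)
    refine h1.congr_deriv ?_
    have h2 := hpn t ht
    have h3 := hcr t ht
    have h4 := sqrt_two_ne
    have : (√2 * s t * (p t + √2 * I) * (deriv c t / √2) : ℂ) = (√(q t) : ℝ) * I := by
      simp only [hs]
      field_simp
    rw [this, re_ofReal_mul, I_re, mul_zero]
  have hconst : ∀ t ∈ Ioo (0 : ℝ) 1, ∀ u ∈ Ioo (0 : ℝ) 1, f t = f u := fun t ht u hu =>
    isOpen_Ioo.is_const_of_deriv_eq_zero isPreconnected_Ioo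
      (fun t ht => (hfd t ht).differentiableAt.differentiableWithinAt)
      (fun t ht => (hfd t ht).deriv) ht hu
  have hlim : Tendsto f (𝓝[>] 0) (𝓝 0) := by
    have hp0 : Tendsto p (𝓝[>] 0) (𝓝 (-1)) := by
      have h1 : ContinuousAt p 0 := continuous_nrm.continuousAt.comp
        (hc.analytic 0 ⟨le_rfl, zero_le_one⟩).continuousAt
      have h2 : p 0 = -1 := by simp only [hp]; rw [hc.source, nrm_z₁]
      rw [ContinuousAt, h2] at h1
      exact h1.mono_left nhdsWithin_le_nhds
    have hs0' : Tendsto s (𝓝[>] 0) (𝓝 0) := by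
      rw [tendsto_zero_iff_norm_tendsto_zero]
      have h1 : Tendsto (fun t => √‖1 - p t ^ 2‖) (𝓝[>] 0) (𝓝 (√‖(1 - (-1) ^ 2 : ℂ)‖)) := by
        have : Continuous fun w : ℂ => √‖1 - w ^ 2‖ := by fun_prop
        exact (this.tendsto (-1 : ℂ)).comp hp0
      have h2 : √‖(1 - (-1) ^ 2 : ℂ)‖ = 0 := by norm_num
      rw [h2] at h1
      refine h1.congr' ?_
      filter_upwards [Ioo_mem_nhdsGT (zero_lt_one' ℝ)] with τ hτ
      rw [← hs2 τ hτ, norm_pow, Real.sqrt_sq (norm_nonneg _)]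
    have h1 : ContinuousAt (fun w : ℂ × ℂ => (-(√2 / 3 : ℝ) * w.2 ^ 3 + I * w.1 * w.2 : ℂ).re -
        Real.log ‖w.1 + I * w.2‖) (-1, 0) := by
      refine ContinuousAt.sub (by fun_prop) (ContinuousAt.log (by fun_prop) (by simp))
    have h2 := h1.tendsto.comp (hp0.prodMk_nhds hs0')
    simp at h2
    refine h2.congr fun τ => ?_
    simp [hf, phiAux_re]
  have hf0 : f t = 0 := by
    refine tendsto_nhds_unique (tendsto_const_nhds.congr' ?_) hlim
    filter_upwards [Ioo_mem_nhdsGT (zero_lt_one' ℝ)] with τ hτ using hconst t ht τ hτ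
  have hslit : nrm (c t) ∈ slit := by
    by_contra hn
    rw [mem_slit_iff, not_or, not_not, not_lt] at hn
    have hre : p t = ((p t).re : ℝ) := by apply Complex.ext <;> simp [hp, hn.1]
    rcases hn.2.eq_or_lt with h | h
    · have hne := trajectory_nrm_ne hc ht
      rcases eq_or_eq_neg_of_abs_eq h.symm with h | h
      · refine hne.1 ?_
        rw [show nrm (c t) = p t from rfl, hre, show (p t).re = 1 from h, ofReal_one]
      · refine hne.2 ?_
        rw [show nrm (c t) = p t from rfl, hre, show (p t).re = -1 from h, ofReal_neg, ofReal_one]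
    · refine phiAux_re_ne_zero_of_ray h (s := s t) ?_ ?_
      · have := hs2 t ht; rwa [hre] at this
      · have : f t = (phiAux ((p t).re : ℝ) (s t)).re := by
          simp only [hf]; rw [← hre]
        rw [← this]; exact hf0
  refine ⟨hslit, ?_⟩
  rcases eq_root_of_sq (hs2 t ht) with h | h
  · rw [← hf0]; simp only [hf]; rw [h]; rfl
  · have h1 : f t = -(phi (nrm (c t))).re := by
      simp only [hf]; rw [h, phiAux_re_neg (root_sq _)]; rfl
    linarith

/-- Re phi = 0 forbids the line Im p = -√2 (where Re phi > 0), the segment (-1, 1) (where Re phi <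
0) and the vertical sides of the box below ±1 (where Re phi > 0). A connected curve with one point
in the box stays inside, where the zero on each vertical is unique. -/
theorem trajectory_mem_arc (hc : IsCriticalTrajectory Q z₁ z₂ c) {t : ℝ}
    (ht : t ∈ Icc (0 : ℝ) 1) : c t ∈ arc := by
  set p : ℝ → ℂ := fun t => nrm (c t) with hp
  have hF : ∀ t ∈ Ioo (0 : ℝ) 1, p t ∈ slit ∧ (phi (p t)).re = 0 := fun t ht =>
    trajectory_phi_re_eq_zero hc ht
  have hcont : ContinuousOn p (Icc 0 1) := continuous_nrm.comp_continuousOn hc.analytic.continuousOn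
  have hp0 : p 0 = -1 := by simp only [hp]; rw [hc.source, nrm_z₁]
  have hp1 : p 1 = 1 := by simp only [hp]; rw [hc.target, nrm_z₂]
  have hre : ContinuousOn (fun t => (p t).re) (Icc 0 1) := continuous_re.comp_continuousOn hcont
  have him : ContinuousOn (fun t => (p t).im) (Icc 0 1) := continuous_im.comp_continuousOn hcont
  have hs : 0 < √2 := by positivity
  have heq : ∀ t, p t = (p t).re + (p t).im * I := fun t => (re_add_im _).symm
  have hnl : ∀ t ∈ Ioo (0 : ℝ) 1, (p t).im ≠ -√2 := fun t ht h => by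
    have h1 := phi_re_line_pos (p t).re
    rw [← h, ← heq, (hF t ht).2] at h1
    exact lt_irrefl _ h1
  have hbd : ∀ t ∈ Ioo (0 : ℝ) 1, -√2 < (p t).im := fun t ht => by
    by_contra hc'
    have h1 : (p t).im < -√2 := lt_of_le_of_ne (not_lt.1 hc') (hnl t ht)
    have h2 := intermediate_value_Ioo' ht.1.le (him.mono (Icc_subset_Icc_right ht.2.le))
    obtain ⟨u, hu, hu0⟩ := h2 (show -√2 ∈ Ioo _ _ from ⟨h1, by rw [hp0]; simp⟩)
    exact hnl u ⟨hu.1, lt_trans hu.2 ht.2⟩ hu0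
  have hseg : ∀ t ∈ Ioo (0 : ℝ) 1, (p t).im ≠ 0 := fun t ht h => by
    have h1 := (mem_slit_iff.1 (hF t ht).1).resolve_left (not_not.2 h)
    have h2 := phi_re_ofReal_neg h1
    have h3 : ((p t).re : ℂ) = p t := by conv_rhs => rw [heq t, h]; simp
    rw [h3, (hF t ht).2] at h2
    exact lt_irrefl _ h2
  set B : Set ℂ := {w | |w.re| < 1} ∩ ({w | -√2 < w.im} ∩ {w | w.im < 0}) with hB
  have hBo : IsOpen B := (isOpen_lt (continuous_abs.comp continuous_re) continuous_const).inter
    ((isOpen_lt continuous_const continuous_im).inter (isOpen_lt continuous_im continuous_const))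
  have hBc : closure B ⊆ {w | |w.re| ≤ 1} ∩ {w | w.im ≤ 0} := by
    refine closure_minimal (fun w hw => ⟨mem_ofPred_eq.mpr (le_of_lt hw.1), mem_ofPred_eq.mpr (le_of_lt hw.2.2)⟩) ?_
    exact (isClosed_le (continuous_abs.comp continuous_re) continuous_const).inter
      (isClosed_le continuous_im continuous_const)
  have hsub : p '' Ioo 0 1 ⊆ B := by
    refine IsPreconnected.subset_of_closure_inter_subset
      (isPreconnected_Ioo.image _ (hcont.mono Ioo_subset_Icc_self)) hBo ?_ ?_
    -- Going from -1 to 1 the curve crosses the imaginary axis. It does so below 0, since Re phi < 0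
    -- on the rest of that axis upwards, and this is the point in the box.
    · obtain ⟨u, hu, hu0⟩ := intermediate_value_Ioo zero_le_one hre
        (show (0 : ℝ) ∈ Ioo _ _ by rw [hp0, hp1]; simp)
      refine ⟨p u, mem_image_of_mem _ hu, ?_, hbd u hu, ?_⟩
      · rw [mem_ofPred_eq, show (p u).re = 0 from hu0]; simp
      · by_contra hn
        have h1 := phi_re_mul_I_neg (not_lt.1 hn)
        have h3 : ((p u).im * I : ℂ) = p u := by
          conv_rhs => rw [heq u, show (p u).re = 0 from hu0]
          simp
        rw [h3, (hF u hu).2] at h1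
        exact lt_irrefl _ h1
    · rintro w ⟨hw, u, hu, rfl⟩
      obtain ⟨h1, h2⟩ := hBc hw
      rw [mem_ofPred_eq] at h1 h2
      have h2' : (p u).im < 0 := lt_of_le_of_ne h2 (hseg u hu)
      refine ⟨?_, hbd u hu, h2'⟩
      refine lt_of_le_of_ne h1 fun h => ?_
      have h3 := phi_re_pos_below h1 ⟨(hbd u hu).le, h2'.le⟩ (by rwa [height_of_abs_eq_one h])
      rw [← heq, (hF u hu).2] at h3
      exact lt_irrefl _ h3
  rcases ht.1.eq_or_lt with h | h
  · have : nrm (c t) = -1 := by rw [← h]; exact hp0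
    rw [mem_arc, this]
    simp [height_of_abs_eq_one]
  rcases ht.2.eq_or_lt with h' | h'
  · have : nrm (c t) = 1 := by rw [h']; exact hp1
    rw [mem_arc, this]
    simp [height_of_abs_eq_one]
  · obtain ⟨h1, h2, h3⟩ := hsub (mem_image_of_mem _ ⟨h, h'⟩)
    refine mem_arc.2 ⟨le_of_lt h1, eq_height_of_mid h1 ⟨le_of_lt h2, le_of_lt h3⟩ ?_⟩
    rw [re_add_im]; exact (hF t ⟨h, h'⟩).2

end Trajectory

/-! ### Parametrizations of the trajectory and their abscissa -/

/-- A regular analytic parametrization of the trajectory from `z₁` to `z₂`. -/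
structure IsArcParam (c : ℝ → ℂ) : Prop where
  analytic : AnalyticOnNhd ℝ c (Icc 0 1)
  regular : ∀ t ∈ Icc (0 : ℝ) 1, deriv c t ≠ 0
  injOn : InjOn c (Icc 0 1)
  source : c 0 = z₁
  target : c 1 = z₂
  mem_arc : ∀ t ∈ Icc (0 : ℝ) 1, c t ∈ arc

theorem IsCriticalTrajectory.isArcParam {c : ℝ → ℂ} (hc : IsCriticalTrajectory Q z₁ z₂ c) :
    IsArcParam c :=
  ⟨hc.analytic, hc.regular, hc.injOn, hc.source, hc.target, fun _ ht => trajectory_mem_arc hc ht⟩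

/-- The abscissa of a curve in normalized coordinates. -/
def absc (c : ℝ → ℂ) (t : ℝ) : ℝ := (nrm (c t)).re

namespace IsArcParam

variable {c : ℝ → ℂ} (hc : IsArcParam c)
include hc

theorem nrm_eq {t : ℝ} (ht : t ∈ Icc (0 : ℝ) 1) : nrm (c t) = graphPoint (absc c t) := by
  rw [graphPoint, absc, ← (CubicSCurve.mem_arc.1 (hc.mem_arc t ht)).2, re_add_im]

theorem absc_zero : absc c 0 = -1 := by rw [absc, hc.source, nrm_z₁]; simp
theorem absc_one : absc c 1 = 1 := by rw [absc, hc.target, nrm_z₂]; simp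

theorem continuousOn_absc : ContinuousOn (absc c) (Icc 0 1) :=
  continuous_re.comp_continuousOn (continuous_nrm.comp_continuousOn hc.analytic.continuousOn)

theorem strictMonoOn_absc : StrictMonoOn (absc c) (Icc 0 1) := by
  have hinj : InjOn (absc c) (Icc 0 1) := fun t ht u hu h => by
    refine hc.injOn ht hu (nrm_injective ?_)
    rw [hc.nrm_eq ht, hc.nrm_eq hu, h]
  rcases hc.continuousOn_absc.strictMonoOn_of_injOn_Icc' zero_le_one hinj with h | h
  · exact h
  · have := h ⟨le_rfl, zero_le_one⟩ ⟨zero_le_one, le_rfl⟩ one_pos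
    rw [hc.absc_zero, hc.absc_one] at this
    linarith

theorem image_absc : absc c '' Icc 0 1 = Icc (-1) 1 := by
  apply Subset.antisymm
  · rintro _ ⟨t, ht, rfl⟩
    exact abs_le.1 (CubicSCurve.mem_arc.1 (hc.mem_arc t ht)).1
  · have := intermediate_value_Icc zero_le_one hc.continuousOn_absc
    rwa [hc.absc_zero, hc.absc_one] at this

theorem image_eq : c '' Icc 0 1 = arc := by
  apply Subset.antisymm
  · rintro _ ⟨t, ht, rfl⟩
    exact hc.mem_arc t ht
  · intro z hz
    have h1 : (nrm z).re ∈ absc c '' Icc 0 1 := by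
      rw [hc.image_absc]; exact abs_le.1 (CubicSCurve.mem_arc.1 hz).1
    obtain ⟨t, ht, h⟩ := h1
    refine ⟨t, ht, nrm_injective ?_⟩
    rw [hc.nrm_eq ht, h, graphPoint, ← (CubicSCurve.mem_arc.1 hz).2, re_add_im]

theorem absc_mem {t : ℝ} (ht : t ∈ Ioo (0 : ℝ) 1) : |absc c t| < 1 := by
  have h1 := hc.strictMonoOn_absc ⟨le_rfl, zero_le_one⟩ (Ioo_subset_Icc_self ht) ht.1
  have h2 := hc.strictMonoOn_absc (Ioo_subset_Icc_self ht) ⟨zero_le_one, le_rfl⟩ ht.2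
  rw [hc.absc_zero] at h1
  rw [hc.absc_one] at h2
  exact abs_lt.2 ⟨h1, h2⟩

theorem hasDerivAt_absc {t : ℝ} (ht : t ∈ Icc (0 : ℝ) 1) :
    HasDerivAt (absc c) (deriv c t / √2).re t := by
  have h := (hc.analytic t ht).differentiableAt.hasDerivAt
  have h1 : HasDerivAt (fun t => nrm (c t)) (deriv c t / √2) t :=
    ((hasDerivAt_nrm (c t)).comp t h).congr_deriv (by ring)
  exact hasDerivAt_re h1

theorem deriv_eq {t : ℝ} (ht : t ∈ Ioo (0 : ℝ) 1) :
    deriv c t / √2 = deriv (absc c) t * (1 + deriv height (absc c t) * I) := by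
  have ht' := Ioo_subset_Icc_self ht
  have h := (hc.analytic t ht').differentiableAt.hasDerivAt
  have h1 : HasDerivAt (fun t => nrm (c t)) (deriv c t / √2) t :=
    ((hasDerivAt_nrm (c t)).comp t h).congr_deriv (by ring)
  have h2 : HasDerivAt (fun t => graphPoint (absc c t))
      (deriv (absc c) t • (1 + deriv height (absc c t) * I)) t :=
    HasDerivAt.scomp t (hasDerivAt_graphPoint (absc c t))
      (hc.hasDerivAt_absc ht').differentiableAt.hasDerivAt
  rw [real_smul] at h2
  refine h1.unique (h2.congr_of_eventuallyEq ?_)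
  filter_upwards [Icc_mem_nhds ht.1 ht.2] with τ hτ using hc.nrm_eq hτ

/-- The tangent is a multiple of the derivative of the abscissa, so a zero of the latter would
contradict regularity. -/
theorem deriv_absc_pos {t : ℝ} (ht : t ∈ Ioo (0 : ℝ) 1) : 0 < deriv (absc c) t := by
  refine lt_of_le_of_ne ?_ fun h => ?_
  · rw [← derivWithin_of_mem_nhds (Icc_mem_nhds ht.1 ht.2)]
    exact hc.strictMonoOn_absc.monotoneOn.derivWithin_nonneg
  · have h1 := hc.deriv_eq ht
    rw [← h, ofReal_zero, zero_mul, div_eq_zero_iff] at h1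
    exact h1.elim (hc.regular t (Ioo_subset_Icc_self ht)) sqrt_two_ne

/-- `Q^{1/2} dz` is positive imaginary along the arc. -/
theorem sqrtQ_mul_deriv {t : ℝ} (ht : t ∈ Ioo (0 : ℝ) 1) :
    sqrtQ (c t) * deriv c t = deriv (absc c) t *
      (phiDeriv (graphPoint (absc c t)) * (1 + deriv height (absc c t) * I)) := by
  rw [sqrtQ, hc.nrm_eq (Ioo_subset_Icc_self ht), div_mul_eq_mul_div, mul_div_assoc,
    hc.deriv_eq ht]
  ring

end IsArcParam

/-! ### The measure on the trajectory -/

/-- The point of the contour with a given normalized abscissa. -/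
def pt (x : ℝ) : ℂ := denrm (graphPoint x)

/-- The density of the measure with respect to the normalized abscissa. -/
def dens (x : ℝ) : ℝ := (phiDeriv (graphPoint x) * (1 + deriv height x * I)).im / Real.pi

/-- The equilibrium measure. -/
def mu : Measure ℂ :=
  Measure.map pt ((volume.restrict (Ioo (-1 : ℝ) 1)).withDensity fun x => ENNReal.ofReal (dens x))

theorem continuous_pt : Continuous pt := continuous_denrm.comp continuous_graphPoint

theorem nrm_pt (x : ℝ) : nrm (pt x) = graphPoint x := nrm_denrm _

theorem pt_mem_arc {x : ℝ} (hx : x ∈ Icc (-1 : ℝ) 1) : pt x ∈ arc := by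
  rw [mem_arc, nrm_pt, graphPoint_re, graphPoint_im]
  exact ⟨abs_le.2 hx, rfl⟩

theorem arc_eq_image : arc = pt '' Icc (-1) 1 := by
  apply Subset.antisymm
  · intro z hz
    refine ⟨(nrm z).re, abs_le.1 (mem_arc.1 hz).1, nrm_injective ?_⟩
    rw [nrm_pt, graphPoint, ← (mem_arc.1 hz).2, re_add_im]
  · rintro _ ⟨x, hx, rfl⟩
    exact pt_mem_arc hx

theorem isCompact_arc : IsCompact arc := by
  rw [arc_eq_image]; exact isCompact_Icc.image continuous_pt

theorem continuous_deriv_height : Continuous (deriv height) :=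
  continuous_iff_continuousAt.2 fun x => (analyticAt_height x).deriv.continuousAt

theorem measurable_root : Measurable root := by unfold root; fun_prop

theorem measurable_phiDeriv : Measurable phiDeriv := by
  unfold phiDeriv
  have := measurable_root
  fun_prop

theorem measurable_dens : Measurable dens := by
  unfold dens
  have h1 := measurable_phiDeriv.comp continuous_graphPoint.measurable
  have h2 := continuous_deriv_height.measurable
  exact (measurable_im.comp (h1.mul (measurable_const.add
    ((measurable_ofReal.comp h2).mul_const I)))).div_const _

theorem dens_pos {x : ℝ} (hx : x ∈ Ioo (-1 : ℝ) 1) : 0 < dens x :=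
  div_pos (phiDeriv_graphPoint_mid (abs_lt.2 hx)).2 Real.pi_pos

theorem continuousOn_phiDeriv_graphPoint :
    ContinuousOn (fun x => phiDeriv (graphPoint x)) (Icc (-1) 1) := fun x hx => by
  refine (ContinuousAt.comp (g := phiDeriv) ?_
    continuous_graphPoint.continuousAt).continuousWithinAt
  have hr : ContinuousAt root (graphPoint x) := by
    by_cases h : |x| = 1
    · refine continuousAt_root_of_sq_eq_one ?_
      rw [graphPoint, height_of_abs_eq_one h, ofReal_zero, zero_mul, add_zero, ← ofReal_pow,
        ← sq_abs, h]
      simp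
    · exact (hasDerivAt_root (graphPoint_mem_slit h)).continuousAt
  unfold phiDeriv
  fun_prop

theorem continuousOn_dens : ContinuousOn dens (Icc (-1) 1) := by
  have h1 := continuousOn_phiDeriv_graphPoint
  have h2 := continuous_deriv_height
  unfold dens
  exact (continuous_im.comp_continuousOn (h1.mul (by fun_prop))).div_const _

theorem exists_dens_le : ∃ M, 0 ≤ M ∧ ∀ x ∈ Icc (-1 : ℝ) 1, |dens x| ≤ M := by
  obtain ⟨M, hM⟩ := isCompact_Icc.exists_bound_of_continuousOn continuousOn_dens
  exact ⟨M, (norm_nonneg _).trans (hM 0 (by simp)), hM⟩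

/-- The measure on the arc does not depend on the parametrization. -/
theorem IsArcParam.arcMeasure_eq {c : ℝ → ℂ} (hc : IsArcParam c) :
    arcMeasure c (fun s => 1 / (Real.pi * I) * sqrtQ s) = mu := by
  have hd : ∀ t ∈ Ioo (0 : ℝ) 1, (1 / (Real.pi * I) * sqrtQ (c t) * deriv c t).re =
      |deriv (absc c) t| * dens (absc c t) := fun t ht => by
    rw [mul_assoc, hc.sqrtQ_mul_deriv ht, dens, abs_of_pos (hc.deriv_absc_pos ht)]
    have : (1 / (Real.pi * I) : ℂ) = ((Real.pi⁻¹ : ℝ) : ℂ) * -I := by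
      rw [ofReal_inv, ← inv_I, one_div, mul_inv]
    rw [this, mul_assoc, re_ofReal_mul, mul_left_comm, re_ofReal_mul]
    simp only [neg_mul, neg_re, I_mul_re]
    ring
  have hcm : ContinuousOn c (Ioo 0 1) := hc.analytic.continuousOn.mono Ioo_subset_Icc_self
  have hcae : AEMeasurable c (volume.restrict (Ioo (0 : ℝ) 1)) := hcm.aemeasurable measurableSet_Ioo
  have himg : absc c '' Ioo 0 1 = Ioo (-1) 1 := by
    have hcont := hc.continuousOn_absc
    apply Subset.antisymm
    · rintro _ ⟨t, ht, rfl⟩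
      exact abs_lt.1 (hc.absc_mem ht)
    · have := intermediate_value_Ioo zero_le_one hcont
      rwa [hc.absc_zero, hc.absc_one] at this
  ext A hA
  rw [arcMeasure, mu, Measure.map_apply_of_aemeasurable (hcae.mono_ac
    (withDensity_absolutelyContinuous _ _)) hA, Measure.map_apply continuous_pt.measurable hA]
  have hA' : MeasurableSet (pt ⁻¹' A) := continuous_pt.measurable hA
  have hnull : NullMeasurableSet (c ⁻¹' A) (volume.restrict (Ioo (0 : ℝ) 1)) :=
    hcae.nullMeasurableSet_preimage hA
  have hptc : ∀ t ∈ Ioo (0 : ℝ) 1, pt (absc c t) = c t := fun t ht => by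
    rw [pt, ← hc.nrm_eq (Ioo_subset_Icc_self ht), denrm_nrm]
  -- Change of variables x = absc c t, under which pt x = c t.
  rw [withDensity_apply _ hA', withDensity_apply', ← lintegral_indicator₀ hnull,
    ← lintegral_indicator hA', ← himg, lintegral_image_eq_lintegral_abs_deriv_mul measurableSet_Ioo
      (fun t ht => (hc.hasDerivAt_absc
        (Ioo_subset_Icc_self ht)).differentiableAt.hasDerivAt.hasDerivWithinAt)
      (hc.strictMonoOn_absc.injOn.mono Ioo_subset_Icc_self)]
  refine setLIntegral_congr_fun measurableSet_Ioo fun t ht => ?_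
  by_cases h : c t ∈ A
  · have h' : absc c t ∈ pt ⁻¹' A := by rw [mem_preimage, hptc t ht]; exact h
    rw [indicator_of_mem (show t ∈ c ⁻¹' A from h), indicator_of_mem h', hd t ht,
      ENNReal.ofReal_mul (abs_nonneg _)]
  · have h' : absc c t ∉ pt ⁻¹' A := by rw [mem_preimage, hptc t ht]; exact h
    rw [indicator_of_notMem (show t ∉ c ⁻¹' A from h), indicator_of_notMem h', mul_zero]

/-! ### Integration against `mu` in the abscissa -/

section Integrals

variable {E : Type*} [NormedAddCommGroup E] [NormedSpace ℝ E]

theorem toNNReal_dens_smul {x : ℝ} (hx : x ∈ Ioo (-1 : ℝ) 1) (v : E) :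
    (dens x).toNNReal • v = dens x • v := by
  rw [NNReal.smul_def, Real.coe_toNNReal _ (dens_pos hx).le]

theorem integral_mu {f : ℂ → E} (hf : StronglyMeasurable f) :
    ∫ s, f s ∂mu = ∫ x in Ioo (-1 : ℝ) 1, dens x • f (pt x) := by
  rw [mu, integral_map continuous_pt.aemeasurable hf.aestronglyMeasurable]
  rw [show (fun x => ENNReal.ofReal (dens x)) = fun x => (((dens x).toNNReal : NNReal) : ℝ≥0∞) from
    rfl, integral_withDensity_eq_integral_smul measurable_dens.real_toNNReal]
  exact setIntegral_congr_fun measurableSet_Ioo fun x hx => toNNReal_dens_smul hx _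

theorem integrable_mu_iff {f : ℂ → E} (hf : StronglyMeasurable f) :
    Integrable f mu ↔ IntegrableOn (fun x => dens x • f (pt x)) (Ioo (-1 : ℝ) 1) := by
  rw [mu, integrable_map_measure hf.aestronglyMeasurable continuous_pt.aemeasurable,
    show (fun x => ENNReal.ofReal (dens x)) = fun x => (((dens x).toNNReal : NNReal) : ℝ≥0∞) from
    rfl, integrable_withDensity_iff_integrable_smul measurable_dens.real_toNNReal]
  exact integrableOn_congr_fun (fun x hx => toNNReal_dens_smul hx _) measurableSet_Ioo

end Integrals

/-- The density is the derivative of Im phi / π along the graph, and Im phi rises from -π at p = -1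
to 0 at p = 1. -/
theorem integral_dens : ∫ x in (-1 : ℝ)..1, dens x = 1 := by
  have hcont : ContinuousOn (fun x => phi (graphPoint x)) (Icc (-1) 1) := fun x hx => by
    refine (ContinuousAt.comp (g := phi) ?_ continuous_graphPoint.continuousAt).continuousWithinAt
    by_cases h : |x| = 1
    · rw [graphPoint, height_of_abs_eq_one h, ofReal_zero, zero_mul, add_zero]
      rcases eq_or_eq_neg_of_abs_eq h with h | h
      · simpa [h] using continuousAt_phi_one
      · simpa [h] using continuousAt_phi_neg_one
    · exact (hasDerivAt_phi (graphPoint_mem_slit h)).continuousAt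
  have h := intervalIntegral.integral_eq_sub_of_hasDerivAt_of_le (by norm_num : (-1 : ℝ) ≤ 1)
    (f := fun x => (phi (graphPoint x)).im / Real.pi) (f' := dens)
    ((continuous_im.comp_continuousOn hcont).div_const _)
    (fun x hx => (hasDerivAt_im (hasDerivAt_phi_graphPoint (abs_lt.2 hx).ne)).div_const _)
    (continuousOn_dens.intervalIntegrable_of_Icc (by norm_num))
  rw [h]
  have e1 : graphPoint 1 = 1 := by simp [graphPoint, height_of_abs_eq_one]
  have e2 : graphPoint (-1) = -1 := by simp [graphPoint, height_of_abs_eq_one]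
  rw [e1, e2, phi_one, phi_neg_one]
  simp [Real.pi_ne_zero]

instance isProbabilityMeasure_mu : IsProbabilityMeasure mu := by
  constructor
  rw [mu, Measure.map_apply continuous_pt.measurable MeasurableSet.univ, preimage_univ,
    withDensity_apply _ MeasurableSet.univ, Measure.restrict_univ,
    ← ofReal_integral_eq_lintegral_ofReal]
  · rw [← integral_Ioc_eq_integral_Ioo, ← intervalIntegral.integral_of_le (by norm_num),
      integral_dens, ENNReal.ofReal_one]
  · exact (continuousOn_dens.integrableOn_Icc).mono_set Ioo_subset_Icc_self
  · filter_upwards [ae_restrict_mem measurableSet_Ioo] with x hx using (dens_pos hx).le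

theorem mu_compl_arc : mu arcᶜ = 0 := by
  have hm : MeasurableSet (pt ⁻¹' arcᶜ) :=
    continuous_pt.measurable isCompact_arc.isClosed.measurableSet.compl
  rw [mu, Measure.map_apply continuous_pt.measurable isCompact_arc.isClosed.measurableSet.compl]
  refine withDensity_absolutelyContinuous _ _ ?_
  rw [Measure.restrict_apply hm]
  have : pt ⁻¹' arcᶜ ∩ Ioo (-1) 1 = ∅ := by
    ext x
    simp only [mem_inter_iff, mem_preimage, mem_compl_iff, mem_empty_iff_false, iff_false, not_and]
    exact fun h h' => h (pt_mem_arc (Ioo_subset_Icc_self h'))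
  rw [this, measure_empty]

theorem ae_mem_arc : ∀ᵐ s ∂mu, s ∈ arc := by
  rw [ae_iff]; exact mu_compl_arc

theorem support_mu : mu.support = arc := by
  apply Subset.antisymm
  · exact Measure.support_subset_of_isClosed isCompact_arc.isClosed ae_mem_arc
  · have key : pt '' Ioo (-1) 1 ⊆ mu.support := by
      rintro _ ⟨x, hx, rfl⟩
      rw [Measure.mem_support_iff_forall]
      intro U hU
      obtain ⟨W, hWU, hWo, hxW⟩ := mem_nhds_iff.1 hU
      refine lt_of_lt_of_le ?_ (measure_mono hWU)
      have hm : MeasurableSet (pt ⁻¹' W) := continuous_pt.measurable hWo.measurableSet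
      have hV : IsOpen (pt ⁻¹' W ∩ Ioo (-1) 1) := (hWo.preimage continuous_pt).inter isOpen_Ioo
      rw [mu, Measure.map_apply continuous_pt.measurable hWo.measurableSet, withDensity_apply _ hm,
        Measure.restrict_restrict hm,
        setLIntegral_pos_iff measurable_dens.ennreal_ofReal]
      have : Function.support (fun x => ENNReal.ofReal (dens x)) ∩ (pt ⁻¹' W ∩ Ioo (-1) 1) =
          pt ⁻¹' W ∩ Ioo (-1) 1 := by
        refine inter_eq_right.2 fun y hy => ?_
        rw [Function.mem_support, Ne, ENNReal.ofReal_eq_zero, not_le]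
        exact dens_pos hy.2
      rw [this]
      exact hV.measure_pos volume ⟨x, hxW, hx⟩
    have h2 : arc ⊆ closure (pt '' Ioo (-1) 1) := by
      rw [arc_eq_image, ← closure_Ioo (by norm_num : (-1 : ℝ) ≠ 1)]
      exact image_closure_subset_closure_image continuous_pt
    exact h2.trans (closure_minimal key Measure.isClosed_support)

/-! ### Finiteness and continuity of logarithmic potentials -/

theorem sub_pt (z : ℂ) (x : ℝ) : z - pt x = √2 * (nrm z - graphPoint x) := by
  conv_lhs => rw [← denrm_nrm z]
  simp only [pt, denrm]; ring

/-- Logarithmic integrals against the measure are finite and continuous, because the measure has a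
bounded density with respect to the abscissa. -/
theorem continuous_integral_log {l : ℝ → ℝ} (hl : Continuous l) (hle : ∀ x, |l x| ≤ |x|) :
    (∀ z : ℂ, Integrable (fun s => l (Real.log (1 / ‖z - s‖))) mu) ∧
      Continuous fun z : ℂ => ∫ s, l (Real.log (1 / ‖z - s‖)) ∂mu := by
  obtain ⟨M, hM0, hM⟩ := exists_dens_le
  set g : ℂ → ℝ → ℝ := fun z =>
    (Ioo (-1 : ℝ) 1).indicator fun x => dens x * l (Real.log (1 / ‖z - pt x‖)) with hg
  -- The shift of the abscissa by Re(nrm z) puts the possible singularity at u = 0 for every z, so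
  -- that one integrable majorant serves all z in a bounded set.
  set H : ℂ → ℝ → ℝ := fun z u => g z ((nrm z).re + u) with hH
  have hfm : ∀ z : ℂ, Measurable fun s : ℂ => l (Real.log (1 / ‖z - s‖)) := fun z =>
    hl.measurable.comp (Real.measurable_log.comp (by fun_prop))
  have hgm : ∀ z, Measurable (g z) := fun z =>
    (measurable_dens.mul ((hfm z).comp continuous_pt.measurable)).indicator measurableSet_Ioo
  have hHm : ∀ z, Measurable (H z) := fun z => (hgm z).comp (by fun_prop)
  -- It comes from |u| ≤ ‖z - pt x‖ ≤ √2 (K + 3) when ‖nrm z‖ ≤ K, as the norm of a graph point is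
  -- at most 3.
  set bound : ℝ → ℝ → ℝ := fun K => (Icc (-(K + 1)) (K + 1)).indicator fun u =>
    M * (|Real.log u| + |Real.log (√2 * (K + 3))|) with hbound
  have hbi : ∀ K, 0 ≤ K → Integrable (bound K) := fun K hK => by
    refine (integrable_indicator_iff measurableSet_Icc).2 ?_
    refine Integrable.const_mul (Integrable.add ?_ ?_) M
    · have h := (intervalIntegral.intervalIntegrable_log' (a := -(K + 1)) (b := K + 1)).abs
      rw [intervalIntegrable_iff_integrableOn_Icc_of_le (by linarith)] at h
      exact h
    · exact integrableOn_const (by simp)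
  have hHb : ∀ K, 0 ≤ K → ∀ z, ‖nrm z‖ ≤ K → ∀ u, u ≠ 0 → ‖H z u‖ ≤ bound K u := by
    intro K hK z hz u hu
    by_cases hx : (nrm z).re + u ∈ Ioo (-1 : ℝ) 1
    · have hre := (abs_re_le_norm (nrm z)).trans hz
      have hu2 : u ∈ Icc (-(K + 1)) (K + 1) := by
        rw [abs_le] at hre
        exact ⟨by linarith [hx.1, hre.2], by linarith [hx.2, hre.1]⟩
      simp only [hH, hg, hbound]
      rw [indicator_of_mem hx, indicator_of_mem hu2, norm_mul]
      set x := (nrm z).re + u with hxdef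
      have h2 : 1 ≤ √2 := Real.one_le_sqrt.2 (by norm_num)
      have hd1 : |u| ≤ ‖z - pt x‖ := by
        rw [sub_pt, norm_mul, norm_real, Real.norm_of_nonneg (Real.sqrt_nonneg _)]
        have := abs_re_le_norm (nrm z - graphPoint x)
        rw [sub_re, graphPoint_re, hxdef, sub_add_cancel_left, abs_neg] at this
        nlinarith [abs_nonneg u]
      have hd2 : ‖z - pt x‖ ≤ √2 * (K + 3) := by
        rw [sub_pt, norm_mul, norm_real, Real.norm_of_nonneg (Real.sqrt_nonneg _)]
        refine mul_le_mul_of_nonneg_left ((norm_sub_le _ _).trans (add_le_add hz ?_)) (by linarith)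
        refine (norm_le_abs_re_add_abs_im _).trans ?_
        rw [graphPoint_re, graphPoint_im]
        have h4 := (height_mid (abs_lt.2 hx)).1
        have h5 : √2 < 2 := by
          rw [Real.sqrt_lt' (by norm_num)]; norm_num
        have h6 : |height x| ≤ 2 := abs_le.2 ⟨by linarith [h4.1], by linarith [h4.2]⟩
        linarith [abs_lt.2 hx]
      have hupos : 0 < |u| := abs_pos.2 hu
      have hdpos : 0 < ‖z - pt x‖ := lt_of_lt_of_le hupos hd1
      refine mul_le_mul (hM x (Ioo_subset_Icc_self hx)) ?_ (norm_nonneg _) hM0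
      refine (hle _).trans ?_
      rw [one_div, Real.log_inv, abs_neg]
      have h7 := Real.log_le_log hupos hd1
      have h8 := Real.log_le_log hdpos hd2
      rw [Real.log_abs] at h7
      rw [abs_le]
      constructor
      · linarith [neg_abs_le (Real.log u), abs_nonneg (Real.log (√2 * (K + 3)))]
      · linarith [le_abs_self (Real.log (√2 * (K + 3))), abs_nonneg (Real.log u)]
    · simp only [hH, hg]
      rw [indicator_of_notMem hx, norm_zero]
      exact indicator_nonneg (fun u _ => by positivity) _
  have hne : ∀ a : ℝ, ∀ᵐ u : ℝ, u ≠ a := fun a => by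
    rw [ae_iff]; simp
  have hHi : ∀ z, Integrable (H z) := fun z =>
    (hbi _ (norm_nonneg _)).mono' (hHm z).aestronglyMeasurable
      ((hne 0).mono fun u hu => hHb _ (norm_nonneg (nrm z)) z le_rfl u hu)
  have hint : ∀ z : ℂ, ∫ s, l (Real.log (1 / ‖z - s‖)) ∂mu = ∫ u, H z u := fun z => by
    rw [integral_mu (hfm z).stronglyMeasurable, ← integral_indicator measurableSet_Ioo]
    exact (integral_add_left_eq_self (μ := volume) (g z) (nrm z).re).symm
  constructor
  · intro z
    rw [integrable_mu_iff (hfm z).stronglyMeasurable, ← integrable_indicator_iff measurableSet_Ioo]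
    have := (hHi z).comp_add_left (-(nrm z).re)
    simp only [hH, add_neg_cancel_left] at this
    exact this
  · rw [continuous_iff_continuousAt]
    intro z₀
    simp_rw [hint]
    refine continuousAt_of_dominated (bound := bound (‖nrm z₀‖ + 1))
      (Eventually.of_forall fun z => (hHm z).aestronglyMeasurable) ?_ (hbi _ (by positivity)) ?_
    · have h1 : ∀ᶠ z in 𝓝 z₀, ‖nrm z‖ < ‖nrm z₀‖ + 1 :=
        (continuous_nrm.norm.continuousAt).eventually (gt_mem_nhds (by linarith))
      filter_upwards [h1] with z hz
      exact (hne 0).mono fun u hu => hHb _ (by positivity) z hz.le u hu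
    -- Besides the singularity, the two values of u at which the indicator jumps at z₀ are
    -- discarded.
    · filter_upwards [hne 0, hne (1 - (nrm z₀).re), hne (-1 - (nrm z₀).re)] with u h0 h1 h2
      have hx : ContinuousAt (fun z => (nrm z).re + u) z₀ :=
        ((continuous_re.comp continuous_nrm).add_const u).continuousAt
      rcases lt_trichotomy |(nrm z₀).re + u| 1 with h | h | h
      · have hev : ∀ᶠ z in 𝓝 z₀, (nrm z).re + u ∈ Ioo (-1 : ℝ) 1 :=
          hx.eventually (Ioo_mem_nhds (abs_lt.1 h).1 (abs_lt.1 h).2)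
        have hc : ContinuousAt (fun z => dens ((nrm z).re + u) *
            l (Real.log (1 / ‖z - pt ((nrm z).re + u)‖))) z₀ := by
          have hd : ContinuousAt dens ((nrm z₀).re + u) :=
            continuousOn_dens.continuousAt (Icc_mem_nhds (abs_lt.1 h).1 (abs_lt.1 h).2)
          have hp : ContinuousAt (fun z => ‖z - pt ((nrm z).re + u)‖) z₀ :=
            (continuousAt_id.sub (ContinuousAt.comp (f := fun z => (nrm z).re + u) (g := pt)
              continuous_pt.continuousAt hx)).norm
          have hnz : ‖z₀ - pt ((nrm z₀).re + u)‖ ≠ 0 := by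
            rw [sub_pt, norm_ne_zero_iff]
            refine mul_ne_zero sqrt_two_ne fun h3 => h0 ?_
            have := congrArg re h3
            rw [sub_re, graphPoint_re, zero_re] at this
            linarith
          refine (ContinuousAt.comp (f := fun z => (nrm z).re + u) (g := dens) hd hx).mul
            (ContinuousAt.comp (g := l) hl.continuousAt (ContinuousAt.log ?_ ?_))
          · exact continuousAt_const.div hp hnz
          · exact one_div_ne_zero hnz
        refine hc.congr ?_
        filter_upwards [hev] with z hz
        simp only [hH, hg]
        rw [indicator_of_mem hz]
      · exfalso
        rcases eq_or_eq_neg_of_abs_eq h with h | h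
        · exact h1 (by linarith)
        · exact h2 (by linarith)
      · have hev : ∀ᶠ z in 𝓝 z₀, 1 < |(nrm z).re + u| := hx.abs.eventually (lt_mem_nhds h)
        refine (continuousAt_const (y := (0 : ℝ))).congr ?_
        filter_upwards [hev] with z hz
        simp only [hH, hg]
        rw [indicator_of_notMem]
        exact fun h' => absurd (abs_lt.2 h') hz.not_gt

theorem integrable_log_mu (z : ℂ) : Integrable (fun s => Real.log (1 / ‖z - s‖)) mu :=
  (continuous_integral_log continuous_id fun _ => le_rfl).1 z

theorem continuous_logPotential_mu : Continuous (logPotential mu) :=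
  (continuous_integral_log continuous_id fun _ => le_rfl).2

theorem continuous_integral_abs_log_mu :
    Continuous fun z : ℂ => ∫ s, |Real.log (1 / ‖z - s‖)| ∂mu :=
  (continuous_integral_log continuous_abs fun x => (abs_abs x).le).2

/-! ### The Cauchy transform of the measure -/

/-- The Cauchy transform of the equilibrium measure. -/
def cauchy (z : ℂ) : ℂ := ∫ s, (z - s)⁻¹ ∂mu

theorem exists_ball_far {z : ℂ} (hz : z ∉ arc) :
    ∃ δ > 0, ∀ w ∈ Metric.ball z δ, ∀ s ∈ arc, δ ≤ ‖w - s‖ := by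
  obtain ⟨ε, hε, h⟩ := Metric.isOpen_iff.1 isCompact_arc.isClosed.isOpen_compl z hz
  refine ⟨ε / 2, by positivity, fun w hw s hs => ?_⟩
  by_contra hc
  suffices hsz : s ∈ Metric.ball z ε from h hsz hs
  rw [Metric.mem_ball] at hw ⊢
  have : dist s w < ε / 2 := by rw [dist_comm, dist_eq]; exact not_le.1 hc
  linarith [dist_triangle s w z]

theorem norm_inv_sub_le {w s : ℂ} {δ : ℝ} (hδ : 0 < δ) (h : δ ≤ ‖w - s‖) : ‖(w - s)⁻¹‖ ≤ δ⁻¹ := by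
  rw [norm_inv]; exact inv_anti₀ hδ h

theorem measurable_inv_sub (z : ℂ) : Measurable fun s : ℂ => (z - s)⁻¹ := by fun_prop

theorem integrable_inv_sub {z : ℂ} (hz : z ∉ arc) : Integrable (fun s => (z - s)⁻¹) mu := by
  obtain ⟨δ, hδ, h⟩ := exists_ball_far hz
  refine Integrable.of_bound (measurable_inv_sub z).aestronglyMeasurable δ⁻¹ ?_
  filter_upwards [ae_mem_arc] with s hs
  exact norm_inv_sub_le hδ (h z (Metric.mem_ball_self hδ) s hs)

theorem differentiableOn_cauchy : DifferentiableOn ℂ cauchy arcᶜ := fun z hz => by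
  obtain ⟨δ, hδ, h⟩ := exists_ball_far hz
  refine (hasDerivAt_integral_of_dominated_loc_of_deriv_le (μ := mu) (𝕜 := ℂ)
    (F := fun z s => (z - s)⁻¹) (F' := fun z s => -((z - s)⁻¹) ^ 2) (bound := fun _ => δ⁻¹ ^ 2)
    (Metric.ball_mem_nhds z hδ) (Eventually.of_forall fun z => (measurable_inv_sub z).aestronglyMeasurable)
    (integrable_inv_sub hz) ?_ ?_ (integrable_const _)
    ?_).2.differentiableAt.differentiableWithinAt
  · exact ((measurable_inv_sub z).pow_const 2).neg.aestronglyMeasurable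
  · filter_upwards [ae_mem_arc] with s hs w hw
    rw [norm_neg, norm_pow]
    exact pow_le_pow_left₀ (norm_nonneg _) (norm_inv_sub_le hδ (h w hw s hs)) 2
  · filter_upwards [ae_mem_arc] with s hs w hw
    have hne : w - s ≠ 0 := norm_pos_iff.1 (lt_of_lt_of_le hδ (h w hw s hs))
    have h1 := ((hasDerivAt_id w).sub_const s).inv hne
    refine h1.congr_deriv ?_
    simp [div_eq_mul_inv]

theorem analyticOnNhd_cauchy : AnalyticOnNhd ℂ cauchy arcᶜ :=
  differentiableOn_cauchy.analyticOnNhd isCompact_arc.isClosed.isOpen_compl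

/-- The real linear functional `v ↦ -Re (a v)`, depending linearly on `a`. -/
def negReMul : ℂ →L[ℝ] ℂ →L[ℝ] ℝ :=
  -((ContinuousLinearMap.compL ℝ ℂ ℂ ℝ reCLM).comp (ContinuousLinearMap.mul ℝ ℂ))

theorem negReMul_apply (a v : ℂ) : negReMul a v = -(a * v).re := rfl

theorem norm_negReMul_le (a : ℂ) : ‖negReMul a‖ ≤ ‖a‖ := by
  refine ContinuousLinearMap.opNorm_le_bound _ (norm_nonneg a) fun v => ?_
  rw [negReMul_apply, norm_neg, ← norm_mul]
  exact abs_re_le_norm _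

theorem hasFDerivAt_logPotential {z : ℂ} (hz : z ∉ arc) :
    HasFDerivAt (logPotential mu) (negReMul (cauchy z)) z := by
  obtain ⟨δ, hδ, h⟩ := exists_ball_far hz
  have h1 := hasFDerivAt_integral_of_dominated_of_fderiv_le (μ := mu) (𝕜 := ℝ)
    (F := fun z s => Real.log (1 / ‖z - s‖)) (F' := fun z s => negReMul (z - s)⁻¹)
    (bound := fun _ => δ⁻¹) (x₀ := z) (Metric.ball_mem_nhds z hδ)
    (Eventually.of_forall fun z => (integrable_log_mu z).aestronglyMeasurable)
    (integrable_log_mu z)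
    (negReMul.continuous.measurable.comp (measurable_inv_sub z)).aestronglyMeasurable ?_
    (integrable_const _) ?_
  · refine h1.congr_fderiv ?_
    rw [cauchy]
    exact negReMul.integral_comp_comm (integrable_inv_sub hz)
  · filter_upwards [ae_mem_arc] with s hs w hw
    exact (norm_negReMul_le _).trans (norm_inv_sub_le hδ (h w hw s hs))
  · filter_upwards [ae_mem_arc] with s hs w hw
    have hne : w - s ≠ 0 := norm_pos_iff.1 (lt_of_lt_of_le hδ (h w hw s hs))
    -- The quotient is close to 1, so the principal logarithm is differentiable there.
    have h2 : HasDerivAt (fun y : ℂ => log ((y - s) / (w - s))) (1 / (w - s) / ((w - s) / (w - s))) w :=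
      (((hasDerivAt_id w).sub_const s).div_const (w - s)).clog (by simp [div_self hne])
    rw [div_self hne, div_one] at h2
    have h3 := (reCLM.hasFDerivAt.comp w (h2.hasFDerivAt.restrictScalars ℝ)).neg.sub_const
      (Real.log ‖w - s‖)
    refine HasFDerivAt.congr_fderiv (h3.congr_of_eventuallyEq
        (f₁ := fun y : ℂ => Real.log (1 / ‖y - s‖)) ?_) ?_
    · filter_upwards [(continuousAt_id.sub continuousAt_const).eventually_ne hne] with y hy
      simp only [Function.comp, reCLM_apply, Pi.neg_apply, log_re, norm_div]
      have hy' : y - s ≠ 0 := hy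
      rw [Real.log_div (norm_ne_zero_iff.2 hy') (norm_ne_zero_iff.2 hne), one_div, Real.log_inv]
      ring
    · ext; simp [negReMul_apply]; ring

theorem exists_norm_arc_le : ∃ M > 0, ∀ s ∈ arc, ‖s‖ ≤ M := by
  obtain ⟨M, hM⟩ := isCompact_arc.isBounded.exists_norm_le
  exact ⟨max M 1, by positivity, fun s hs => (hM s hs).trans (le_max_left _ _)⟩

theorem isBigO_cauchy :
    (fun z => cauchy z - 1 / z) =O[cocompact ℂ] fun z : ℂ => 1 / z ^ 2 := by
  obtain ⟨M, hM, h⟩ := exists_norm_arc_le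
  refine Asymptotics.IsBigO.of_bound (2 * M) ?_
  have h2 : ∀ᶠ z in cocompact ℂ, 2 * M < ‖z‖ :=
    (tendsto_norm_cocompact_atTop (E := ℂ)).eventually (eventually_gt_atTop (2 * M))
  filter_upwards [h2] with z hz
  have hz0 : z ≠ 0 := norm_pos_iff.1 (by linarith)
  have hzn : 0 < ‖z‖ := by linarith
  have hzarc : z ∉ arc := fun hmem => by linarith [h z hmem]
  have e : cauchy z - 1 / z = ∫ s, ((z - s)⁻¹ - 1 / z) ∂mu := by
    rw [integral_sub (integrable_inv_sub hzarc) (integrable_const _), cauchy]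
    simp
  rw [e]
  have : ∀ᵐ s ∂mu, ‖(z - s)⁻¹ - 1 / z‖ ≤ 2 * M * ‖1 / z ^ 2‖ := by
    filter_upwards [ae_mem_arc] with s hs
    have h3 : ‖z‖ / 2 ≤ ‖z - s‖ := by linarith [norm_sub_norm_le z s, h s hs]
    have h4 : z - s ≠ 0 := norm_pos_iff.1 (by linarith)
    have : (z - s)⁻¹ - 1 / z = s / ((z - s) * z) := by field_simp; ring
    rw [this, norm_div, norm_mul, norm_div, norm_one, norm_pow, mul_one_div,
      div_le_div_iff₀ (by positivity) (by positivity)]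
    have h5 := h s hs
    calc ‖s‖ * ‖z‖ ^ 2 ≤ M * ‖z‖ ^ 2 := by gcongr
      _ = 2 * M * (‖z‖ / 2 * ‖z‖) := by ring
      _ ≤ 2 * M * (‖z - s‖ * ‖z‖) := by gcongr
  have h6 := norm_integral_le_of_norm_le_const this
  simpa using h6

/-! #### Evaluation near infinity -/

/-- The factorization 2v(P - cos θ) = (1 - ve^{iθ})(1 - ve^{-iθ}) gives a primitive with two
logarithms; |v| < 1 keeps both off the cut, and they cancel at θ = 0 and θ = π. -/
theorem integral_inv_sub_cos {v : ℂ} (hv : ‖v‖ < 1) (hv0 : v ≠ 0) :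
    ∫ θ in (0 : ℝ)..Real.pi, ((v + v⁻¹) / 2 - cos θ)⁻¹ = Real.pi / ((v⁻¹ - v) / 2) := by
  have hnorm : ∀ θ : ℝ, ‖v * exp (θ * I)‖ < 1 := fun θ => by
    rw [norm_mul, norm_exp_ofReal_mul_I, mul_one]; exact hv
  have hnorm' : ∀ θ : ℝ, ‖v * exp (-(θ * I))‖ < 1 := fun θ => by
    have := hnorm (-θ); rwa [ofReal_neg, neg_mul] at this
  have hslit : ∀ w : ℂ, ‖w‖ < 1 → 1 - w ∈ slitPlane := fun w hw => by
    left
    have := (le_abs_self w.re).trans (abs_re_le_norm w)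
    simp; linarith
  have hS : (v⁻¹ - v) / 2 ≠ 0 := by
    intro h
    have h1 : v⁻¹ = v := by linear_combination 2 * h
    have h2 : v * v = 1 := by
      have := mul_inv_cancel₀ hv0
      rwa [h1] at this
    have h3 := congrArg norm h2
    rw [norm_mul, norm_one] at h3
    nlinarith [norm_nonneg v]
  have hP : ∀ θ : ℝ, (v + v⁻¹) / 2 - cos θ ≠ 0 ∧ 1 - v * exp (θ * I) ≠ 0 ∧
      1 - v * exp (-(θ * I)) ≠ 0 ∧ ((v + v⁻¹) / 2 - cos θ) * (2 * v) =
        (1 - v * exp (θ * I)) * (1 - v * exp (-(θ * I))) := fun θ => by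
    have h1 := slitPlane_ne_zero (hslit _ (hnorm θ))
    have h2 := slitPlane_ne_zero (hslit _ (hnorm' θ))
    have h3 : exp (θ * I) * exp (-(θ * I)) = 1 := by rw [← exp_add]; simp
    have h4 : ((v + v⁻¹) / 2 - cos θ) * (2 * v) =
        (1 - v * exp (θ * I)) * (1 - v * exp (-(θ * I))) := by
      rw [cos]
      field_simp
      linear_combination -v ^ 2 * h3
    refine ⟨fun h => ?_, h1, h2, h4⟩
    rw [h, zero_mul] at h4
    exact mul_ne_zero h1 h2 h4.symm
  have hd : ∀ θ ∈ uIcc (0 : ℝ) Real.pi, HasDerivAt (fun θ : ℝ => (θ + I * log (1 - v * exp (θ * I)) -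
      I * log (1 - v * exp (-(θ * I)))) / ((v⁻¹ - v) / 2)) (((v + v⁻¹) / 2 - cos θ)⁻¹) θ := by
    intro θ _
    obtain ⟨h1, h2, h3, h4⟩ := hP θ
    have hθ : HasDerivAt (fun θ : ℝ => (θ : ℂ)) 1 θ := (hasDerivAt_id θ).ofReal_comp
    have e1 := (((hθ.mul_const I).cexp.const_mul v).const_sub 1).clog_real (hslit _ (hnorm θ))
    have e2 := (((hθ.mul_const I).fun_neg.cexp.const_mul v).const_sub 1).clog_real (hslit _ (hnorm' θ))
    have e3 := (((hθ.fun_add (e1.const_mul I)).fun_sub (e2.const_mul I))).div_const ((v⁻¹ - v) / 2)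
    refine e3.congr_deriv ?_
    set a := exp (θ * I) with ha
    set b := exp (-(θ * I)) with hb
    have hab : a * b = 1 := by rw [ha, hb, ← exp_add]; simp
    have h5 : ((v + v⁻¹) / 2 - cos θ)⁻¹ = 2 * v / ((1 - v * a) * (1 - v * b)) := by
      rw [← h4]; field_simp
    have h6 : ((v⁻¹ - v) / 2)  = (1 - v ^ 2) / (2 * v) := by field_simp
    have h7 : 1 - v ^ 2 ≠ 0 := by
      intro h; rw [h6, h, zero_div] at hS; exact hS rfl
    rw [h5, h6]
    field_simp
    linear_combination (-(v*a*(1 - v*b)) - v*b*(1-v*a)) * I_sq - v ^ 2 * hab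
  have hint : IntervalIntegrable (fun θ : ℝ => ((v + v⁻¹) / 2 - cos θ)⁻¹) volume 0 Real.pi := by
    refine Continuous.intervalIntegrable ?_ _ _
    exact Continuous.inv₀ (by fun_prop) fun θ => (hP θ).1
  rw [intervalIntegral.integral_eq_sub_of_hasDerivAt hd hint]
  have h8 : exp (-(Real.pi * I)) = -1 := by rw [exp_neg, exp_pi_mul_I]; norm_num
  rw [exp_pi_mul_I, h8]
  simp

/-- Polynomial division by P - cos θ leaves the remainder -S²(P + √2 i), where S² = P² - 1, and the
quotient is integrated term by term. -/
theorem integral_jacobi {v : ℂ} (hv : ‖v‖ < 1) (hv0 : v ≠ 0) {P S : ℂ} (hP : P = (v + v⁻¹) / 2)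
    (hS : S = (v⁻¹ - v) / 2) (hne : ∀ θ : ℝ, P - cos θ ≠ 0) :
    ∫ θ in (0 : ℝ)..Real.pi, sin θ ^ 2 * (cos θ + √2 * I) / (P - cos θ) =
      Real.pi * (P ^ 2 + √2 * I * P - 1 / 2 - S * (P + √2 * I)) := by
  have hS2 : S ^ 2 = P ^ 2 - 1 := by rw [hS, hP]; field_simp; ring
  have h1 : ∀ θ : ℝ, sin θ ^ 2 * (cos θ + √2 * I) / (P - cos θ) =
      -(S ^ 2 * (P + √2 * I)) * (P - cos θ)⁻¹ + ((P ^ 2 + √2 * I * P - 1) +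
        (P + √2 * I) * cos θ + cos θ ^ 2) := fun θ => by
    have := hne θ
    have h2 : sin (θ : ℂ) ^ 2 = 1 - cos (θ : ℂ) ^ 2 := by
      rw [← sin_sq_add_cos_sq (θ : ℂ)]; ring
    rw [h2, hS2]
    field_simp
    ring
  have hS0 : S ≠ 0 := by
    intro h
    rw [hS] at h
    have h1 : v⁻¹ = v := by linear_combination 2 * h
    have h2 : v * v = 1 := by
      have := mul_inv_cancel₀ hv0
      rwa [h1] at this
    have h3 := congrArg norm h2
    rw [norm_mul, norm_one] at h3
    nlinarith [norm_nonneg v]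
  simp_rw [h1]
  have hc : ∫ θ in (0 : ℝ)..Real.pi, cos (θ : ℂ) = 0 := by
    have : ∀ θ : ℝ, cos (θ : ℂ) = ((Real.cos θ : ℝ) : ℂ) := fun θ => (ofReal_cos θ).symm
    simp_rw [this]
    rw [intervalIntegral.integral_ofReal, integral_cos]; simp
  have hc2 : ∫ θ in (0 : ℝ)..Real.pi, cos (θ : ℂ) ^ 2 = Real.pi / 2 := by
    have : ∀ θ : ℝ, cos (θ : ℂ) ^ 2 = ((Real.cos θ ^ 2 : ℝ) : ℂ) := fun θ => by
      rw [ofReal_pow, ofReal_cos]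
    simp_rw [this]
    rw [intervalIntegral.integral_ofReal, integral_cos_sq]; simp
  have hcont : Continuous fun θ : ℝ => (P - cos θ)⁻¹ := Continuous.inv₀ (by fun_prop) hne
  rw [intervalIntegral.integral_add, intervalIntegral.integral_add, intervalIntegral.integral_add,
    intervalIntegral.integral_const_mul, intervalIntegral.integral_const_mul, hc, hc2,
    intervalIntegral.integral_const]
  · have := integral_inv_sub_cos hv hv0
    rw [← hP, ← hS] at this
    rw [this, sub_zero, real_smul]
    field_simp
    ring
  all_goals exact Continuous.intervalIntegrable (by fun_prop) _ _

/-- Along the arc phi' dp is purely imaginary, so the real density may be replaced by phi' dp/(πi).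
The integrand then becomes a holomorphic differential, whose path can be deformed. -/
theorem cauchy_eq_intervalIntegral (z : ℂ) :
    cauchy z = -I / (√2 * Real.pi) * ∫ x in (-1 : ℝ)..1,
      phiDeriv (graphPoint x) * (1 + deriv height x * I) / (nrm z - graphPoint x) := by
  rw [cauchy, integral_mu (measurable_inv_sub z).stronglyMeasurable,
    ← intervalIntegral.integral_const_mul, intervalIntegral.integral_of_le (by norm_num),
    integral_Ioc_eq_integral_Ioo]
  refine setIntegral_congr_fun measurableSet_Ioo fun x hx => ?_
  have h1 := (phiDeriv_graphPoint_mid (abs_lt.2 hx)).1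
  set W := phiDeriv (graphPoint x) * (1 + deriv height x * I) with hW
  have h2 : W = W.im * I := by
    apply Complex.ext <;> simp [h1]
  have h3 : dens x = W.im / Real.pi := rfl
  rw [sub_pt, h3, real_smul, mul_inv]
  generalize W.im = y at h2
  rw [h2]
  push_cast
  simp only [div_eq_mul_inv, mul_inv]
  linear_combination (√2 : ℂ)⁻¹ * (Real.pi : ℂ)⁻¹ * y * (nrm z - graphPoint x)⁻¹ * I_sq

/-! ### The substitution p = cos η and deformation of the path -/

/-- The angle `η` with `cos η = p`, `sin η = root p`. -/
def angle (p : ℂ) : ℂ := -I * log (p + I * root p)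

theorem exp_I_mul_angle (p : ℂ) : exp (I * angle p) = p + I * root p := by
  rw [angle, ← mul_assoc, mul_neg, I_mul_I, neg_neg, one_mul, exp_log (add_root_ne_zero (root_sq p))]

theorem exp_neg_I_mul_angle (p : ℂ) : exp (-(I * angle p)) = p - I * root p := by
  rw [exp_neg, exp_I_mul_angle]
  exact inv_eq_of_mul_eq_one_right (add_mul_sub_of_sq (root_sq p))

theorem cos_angle (p : ℂ) : cos (angle p) = p := by
  rw [cos, mul_comm (angle p), neg_mul, mul_comm (angle p), exp_I_mul_angle, exp_neg_I_mul_angle]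
  ring

theorem sin_angle (p : ℂ) : sin (angle p) = root p := by
  rw [sin, mul_comm (angle p), neg_mul, mul_comm (angle p), exp_I_mul_angle, exp_neg_I_mul_angle]
  linear_combination -root p * I_sq

theorem hasDerivAt_angle {p : ℂ} (hp : p ∈ slit) : HasDerivAt angle (-1 / root p) p := by
  have h1 : p + I * root p ∈ slitPlane := Or.inr (im_add_root_pos hp).ne'
  have h2 := (((hasDerivAt_id p).add ((hasDerivAt_root hp).const_mul I)).clog h1).const_mul (-I)
  refine h2.congr_deriv ?_
  have h3 := root_ne_zero hp
  have h4 := add_root_ne_zero (root_sq p)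
  simp only [id, Pi.add_apply]
  field_simp
  linear_combination p * I_sq

theorem angle_one : angle 1 = 0 := by simp [angle, root_one]

theorem angle_neg_one : angle (-1) = Real.pi := by
  rw [angle, root_neg_one, mul_zero, add_zero, log_neg_one]
  linear_combination -(Real.pi : ℂ) * I_sq

theorem continuousOn_angle_graphPoint :
    ContinuousOn (fun x => angle (graphPoint x)) (Icc (-1) 1) := fun x hx => by
  have hr : ContinuousAt root (graphPoint x) := by
    by_cases h : |x| = 1
    · refine continuousAt_root_of_sq_eq_one ?_
      rw [graphPoint, height_of_abs_eq_one h, ofReal_zero, zero_mul, add_zero, ← ofReal_pow,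
        ← sq_abs, h]
      simp
    · exact (hasDerivAt_root (graphPoint_mem_slit h)).continuousAt
  have hg : ContinuousAt (fun p => p + I * root p) (graphPoint x) := by fun_prop
  have hl : ContinuousWithinAt log {w | 0 ≤ w.im} (graphPoint x + I * root (graphPoint x)) := by
    by_cases h : x = -1
    · have h1 : graphPoint x = -1 := by
        rw [graphPoint, height_of_abs_eq_one (by simp [h]), h]; simp
      rw [h1, root_neg_one]
      exact continuousWithinAt_log_of_re_neg_of_im_zero (by simp) (by simp)
    · refine (continuousAt_clog ?_).continuousWithinAt
      by_cases h' : x = 1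
      · have h1 : graphPoint x = 1 := by
          rw [graphPoint, height_of_abs_eq_one (by simp [h']), h']; simp
        rw [h1, root_one]
        simp
      · have : |x| ≠ 1 := fun hh => by
          rcases eq_or_eq_neg_of_abs_eq hh with h1 | h1
          exacts [h' h1, h h1]
        exact Or.inr (im_add_root_pos (graphPoint_mem_slit this)).ne'
  have := (hl.comp (t := {w | 0 ≤ w.im}) (s := univ)
    (f := fun p => p + I * root p) hg.continuousWithinAt fun p _ => im_add_root_nonneg p)
  rw [continuousWithinAt_univ] at this
  have h2 : ContinuousAt angle (graphPoint x) := continuousAt_const.mul this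
  exact (ContinuousAt.comp (g := angle) h2 continuous_graphPoint.continuousAt).continuousWithinAt

theorem norm_cos_le (w : ℂ) : ‖cos w‖ ≤ Real.exp ‖w‖ := by
  rw [cos, norm_div]
  have h1 := norm_exp_le_exp_norm (w * I)
  have h2 := norm_exp_le_exp_norm (-w * I)
  have h3 := norm_add_le (exp (w * I)) (exp (-w * I))
  rw [norm_mul, norm_I, mul_one] at h1
  rw [norm_mul, norm_I, mul_one, norm_neg] at h2
  rw [Complex.norm_two, div_le_iff₀ two_pos]
  linarith

theorem graphPoint_one : graphPoint 1 = 1 := by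
  rw [graphPoint, height_of_abs_eq_one (by simp)]; simp

theorem graphPoint_neg_one : graphPoint (-1) = -1 := by
  rw [graphPoint, height_of_abs_eq_one (by simp)]; simp

theorem exists_norm_angle_lt : ∃ r > Real.pi, ∀ x ∈ Icc (-1 : ℝ) 1, ‖angle (graphPoint x)‖ < r := by
  obtain ⟨M, hM⟩ := isCompact_Icc.exists_bound_of_continuousOn continuousOn_angle_graphPoint
  exact ⟨max M Real.pi + 1, by linarith [le_max_right M Real.pi], fun x hx => by
    linarith [hM x hx, le_max_left M Real.pi]⟩

/-- Deformation of the integral over the trajectory, pulled back by the cosine, to an integral over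
a real period. -/
theorem integral_graphPoint_eq {r : ℝ} (hr : Real.pi < r)
    (hangle : ∀ x ∈ Icc (-1 : ℝ) 1, ‖angle (graphPoint x)‖ < r) {P : ℂ} (hP : Real.exp r < ‖P‖) :
    ∫ x in (-1 : ℝ)..1, phiDeriv (graphPoint x) * (1 + deriv height x * I) / (P - graphPoint x) =
      √2 * ∫ θ in (0 : ℝ)..Real.pi, sin θ ^ 2 * (cos θ + √2 * I) / (P - cos θ) := by
  -- |cos w| ≤ e^{|w|} < e^r < |P|: the disk of radius r, which contains both paths, has no pole.
  have hne : ∀ w : ℂ, ‖w‖ < r → P - cos w ≠ 0 := fun w hw h => by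
    have h1 := norm_cos_le w
    rw [← sub_eq_zero.1 h] at h1
    linarith [Real.exp_lt_exp.2 hw]
  have hne' : ∀ x ∈ Icc (-1 : ℝ) 1, P - graphPoint x ≠ 0 := fun x hx => by
    have := hne _ (hangle x hx)
    rwa [cos_angle] at this
  set m : ℂ → ℂ := fun w => sin w ^ 2 * (cos w + √2 * I) / (P - cos w) with hm
  have hd : DifferentiableOn ℂ m (Metric.ball 0 r) := fun w hw => by
    have := hne w (by simpa using hw)
    have h1 : DifferentiableAt ℂ m w := by
      rw [hm]; fun_prop (disch := assumption)
    exact h1.differentiableWithinAt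
  obtain ⟨M, hM⟩ := hd.isExactOn_ball
  have h1 : ∫ θ in (0 : ℝ)..Real.pi, m θ = M Real.pi - M 0 := by
    have hmem : ∀ θ ∈ uIcc (0 : ℝ) Real.pi, (θ : ℂ) ∈ Metric.ball (0 : ℂ) r := fun θ hθ => by
      rw [uIcc_of_le Real.pi_pos.le] at hθ
      rw [mem_ball_zero_iff, norm_real, Real.norm_eq_abs, abs_of_nonneg hθ.1]
      linarith [hθ.2]
    rw [intervalIntegral.integral_eq_sub_of_hasDerivAt (f := fun θ : ℝ => M θ)
      (fun θ hθ => (hM θ (hmem θ hθ)).comp_ofReal)]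
    · simp
    · refine ContinuousOn.intervalIntegrable fun θ hθ => ?_
      exact ((hd.continuousOn.continuousAt (Metric.isOpen_ball.mem_nhds (hmem θ hθ))).comp
        continuous_ofReal.continuousAt).continuousWithinAt
  rw [intervalIntegral.integral_eq_sub_of_hasDerivAt_of_le
    -- The minus sign is that of dη = -dp / root p; the endpoints p = 1 and p = -1 correspond to η =
    -- 0 and η = π.
    (f := fun x => -(√2 : ℂ) * M (angle (graphPoint x))) (by norm_num)]
  · rw [graphPoint_one, graphPoint_neg_one, angle_one, angle_neg_one, h1]; ring
  · refine continuousOn_const.mul fun x hx => ?_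
    have hmem : angle (graphPoint x) ∈ Metric.ball (0 : ℂ) r := by simpa using hangle x hx
    exact (hM _ hmem).continuousAt.comp_continuousWithinAt
      (f := fun x => angle (graphPoint x)) (continuousOn_angle_graphPoint x hx)
  · intro x hx
    have hmem : angle (graphPoint x) ∈ Metric.ball (0 : ℂ) r := by
      simpa using hangle x (Ioo_subset_Icc_self hx)
    have hs := graphPoint_mem_slit (abs_lt.2 hx).ne
    have h2 := ((hM _ hmem).comp _ (hasDerivAt_angle hs)).comp_of_eq x
      (hasDerivAt_graphPoint x) rfl
    have h3 := h2.const_mul (-(√2 : ℂ))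
    refine h3.congr_deriv ?_
    have h4 := root_ne_zero hs
    have h5 := hne' x (Ioo_subset_Icc_self hx)
    simp only [hm, cos_angle, sin_angle, phiDeriv]
    field_simp
  · refine ContinuousOn.intervalIntegrable ?_
    rw [uIcc_of_le (by norm_num)]
    have h1 := continuousOn_phiDeriv_graphPoint
    have h2 := continuous_deriv_height
    have h3 := continuous_graphPoint
    exact ContinuousOn.div (by fun_prop) (by fun_prop) hne'

/-- P ± s, with s² = P² - 1, have product 1 and sum 2P. If the smaller modulus were at least 1, both
would be 1 and |P| ≤ 1. -/
theorem exists_joukowski {P : ℂ} (hP : 1 < ‖P‖) :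
    ∃ v : ℂ, ‖v‖ < 1 ∧ v ≠ 0 ∧ P = (v + v⁻¹) / 2 := by
  obtain ⟨s, hs⟩ := IsAlgClosed.exists_pow_nat_eq (P ^ 2 - 1) (n := 2) two_pos
  have key : ∀ v w : ℂ, v * w = 1 → v + w = 2 * P → ‖v‖ ≤ ‖w‖ →
      ‖v‖ < 1 ∧ v ≠ 0 ∧ P = (v + v⁻¹) / 2 := fun v w h1 h2 h3 => by
    have hv0 : v ≠ 0 := left_ne_zero_of_mul_eq_one h1
    have h4 : w = v⁻¹ := eq_inv_of_mul_eq_one_right h1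
    have h5 : ‖v‖ * ‖w‖ = 1 := by rw [← norm_mul, h1, norm_one]
    refine ⟨?_, hv0, by rw [← h4, h2]; ring⟩
    by_contra hc
    have h6 : 2 * ‖P‖ ≤ ‖v‖ + ‖w‖ := by
      rw [← Complex.norm_two, ← norm_mul, ← h2]; exact norm_add_le _ _
    nlinarith [norm_nonneg v]
  rcases le_total ‖P - s‖ ‖P + s‖ with h | h
  · exact ⟨_, key (P - s) (P + s) (by linear_combination -hs) (by ring) h⟩
  · exact ⟨_, key (P + s) (P - s) (by linear_combination -hs) (by ring) h⟩

/-- With z = √2 P + i the term -(i/2)z² cancels the polynomial part of the Cauchy transform exactly.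
What remains is -iS(P + √2 i), whose square is Q. -/
theorem exists_sq_eq_Q_of_large :
    ∃ B : ℝ, ∀ z, B < ‖nrm z‖ → (-(I / 2) * z ^ 2 - cauchy z) ^ 2 = Q z := by
  obtain ⟨r, hr, h⟩ := exists_norm_angle_lt
  refine ⟨Real.exp r, fun z hz => ?_⟩
  have h1 : 1 < ‖nrm z‖ := lt_trans (Real.one_lt_exp_iff.2 (Real.pi_pos.trans hr)) hz
  obtain ⟨v, hv, hv0, hP⟩ := exists_joukowski h1
  have hne : ∀ θ : ℝ, nrm z - cos θ ≠ 0 := fun θ hh => by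
    have := abs_le.2 ⟨Real.neg_one_le_cos θ, Real.cos_le_one θ⟩
    rw [sub_eq_zero.1 hh, ← ofReal_cos, norm_real, Real.norm_eq_abs] at h1
    linarith
  have hpi : (Real.pi : ℂ) ≠ 0 := ofReal_ne_zero.2 Real.pi_ne_zero
  have h2 := sqrt_two_ne
  have hS2 : ((v⁻¹ - v) / 2) ^ 2 = nrm z ^ 2 - 1 := by rw [hP]; field_simp; ring
  have e : cauchy z = -I * (nrm z ^ 2 + √2 * I * nrm z - 1 / 2 -
      (v⁻¹ - v) / 2 * (nrm z + √2 * I)) := by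
    rw [cauchy_eq_intervalIntegral, integral_graphPoint_eq hr h hz, integral_jacobi hv hv0 hP rfl hne]
    field_simp
  have hz' : z = √2 * nrm z + I := (denrm_nrm z).symm
  have e2 : -(I / 2) * z ^ 2 - cauchy z = -I * ((v⁻¹ - v) / 2) * (nrm z + √2 * I) := by
    have e3 : z ^ 2 = (√2 * nrm z + I) ^ 2 := by rw [← hz']
    rw [e, e3]
    linear_combination (-(I / 2) * nrm z ^ 2) * sqrt_two_mul_self - (I / 2) * I_sq
  rw [e2, Q_eq, mul_pow, mul_pow, hS2, neg_pow, I_sq]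
  ring

/-! ### The branch of the square root -/

theorem preimage_nrm (A : Set ℂ) : nrm ⁻¹' A = denrm '' A := by
  apply Subset.antisymm
  · exact fun z hz => ⟨nrm z, hz, denrm_nrm z⟩
  · rintro _ ⟨p, hp, rfl⟩
    rwa [mem_preimage, nrm_denrm]

theorem isPreconnected_preimage_nrm {A : Set ℂ} (hA : IsPreconnected A) :
    IsPreconnected (nrm ⁻¹' A) := by
  rw [preimage_nrm]; exact hA.image _ continuous_denrm.continuousOn

theorem isPreconnected_compl_arc : IsPreconnected arcᶜ :=
  isPreconnected_preimage_nrm isPreconnected_compl_midArc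

/-- The branch of `Q^{1/2}` in the complement of the arc. -/
def branch (z : ℂ) : ℂ := -(I / 2) * z ^ 2 - cauchy z

theorem analyticOnNhd_branch : AnalyticOnNhd ℂ branch arcᶜ := fun z hz => by
  have := analyticOnNhd_cauchy z hz
  unfold branch
  fun_prop

theorem analyticAt_Q (z : ℂ) : AnalyticAt ℂ Q z := by unfold Q; fun_prop

theorem tendsto_nrm_cocompact : Tendsto nrm (cocompact ℂ) (cocompact ℂ) :=
  Topology.IsClosedEmbedding.tendsto_cocompact
    (Homeomorph.mk (Equiv.mk nrm denrm denrm_nrm nrm_denrm) continuous_nrm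
      continuous_denrm).isClosedEmbedding

theorem tendsto_denrm_cocompact : Tendsto denrm (cocompact ℂ) (cocompact ℂ) :=
  Topology.IsClosedEmbedding.tendsto_cocompact
    (Homeomorph.mk (Equiv.mk denrm nrm nrm_denrm denrm_nrm) continuous_denrm
      continuous_nrm).isClosedEmbedding

theorem branch_sq {z : ℂ} (hz : z ∈ arcᶜ) : branch z ^ 2 = Q z := by
  obtain ⟨B, hB⟩ := exists_sq_eq_Q_of_large
  have h1 : ∀ᶠ z in cocompact ℂ, B < ‖nrm z‖ ∧ z ∈ arcᶜ :=
    ((tendsto_norm_cocompact_atTop.comp tendsto_nrm_cocompact).eventually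
      (eventually_gt_atTop B)).and isCompact_arc.compl_mem_cocompact
  obtain ⟨z₀, h2, h3⟩ := h1.exists
  have h4 : ∀ᶠ z in 𝓝 z₀, B < ‖nrm z‖ :=
    (continuous_norm.comp continuous_nrm).continuousAt.eventually (lt_mem_nhds h2)
  exact (analyticOnNhd_branch.pow 2).eqOn_of_preconnected_of_eventuallyEq
    (fun z _ => analyticAt_Q z) isPreconnected_compl_arc h3
    (h4.mono fun z hz => hB z hz) hz

theorem isSqrtBranch_branch : IsSqrtBranch arc branch where
  analytic := analyticOnNhd_branch
  sq _ hz := branch_sq hz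
  asymptotic := by
    refine isBigO_cauchy.neg_left.congr_left fun z => ?_
    rw [branch]; ring

theorem IsSqrtBranch.tendsto {γ : Set ℂ} {R : ℂ → ℂ} (hR : IsSqrtBranch γ R) :
    Tendsto (fun z => R z / z ^ 2) (cocompact ℂ) (𝓝 (-(I / 2))) := by
  have h0 : Tendsto (fun z : ℂ => z⁻¹) (cocompact ℂ) (𝓝 0) := by
    rw [← Metric.cobounded_eq_cocompact]; exact tendsto_inv₀_cobounded
  have h1 : Tendsto (fun z : ℂ => 1 / z ^ 2) (cocompact ℂ) (𝓝 0) := by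
    simpa [inv_pow] using h0.pow 2
  have h2 := hR.asymptotic.trans_tendsto h1
  have h3 : Tendsto (fun z => (R z - (-(I / 2) * z ^ 2 - 1 / z)) * (1 / z ^ 2) - (I / 2)
      - z⁻¹ ^ 3) (cocompact ℂ) (𝓝 (0 * 0 - (I / 2) - 0 ^ 3)) :=
    ((h2.mul h1).sub_const _).sub (h0.pow 3)
  rw [show (0 : ℂ) * 0 - (I / 2) - 0 ^ 3 = -(I / 2) by ring] at h3
  refine h3.congr' ?_
  have h4 : ∀ᶠ z in cocompact ℂ, z ≠ (0 : ℂ) :=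
    (isCompact_singleton (x := (0 : ℂ))).compl_mem_cocompact
  filter_upwards [h4] with z hz
  field_simp
  ring

/-- The squares agree on a connected set, so R = ± branch; the leading coefficient -i/2 at infinity
excludes the minus sign. -/
theorem IsSqrtBranch.eq_branch {R : ℂ → ℂ} (hR : IsSqrtBranch arc R) {z : ℂ} (hz : z ∉ arc) :
    R z = branch z := by
  have h := AnalyticOnNhd.eq_zero_or_eq_zero_of_mul_eq_zero (f := fun z => R z - branch z)
    (g := fun z => R z + branch z) (hR.analytic.sub analyticOnNhd_branch)
    (hR.analytic.add analyticOnNhd_branch)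
    (fun z hz => by linear_combination hR.sq z hz - branch_sq hz) isPreconnected_compl_arc
  rcases h with h | h
  · exact sub_eq_zero.1 (h z hz)
  · have h1 : Tendsto (fun z => R z / z ^ 2) (cocompact ℂ) (𝓝 (-(-(I / 2)))) := by
      refine isSqrtBranch_branch.tendsto.neg.congr' ?_
      filter_upwards [isCompact_arc.compl_mem_cocompact] with z hz
      rw [eq_neg_of_add_eq_zero_left (h z hz), neg_div]
    have h2 := tendsto_nhds_unique h1 hR.tendsto
    exact absurd (congrArg im h2) (by norm_num)

/-- A sign test on the imaginary axis: `branch` divided by z² tends to -i/2, while the sign of this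
expression is opposite to that of y + √2. Hence the plus sign above the arc and the minus sign
below. -/
theorem sqrtQ_denrm_mul_I (y : ℝ) : sqrtQ (denrm (y * I)) / denrm (y * I) ^ 2 =
    ((-(√(1 + y ^ 2) * (y + √2) / (√2 * y + 1) ^ 2) : ℝ) : ℂ) * I := by
  have h1 : denrm (y * I) = ((√2 * y + 1 : ℝ) : ℂ) * I := by
    rw [denrm]; push_cast; ring
  have h2 : sqrtQ (denrm (y * I)) = ((√(1 + y ^ 2) * (y + √2) : ℝ) : ℂ) * I := by
    rw [sqrtQ, nrm_denrm, phiDeriv, root_mul_I]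
    have := sqrt_two_ne
    field_simp
    push_cast
    ring
  rw [h2, h1, mul_pow, I_sq]
  push_cast
  simp only [div_eq_mul_inv, inv_neg, mul_neg, mul_one]
  ring

theorem tendsto_denrm_mul_I_atTop :
    Tendsto (fun y : ℝ => denrm (y * I)) atTop (cocompact ℂ) := by
  refine tendsto_denrm_cocompact.comp ?_
  rw [← Metric.cobounded_eq_cocompact, ← tendsto_norm_atTop_iff_cobounded]
  simpa using tendsto_abs_atTop_atTop

theorem tendsto_denrm_mul_I_atBot :
    Tendsto (fun y : ℝ => denrm (y * I)) atBot (cocompact ℂ) := by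
  refine tendsto_denrm_cocompact.comp ?_
  rw [← Metric.cobounded_eq_cocompact, ← tendsto_norm_atTop_iff_cobounded]
  simpa using tendsto_abs_atBot_atTop

theorem branch_eq_or {U : Set ℂ} (hU : IsPreconnected U) (h1 : U ⊆ slit) (h2 : U ⊆ midArcᶜ) :
    (∀ z ∈ nrm ⁻¹' U, branch z = sqrtQ z) ∨ ∀ z ∈ nrm ⁻¹' U, branch z = -sqrtQ z := by
  have hb : AnalyticOnNhd ℂ branch (nrm ⁻¹' U) := fun z hz => analyticOnNhd_branch z (h2 hz)
  have hs : AnalyticOnNhd ℂ sqrtQ (nrm ⁻¹' U) := fun z hz => analyticAt_sqrtQ (h1 hz)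
  have h := AnalyticOnNhd.eq_zero_or_eq_zero_of_mul_eq_zero (f := fun z => branch z - sqrtQ z)
    (g := fun z => branch z + sqrtQ z) (hb.sub hs) (hb.add hs)
    (fun z hz => by linear_combination branch_sq (h2 hz) - sqrtQ_sq z)
    (isPreconnected_preimage_nrm hU)
  exact h.imp (fun h z hz => sub_eq_zero.1 (h z hz))
    fun h z hz => eq_neg_of_add_eq_zero_left (h z hz)

theorem eventually_branch_im_neg : ∀ᶠ z in cocompact ℂ, (branch z / z ^ 2).im < 0 :=
  (continuous_im.continuousAt.tendsto.comp isSqrtBranch_branch.tendsto).eventually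
    (gt_mem_nhds (by norm_num))

theorem branch_eq_sqrtQ {z : ℂ} (hz : nrm z ∈ upperRegion) : branch z = sqrtQ z := by
  refine (branch_eq_or isPreconnected_upperRegion upperRegion_subset_slit
    upperRegion_subset_compl).resolve_right (fun h => ?_) z hz
  obtain ⟨y, h1, h2⟩ := ((tendsto_denrm_mul_I_atTop.eventually eventually_branch_im_neg).and
    (eventually_gt_atTop 0)).exists
  have h3 : denrm (y * I) ∈ nrm ⁻¹' upperRegion := by
    rw [mem_preimage, nrm_denrm, mem_upperRegion]; left; simpa using h2
  rw [h _ h3, neg_div, sqrtQ_denrm_mul_I, neg_im, im_ofReal_mul, I_im, mul_one, neg_neg] at h1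
  have : 0 ≤ √(1 + y ^ 2) * (y + √2) / (√2 * y + 1) ^ 2 := by positivity
  linarith

theorem branch_eq_neg_sqrtQ {z : ℂ} (hz : nrm z ∈ lowerRegion) : branch z = -sqrtQ z := by
  refine (branch_eq_or isPreconnected_lowerRegion lowerRegion_subset_slit
    lowerRegion_subset_compl).resolve_left (fun h => ?_) z hz
  obtain ⟨y, h1, h2, h4⟩ := ((tendsto_denrm_mul_I_atBot.eventually eventually_branch_im_neg).and
    ((eventually_lt_atBot (height 0)).and (eventually_lt_atBot (-√2)))).exists
  have h3 : denrm (y * I) ∈ nrm ⁻¹' lowerRegion := by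
    rw [mem_preimage, nrm_denrm, mem_lowerRegion]; simpa using h2
  rw [h _ h3, sqrtQ_denrm_mul_I, im_ofReal_mul, I_im, mul_one] at h1
  have : √(1 + y ^ 2) * (y + √2) / (√2 * y + 1) ^ 2 ≤ 0 :=
    div_nonpos_of_nonpos_of_nonneg
      (mul_nonpos_of_nonneg_of_nonpos (Real.sqrt_nonneg _) (by linarith)) (sq_nonneg _)
  linarith

/-! ### The two sides of the trajectory -/

/-- Strict differentiability is required since both abscissae vary. The error constant is taken so
small that it also absorbs the factor |height'|. -/
theorem eventually_height_sub_lt (x₀ : ℝ) : ∀ᶠ q in 𝓝 x₀ ×ˢ 𝓝 (0 : ℝ),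
    |height (q.1 - q.2 * deriv height q.1) - height q.1 + q.2 * deriv height q.1 * deriv height x₀| ≤
      |q.2| / 2 := by
  have hs := (analyticAt_height x₀).hasStrictDerivAt
  have hc : Continuous fun q : ℝ × ℝ => (q.1 - q.2 * deriv height q.1, q.1) := by
    have := continuous_deriv_height; fun_prop
  have ht : Tendsto (fun q : ℝ × ℝ => (q.1 - q.2 * deriv height q.1, q.1)) (𝓝 (x₀, 0))
      (𝓝 (x₀, x₀)) := by
    have := hc.tendsto (x₀, 0); simpa using this
  have hk : 0 < (2 * (|deriv height x₀| + 1))⁻¹ := by positivity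
  have h1 := ht.eventually (hs.hasStrictFDerivAt.isLittleO.bound hk)
  have h2 : ∀ᶠ q : ℝ × ℝ in 𝓝 (x₀, 0), |deriv height q.1| < |deriv height x₀| + 1 := by
    have hc2 : Continuous fun q : ℝ × ℝ => |deriv height q.1| := by
      have := continuous_deriv_height; fun_prop
    exact hc2.continuousAt.eventually (gt_mem_nhds (by simp))
  rw [← nhds_prod_eq]
  filter_upwards [h1, h2] with q h3 h4
  simp only [ContinuousLinearMap.toSpanSingleton_apply, smul_eq_mul, Real.norm_eq_abs] at h3
  rw [show q.1 - q.2 * deriv height q.1 - q.1 = -(q.2 * deriv height q.1) by ring, abs_neg,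
    abs_mul] at h3
  calc _ = |height (q.1 - q.2 * deriv height q.1) - height q.1 -
        -(q.2 * deriv height q.1) * deriv height x₀| := by congr 1; ring
    _ ≤ _ := h3
    _ ≤ (2 * (|deriv height x₀| + 1))⁻¹ * (|q.2| * (|deriv height x₀| + 1)) := by gcongr
    _ = |q.2| / 2 := by field_simp

theorem eventually_side (x₀ : ℝ) (hx : |x₀| < 1) : ∀ᶠ q in 𝓝 x₀ ×ˢ 𝓝 (0 : ℝ),
    (0 < q.2 → graphPoint q.1 + q.2 * (I * (1 + deriv height q.1 * I)) ∈ upperRegion) ∧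
    (q.2 < 0 → graphPoint q.1 + q.2 * (I * (1 + deriv height q.1 * I)) ∈ lowerRegion) := by
  have h1 := eventually_height_sub_lt x₀
  rw [← nhds_prod_eq] at h1 ⊢
  have hd := continuous_deriv_height
  have h2 : ∀ᶠ q : ℝ × ℝ in 𝓝 (x₀, 0), |q.1 - q.2 * deriv height q.1| < 1 := by
    have hc : Continuous fun q : ℝ × ℝ => |q.1 - q.2 * deriv height q.1| := by fun_prop
    exact hc.continuousAt.eventually (gt_mem_nhds (by simpa using hx))
  -- At x₀ the product is a square, so it stays above -1/4 nearby. The displaced point then clears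
  -- the graph by at least (1 - 1/4 - 1/2)|ε| in the vertical direction.
  have h3 : ∀ᶠ q : ℝ × ℝ in 𝓝 (x₀, 0), -(1 / 4) < deriv height q.1 * deriv height x₀ := by
    have hc : Continuous fun q : ℝ × ℝ => deriv height q.1 * deriv height x₀ := by fun_prop
    refine hc.continuousAt.eventually (lt_mem_nhds ?_)
    simp only
    nlinarith [mul_self_nonneg (deriv height x₀)]
  filter_upwards [h1, h2, h3] with q h4 h5 h6
  have hre : (graphPoint q.1 + q.2 * (I * (1 + deriv height q.1 * I))).re =
      q.1 - q.2 * deriv height q.1 := by simp [graphPoint]; ring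
  have him : (graphPoint q.1 + q.2 * (I * (1 + deriv height q.1 * I))).im =
      height q.1 + q.2 := by simp [graphPoint]
  have h7 := abs_le.1 h4
  constructor
  · intro hq
    rw [abs_of_pos hq] at h7
    rw [mem_upperRegion, hre, him]
    exact Or.inr ⟨h5, by nlinarith⟩
  · intro hq
    rw [abs_of_neg hq] at h7
    rw [mem_lowerRegion, hre, him]
    exact ⟨h5, by nlinarith⟩

namespace IsArcParam

variable {c : ℝ → ℂ} (hc : IsArcParam c)
include hc

theorem eventually_side {t : ℝ} (ht : t ∈ Ioo (0 : ℝ) 1) : ∀ᶠ x : ℝ × ℝ in 𝓝 t ×ˢ 𝓝 (0 : ℝ),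
    (0 < x.2 → nrm (c x.1 + x.2 * (I * deriv c x.1)) ∈ upperRegion) ∧
    (x.2 < 0 → nrm (c x.1 + x.2 * (I * deriv c x.1)) ∈ lowerRegion) := by
  have h1 : ContinuousAt (absc c) t :=
    (hc.hasDerivAt_absc (Ioo_subset_Icc_self ht)).continuousAt
  have h2 : ContinuousAt (fun u => (deriv c u / √2).re) t := by
    have := (hc.analytic t (Ioo_subset_Icc_self ht)).deriv.continuousAt
    exact continuous_re.continuousAt.comp (this.div_const _)
  have h3 : Tendsto (fun x : ℝ × ℝ => (absc c x.1, x.2 * (deriv c x.1 / √2).re))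
      (𝓝 t ×ˢ 𝓝 (0 : ℝ)) (𝓝 (absc c t) ×ˢ 𝓝 0) := by
    refine Tendsto.prodMk (h1.tendsto.comp tendsto_fst) ?_
    have := (tendsto_snd (f := 𝓝 t) (g := 𝓝 (0 : ℝ))).mul (h2.tendsto.comp tendsto_fst)
    rwa [zero_mul] at this
  have h4 : ∀ᶠ x : ℝ × ℝ in 𝓝 t ×ˢ 𝓝 (0 : ℝ), x.1 ∈ Ioo (0 : ℝ) 1 :=
    tendsto_fst.eventually (Ioo_mem_nhds ht.1 ht.2)
  filter_upwards [h3.eventually (CubicSCurve.eventually_side _ (hc.absc_mem ht)), h4] with x h5 h6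
  have h7 := Ioo_subset_Icc_self h6
  have h8 := hc.deriv_absc_pos h6
  have h9 : (deriv c x.1 / √2).re = deriv (absc c) x.1 := (hc.hasDerivAt_absc h7).deriv.symm
  have e : nrm (c x.1 + x.2 * (I * deriv c x.1)) = graphPoint (absc c x.1) +
      ((x.2 * deriv (absc c) x.1 : ℝ) : ℂ) * (I * (1 + deriv height (absc c x.1) * I)) := by
    have h10 : nrm (c x.1 + x.2 * (I * deriv c x.1)) =
        nrm (c x.1) + x.2 * (I * (deriv c x.1 / √2)) := by
      simp only [nrm]; ring
    rw [h10, hc.nrm_eq h7, hc.deriv_eq h6]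
    push_cast; ring
  rw [h9] at h5
  rw [e]
  exact ⟨fun h => h5.1 (mul_pos h h8), fun h => h5.2 (mul_neg_of_neg_of_pos h h8)⟩

theorem nrm_mem_slit {t : ℝ} (ht : t ∈ Ioo (0 : ℝ) 1) : nrm (c t) ∈ slit := by
  rw [hc.nrm_eq (Ioo_subset_Icc_self ht)]
  exact graphPoint_mem_slit (hc.absc_mem ht).ne

/-- Left of the arc R is `sqrtQ`, which is continuous across the arc. -/
theorem hasLeftLimit {R : ℂ → ℂ} (hR : IsSqrtBranch arc R) {t : ℝ} (ht : t ∈ Ioo (0 : ℝ) 1) :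
    HasLeftLimit R c t (sqrtQ (c t)) := by
  have h1 := hc.analytic t (Ioo_subset_Icc_self ht)
  have h2 : Tendsto (fun x : ℝ × ℝ => c x.1 + (x.2 : ℂ) * (I * deriv c x.1))
      (𝓝 t ×ˢ 𝓝 (0 : ℝ)) (𝓝 (c t + (0 : ℝ) * (I * deriv c t))) :=
    (h1.continuousAt.tendsto.comp tendsto_fst).add
      (((continuous_ofReal.tendsto 0).comp tendsto_snd).mul
        ((h1.deriv.continuousAt.tendsto.comp tendsto_fst).const_mul I))
  rw [ofReal_zero, zero_mul, add_zero] at h2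
  have hle : 𝓝 t ×ˢ 𝓝[>] (0 : ℝ) ≤ 𝓝 t ×ˢ 𝓝 (0 : ℝ) := prod_mono le_rfl nhdsWithin_le_nhds
  have h3 := ((analyticAt_sqrtQ (hc.nrm_mem_slit ht)).continuousAt.tendsto.comp h2).mono_left hle
  refine h3.congr' ?_
  have h4 : ∀ᶠ x : ℝ × ℝ in 𝓝 t ×ˢ 𝓝[>] (0 : ℝ), 0 < x.2 :=
    tendsto_snd.eventually self_mem_nhdsWithin
  filter_upwards [hle (hc.eventually_side ht), h4] with x h5 h6
  have h7 := h5.1 h6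
  rw [Function.comp, hR.eq_branch (upperRegion_subset_compl h7), branch_eq_sqrtQ h7]

end IsArcParam

/-! ### The total potential -/

theorem hasDerivAt_V (z : ℂ) : HasDerivAt V (-(I * z ^ 2)) z := by
  refine ((((hasDerivAt_pow 3 z)).const_mul (-I)).div_const 3).congr_deriv ?_
  push_cast
  ring

theorem hasFDerivAt_re {f : ℂ → ℂ} {f' z : ℂ} (h : HasDerivAt f f' z) :
    HasFDerivAt (fun z => (f z).re) (negReMul (-f')) z := by
  refine (reCLM.hasFDerivAt.comp z (h.hasFDerivAt.restrictScalars ℝ)).congr_fderiv ?_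
  ext v; simp [negReMul_apply]; ring

/-- V'(z) = -iz², so V' minus twice the Cauchy transform is twice `branch`. -/
theorem hasFDerivAt_totalPotential {z : ℂ} (hz : z ∉ arc) :
    HasFDerivAt (totalPotential field mu) (negReMul (-(2 * branch z))) z := by
  have h := ((hasFDerivAt_logPotential hz).const_mul (2 : ℝ)).add (hasFDerivAt_re (hasDerivAt_V z))
  refine h.congr_fderiv ?_
  rw [← map_smul, ← map_add, branch, real_smul]
  congr 1
  push_cast
  ring

theorem continuous_totalPotential : Continuous (totalPotential field mu) := by
  have h1 := continuous_logPotential_mu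
  have h2 : Continuous field := by unfold field V; fun_prop
  unfold totalPotential
  fun_prop

theorem hasFDerivAt_phi_nrm_re {z : ℂ} (hz : nrm z ∈ slit) :
    HasFDerivAt (fun z => (phi (nrm z)).re) (negReMul (-sqrtQ z)) z :=
  hasFDerivAt_re (hasDerivAt_phi_nrm hz)

theorem exists_totalPotential_eq_of_region {U : Set ℂ} (ho : IsOpen U) (hU : IsPreconnected U)
    (h1 : U ⊆ slit) (h2 : U ⊆ midArcᶜ) {k : ℝ} (hk : ∀ z ∈ nrm ⁻¹' U, branch z = k * sqrtQ z) :
    ∃ l, ∀ z, nrm z ∈ U → totalPotential field mu z = l + 2 * k * (phi (nrm z)).re := by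
  have hd : ∀ z ∈ nrm ⁻¹' U, HasFDerivAt (fun z => totalPotential field mu z -
      2 * k * (phi (nrm z)).re) (0 : ℂ →L[ℝ] ℝ) z := fun z hz => by
    refine ((hasFDerivAt_totalPotential (h2 hz)).sub
      ((hasFDerivAt_phi_nrm_re (h1 hz)).const_mul (2 * k))).congr_fderiv ?_
    rw [← map_smul, ← map_sub, hk z hz, real_smul]
    convert negReMul.map_zero using 2
    push_cast
    ring
  obtain ⟨l, hl⟩ := (ho.preimage continuous_nrm).exists_is_const_of_fderiv_eq_zero (𝕜 := ℝ)
    (isPreconnected_preimage_nrm hU)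
    (fun z hz => (hd z hz).differentiableAt.differentiableWithinAt) fun z hz => (hd z hz).fderiv
  exact ⟨l, fun z hz => by linarith [hl z hz]⟩

theorem nrm_add_mul (z v : ℂ) : nrm (z + v) = nrm z + v / √2 := by simp only [nrm]; ring

theorem eq_of_region_limit {U : Set ℂ} {l k : ℝ}
    (h : ∀ z, nrm z ∈ U → totalPotential field mu z = l + 2 * k * (phi (nrm z)).re)
    {z n : ℂ} (hz : nrm z ∈ slit) (hz0 : (phi (nrm z)).re = 0)
    (hn : ∀ᶠ ε : ℝ in 𝓝[>] 0, nrm (z + ε * n) ∈ U) : totalPotential field mu z = l := by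
  have hc : Tendsto (fun ε : ℝ => z + ε * n) (𝓝[>] 0) (𝓝 z) := by
    have : Continuous fun ε : ℝ => z + ε * n := by fun_prop
    have := (this.tendsto 0).mono_left (nhdsWithin_le_nhds (s := Ioi 0))
    simpa using this
  have h1 := (continuous_totalPotential.tendsto z).comp hc
  have h2 := (((hasFDerivAt_phi_nrm_re hz).continuousAt.tendsto.comp hc).const_mul
    (2 * k)).const_add l
  rw [hz0, mul_zero, add_zero] at h2
  refine tendsto_nhds_unique (h1.congr' ?_) h2
  exact hn.mono fun ε hε => h _ hε

theorem nrm_pt_add {x : ℝ} (hx : |x| < 1) :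
    (∀ᶠ ε : ℝ in 𝓝[>] 0, nrm (pt x + ε * (√2 * (I * (1 + deriv height x * I)))) ∈ upperRegion) ∧
    ∀ᶠ ε : ℝ in 𝓝[>] 0, nrm (pt x + ε * -(√2 * (I * (1 + deriv height x * I)))) ∈ lowerRegion := by
  have h2 := sqrt_two_ne
  have e : ∀ ε : ℝ, nrm (pt x + ε * (√2 * (I * (1 + deriv height x * I)))) =
      graphPoint x + ε * (I * (1 + deriv height x * I)) := fun ε => by
    rw [nrm_add_mul, nrm_pt]; field_simp
  have h1 : ∀ᶠ ε : ℝ in 𝓝 0, _ := (eventually_side x hx).curry.self_of_nhds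
  constructor
  · filter_upwards [nhdsWithin_le_nhds h1, self_mem_nhdsWithin] with ε h3 h4
    rw [e]; exact h3.1 h4
  · have h5 : Tendsto (fun ε : ℝ => -ε) (𝓝[>] 0) (𝓝 0) := by
      have := (continuous_neg.tendsto (0 : ℝ)).mono_left (nhdsWithin_le_nhds (s := Ioi 0))
      simpa using this
    filter_upwards [h5.eventually h1, self_mem_nhdsWithin] with ε h3 h4
    have := h3.2 (neg_lt_zero.2 h4)
    rw [← e] at this
    simpa using this

/-- The constant value of the total potential on the arc, with its values on the two sides. -/
theorem exists_totalPotential_eq : ∃ l,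
    (∀ z, nrm z ∈ upperRegion → totalPotential field mu z = l + 2 * 1 * (phi (nrm z)).re) ∧
    (∀ z, nrm z ∈ lowerRegion → totalPotential field mu z = l + 2 * (-1) * (phi (nrm z)).re) ∧
    ∀ z ∈ arc, totalPotential field mu z = l := by
  obtain ⟨l, hl⟩ := exists_totalPotential_eq_of_region isOpen_upperRegion
    isPreconnected_upperRegion upperRegion_subset_slit upperRegion_subset_compl (k := 1)
    fun z hz => by rw [branch_eq_sqrtQ hz]; simp
  obtain ⟨l', hl'⟩ := exists_totalPotential_eq_of_region isOpen_lowerRegion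
    isPreconnected_lowerRegion lowerRegion_subset_slit lowerRegion_subset_compl (k := -1)
    fun z hz => by rw [branch_eq_neg_sqrtQ hz]; simp
  have h1 : ∀ x : ℝ, |x| < 1 → nrm (pt x) ∈ slit ∧ (phi (nrm (pt x))).re = 0 := fun x hx => by
    rw [nrm_pt]; exact ⟨graphPoint_mem_slit hx.ne, phi_graphPoint_re hx.le⟩
  have h2 : ∀ x : ℝ, |x| < 1 → totalPotential field mu (pt x) = l := fun x hx =>
    eq_of_region_limit hl (h1 x hx).1 (h1 x hx).2 (nrm_pt_add hx).1
  -- Both one-sided expressions extend continuously to the arc, and one common boundary point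
  -- identifies the constants.
  have h3 : l' = l := by
    rw [← h2 0 (by simp)]
    exact (eq_of_region_limit hl' (h1 0 (by simp)).1 (h1 0 (by simp)).2
      (nrm_pt_add (by simp)).2).symm
  refine ⟨l, hl, h3 ▸ hl', fun z hz => ?_⟩
  rw [arc_eq_image] at hz
  obtain ⟨x, hx, rfl⟩ := hz
  rw [← closure_Ioo (by norm_num)] at hx
  have hcl : IsClosed {x | totalPotential field mu (pt x) = l} :=
    isClosed_eq (continuous_totalPotential.comp continuous_pt) continuous_const
  exact closure_minimal (fun x hx => h2 x (abs_lt.2 hx)) hcl hx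

/-- The formula valid on one side extends smoothly through the arc because `phi` does, and by
continuity it has the right value at the point itself. -/
theorem hasOneSidedDeriv_of_region {U : Set ℂ} {l k : ℝ}
    (h : ∀ z, nrm z ∈ U → totalPotential field mu z = l + 2 * k * (phi (nrm z)).re)
    {z n : ℂ} (hz : nrm z ∈ slit) (hz0 : (phi (nrm z)).re = 0)
    (hn : ∀ᶠ ε : ℝ in 𝓝[>] 0, nrm (z + ε * n) ∈ U) :
    HasOneSidedDeriv (totalPotential field mu) z n (2 * k * (sqrtQ z * n).re) := by
  have h1 : HasDerivAt (fun ε : ℝ => z + ε * n) n 0 := by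
    simpa using ((hasDerivAt_id (0 : ℝ)).ofReal_comp.mul_const n).const_add z
  have h2 : HasDerivAt (fun ε : ℝ => l + 2 * k * (phi (nrm (z + ε * n))).re)
      (2 * k * (sqrtQ z * n).re) 0 := by
    have h3 := (hasFDerivAt_phi_nrm_re hz).comp_hasDerivAt_of_eq (0 : ℝ) h1 (by simp)
    rw [negReMul_apply, neg_mul, neg_re, neg_neg] at h3
    exact (h3.const_mul (2 * k)).const_add l
  rw [HasOneSidedDeriv, ← hasDerivWithinAt_Ioi_iff_Ici]
  refine h2.hasDerivWithinAt.congr_of_eventuallyEq (hn.mono fun ε hε => h _ hε) ?_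
  have := eq_of_region_limit h hz hz0 hn
  simp [this, hz0]

/-! ### Contours -/

/-- Only interior points avoid the arc, but |R| = √|Q| is bounded up to the endpoints. -/
theorem intervalIntegrable_mul_deriv {R : ℂ → ℂ} (hR : IsSqrtBranch arc R) {G : ℝ → ℂ}
    (hG : AnalyticOnNhd ℝ G univ) {a b : ℝ} (hab : a ≤ b) (h : ∀ u ∈ Ioo a b, G u ∉ arc) :
    IntervalIntegrable (fun u => R (G u) * deriv G u) volume a b := by
  have hc : Continuous G := continuous_iff_continuousAt.2 fun u => (hG u trivial).continuousAt
  have hd : Continuous (deriv G) :=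
    continuous_iff_continuousAt.2 fun u => (hG u trivial).deriv.continuousAt
  have hQ : Continuous fun u => √‖Q (G u)‖ * ‖deriv G u‖ := by
    have : Continuous Q := continuous_iff_continuousAt.2 fun z => (analyticAt_Q z).continuousAt
    fun_prop
  obtain ⟨M, hM⟩ := isCompact_Icc.exists_bound_of_continuousOn (hQ.continuousOn (s := Icc a b))
  rw [intervalIntegrable_iff_integrableOn_Ioo_of_le hab]
  refine IntegrableOn.of_bound (C := M) (by simp) ?_ ?_
  · refine ContinuousOn.aestronglyMeasurable (fun u hu => ?_) measurableSet_Ioo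
    exact ((hR.analytic _ (h u hu)).continuousAt.comp hc.continuousAt).continuousWithinAt.mul
      hd.continuousAt.continuousWithinAt
  · refine (ae_restrict_iff' measurableSet_Ioo).2 (ae_of_all _ fun u hu => ?_)
    have h1 := hM u (Ioo_subset_Icc_self hu)
    rw [← hR.sq _ (h u hu), norm_pow, Real.sqrt_sq (norm_nonneg _), ← norm_mul, norm_norm] at h1
    exact h1

theorem totalPotential_sub_eq {R : ℂ → ℂ} (hR : IsSqrtBranch arc R) {G : ℝ → ℂ}
    (hG : AnalyticOnNhd ℝ G univ) {a b : ℝ} (hab : a ≤ b) (h : ∀ u ∈ Ioo a b, G u ∉ arc) :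
    totalPotential field mu (G b) - totalPotential field mu (G a) =
      2 * (∫ u in a..b, R (G u) * deriv G u).re := by
  have hi := intervalIntegrable_mul_deriv hR hG hab h
  have hc : Continuous G := continuous_iff_continuousAt.2 fun u => (hG u trivial).continuousAt
  rw [← intervalIntegral.integral_eq_sub_of_hasDerivAt_of_le
    (f := fun u => totalPotential field mu (G u)) (f' := fun u => 2 * (R (G u) * deriv G u).re) hab
    (continuous_totalPotential.comp hc).continuousOn ?_ ?_]
  · rw [intervalIntegral.integral_const_mul]
    congr 1
    exact reCLM.intervalIntegral_comp_comm hi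
  · intro u hu
    have h1 := (hasFDerivAt_totalPotential (h u hu)).comp_hasDerivAt u
      (hG u trivial).differentiableAt.hasDerivAt
    refine h1.congr_deriv ?_
    rw [negReMul_apply, hR.eq_branch (h u hu), neg_mul, neg_re, neg_neg, mul_assoc]
    simp
  · exact ⟨(reCLM.integrable_comp hi.1).const_mul 2, (reCLM.integrable_comp hi.2).const_mul 2⟩

namespace IsContourExtension

variable {R : ℂ → ℂ} {G : ℝ → ℂ} (hG : IsContourExtension arc R G)
include hG

theorem isArcParam : IsArcParam G where
  analytic := fun t _ => hG.contour.analytic t trivial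
  regular := fun t _ => hG.contour.regular t
  injOn := hG.contour.injective.injOn
  source := hG.start
  target := hG.finish
  mem_arc := fun t ht => by rw [← hG.middle]; exact mem_image_of_mem _ ht

theorem notMem_arc {t : ℝ} (ht : t ∉ Icc (0 : ℝ) 1) : G t ∉ arc := by
  rw [← hG.middle]
  rintro ⟨u, hu, h⟩
  exact ht (hG.contour.injective h ▸ hu)

theorem le_totalPotential (hR : IsSqrtBranch arc R) {l : ℝ}
    (hl : ∀ z ∈ arc, totalPotential field mu z = l) {z : ℂ} (hz : z ∈ range G) :
    l ≤ totalPotential field mu z := by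
  obtain ⟨t, rfl⟩ := hz
  have hmem : ∀ u ∈ Icc (0 : ℝ) 1, totalPotential field mu (G u) = l := fun u hu =>
    hl _ (hG.isArcParam.mem_arc u hu)
  rcases lt_or_ge t 0 with h | h
  · have h1 := totalPotential_sub_eq hR hG.contour.analytic h.le
      fun u hu => hG.notMem_arc fun h' => h'.1.not_gt hu.2
    have h2 := (hG.phi_one t h).2
    rw [intervalIntegral.integral_symm, neg_re] at h2
    linarith [hmem 0 (by simp)]
  rcases lt_or_ge 1 t with h' | h'
  · have h1 := totalPotential_sub_eq hR hG.contour.analytic h'.le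
      fun u hu => hG.notMem_arc fun h'' => h''.2.not_gt hu.1
    have h2 := (hG.phi_two t h').2
    linarith [hmem 1 (by simp)]
  · exact (hmem t ⟨h, h'⟩).ge

/-- Crossing the arc reverses both the sign of Re phi in the potential and the normal, and the two
changes cancel. -/
theorem exists_normal_derivatives {t : ℝ} (ht : t ∈ Ioo (0 : ℝ) 1) : ∃ d : ℝ,
    HasOneSidedDeriv (totalPotential field mu) (G t) (leftNormal G t) d ∧
    HasOneSidedDeriv (totalPotential field mu) (G t) (-leftNormal G t) d := by
  obtain ⟨l, h1, h2, -⟩ := exists_totalPotential_eq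
  have hc := hG.isArcParam
  have hs := hc.nrm_mem_slit ht
  have h0 : (phi (nrm (G t))).re = 0 := by
    rw [hc.nrm_eq (Ioo_subset_Icc_self ht)]; exact phi_graphPoint_re (hc.absc_mem ht).le
  have h3 : ∀ᶠ ε : ℝ in 𝓝 0, _ := (hc.eventually_side ht).curry.self_of_nhds
  have hpos : 0 < ‖deriv G t‖ := norm_pos_iff.2 (hG.contour.regular t)
  have h4 : ∀ k : ℝ, Tendsto (fun ε : ℝ => ε * (k / ‖deriv G t‖)) (𝓝[>] 0) (𝓝 0) := fun k => by
    have hcont : Continuous fun ε : ℝ => ε * (k / ‖deriv G t‖) := by fun_prop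
    have := (hcont.tendsto 0).mono_left (nhdsWithin_le_nhds (s := Ioi 0))
    rwa [zero_mul] at this
  have e : ∀ k ε : ℝ, G t + ((ε * (k / ‖deriv G t‖) : ℝ) : ℂ) * (I * deriv G t) =
      G t + ε * (k * leftNormal G t) := fun k ε => by
    rw [leftNormal]; push_cast; ring
  have h5 : ∀ᶠ ε : ℝ in 𝓝[>] 0, nrm (G t + ε * leftNormal G t) ∈ upperRegion := by
    filter_upwards [(h4 1).eventually h3, self_mem_nhdsWithin] with ε h6 h7
    have := h6.1 (mul_pos h7 (by positivity))
    rwa [e, ofReal_one, one_mul] at this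
  have h6 : ∀ᶠ ε : ℝ in 𝓝[>] 0, nrm (G t + ε * -leftNormal G t) ∈ lowerRegion := by
    filter_upwards [(h4 (-1)).eventually h3, self_mem_nhdsWithin] with ε h6 h7
    have := h6.2 (mul_neg_of_pos_of_neg h7 (div_neg_of_neg_of_pos (by norm_num) hpos))
    rwa [e, ofReal_neg, ofReal_one, neg_one_mul] at this
  refine ⟨2 * 1 * (sqrtQ (G t) * leftNormal G t).re, hasOneSidedDeriv_of_region h1 hs h0 h5, ?_⟩
  convert hasOneSidedDeriv_of_region h2 hs h0 h6 using 1
  simp only [mul_neg, neg_re]; ring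

end IsContourExtension

/-! ### Existence of the trajectory and of the contour -/

/-- The contour, parametrized so that the trajectory lies over `[0, 1]`. -/
def contour (t : ℝ) : ℂ := pt (2 * t - 1)

theorem analyticAt_pt (x : ℝ) : AnalyticAt ℝ pt x := by
  have := analyticAt_graphPoint x
  unfold pt denrm
  fun_prop

theorem analyticAt_contour (t : ℝ) : AnalyticAt ℝ contour t :=
  (analyticAt_pt (2 * t - 1)).comp_of_eq (f := fun t : ℝ => 2 * t - 1) (by fun_prop) rfl

theorem hasDerivAt_contour (t : ℝ) :
    HasDerivAt contour (2 * √2 * (1 + deriv height (2 * t - 1) * I)) t := by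
  have h1 : HasDerivAt (fun t : ℝ => 2 * t - 1) 2 t := by
    simpa using ((hasDerivAt_id t).const_mul (2 : ℝ)).sub_const 1
  have h2 := ((hasDerivAt_denrm _).comp _ (hasDerivAt_graphPoint (2 * t - 1))).scomp t h1
  refine h2.congr_deriv ?_
  rw [real_smul]; push_cast; ring

theorem deriv_contour_ne (t : ℝ) : deriv contour t ≠ 0 := by
  rw [(hasDerivAt_contour t).deriv]
  refine mul_ne_zero (mul_ne_zero two_ne_zero sqrt_two_ne) fun h => ?_
  simpa using congrArg re h

theorem nrm_contour (t : ℝ) : nrm (contour t) = graphPoint (2 * t - 1) := nrm_pt _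

theorem contour_injective : Function.Injective contour := fun t u h => by
  have := congrArg (fun z => (nrm z).re) h
  simp only [nrm_contour, graphPoint_re] at this
  linarith

theorem contour_mem_arc {t : ℝ} : contour t ∈ arc ↔ t ∈ Icc (0 : ℝ) 1 := by
  rw [mem_arc, nrm_contour, graphPoint_re, graphPoint_im, abs_le, mem_Icc]
  constructor
  · rintro ⟨⟨h1, h2⟩, -⟩; constructor <;> linarith
  · rintro ⟨h1, h2⟩; exact ⟨⟨by linarith, by linarith⟩, rfl⟩

theorem isArcParam_contour : IsArcParam contour where
  analytic t _ := analyticAt_contour t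
  regular t _ := deriv_contour_ne t
  injOn := contour_injective.injOn
  source := nrm_injective (by rw [nrm_contour, nrm_z₁]; norm_num [graphPoint_neg_one])
  target := nrm_injective (by rw [nrm_contour, nrm_z₂]; norm_num [graphPoint_one])
  mem_arc _ ht := contour_mem_arc.2 ht

theorem tendsto_contour {f : Filter ℝ} (hf : Tendsto (fun x : ℝ => |x|) f atTop) :
    Tendsto contour f (cocompact ℂ) := by
  refine tendsto_denrm_cocompact.comp ?_
  rw [← Metric.cobounded_eq_cocompact, ← tendsto_norm_atTop_iff_cobounded]
  refine tendsto_atTop_mono (f := fun t => 2 * |t| - 1) (fun t => ?_) ?_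
  · have h1 := abs_re_le_norm (graphPoint (2 * t - 1))
    rw [graphPoint_re] at h1
    have h2 := abs_sub_abs_le_abs_sub (2 * t) 1
    rw [abs_mul, abs_two, abs_one] at h2
    linarith
  · exact tendsto_atTop_add_const_right _ _ (hf.const_mul_atTop two_pos)

theorem isAnalyticContour_contour : IsAnalyticContour contour where
  analytic t _ := analyticAt_contour t
  regular := deriv_contour_ne
  injective := contour_injective
  atTop := tendsto_contour tendsto_abs_atTop_atTop
  atBot := tendsto_contour tendsto_abs_atBot_atTop

theorem sqrtQ_mul_deriv_contour (t : ℝ) : sqrtQ (contour t) * deriv contour t =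
    ((2 : ℝ) : ℂ) * (phiDeriv (graphPoint (2 * t - 1)) * (1 + deriv height (2 * t - 1) * I)) := by
  rw [sqrtQ, nrm_contour, (hasDerivAt_contour t).deriv]
  have := sqrt_two_ne
  push_cast
  field_simp

theorem isCriticalTrajectory_contour : IsCriticalTrajectory Q z₁ z₂ contour where
  analytic t _ := analyticAt_contour t
  regular t _ := deriv_contour_ne t
  injOn := contour_injective.injOn
  source := isArcParam_contour.source
  target := isArcParam_contour.target
  zero_source := by rw [Q_eq, nrm_z₁]; ring
  zero_target := by rw [Q_eq, nrm_z₂]; ring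
  trajectory t ht := by
    have hx : |2 * t - 1| < 1 := abs_lt.2 ⟨by linarith [ht.1], by linarith [ht.2]⟩
    obtain ⟨h1, h2⟩ := phiDeriv_graphPoint_mid hx
    rw [← sqrtQ_sq, ← mul_pow, sqrtQ_mul_deriv_contour]
    set W := phiDeriv (graphPoint (2 * t - 1)) * (1 + deriv height (2 * t - 1) * I) with hW
    have h3 : W = W.im * I := by apply Complex.ext <;> simp [h1]
    have h4 : (((2 : ℝ) : ℂ) * W) ^ 2 = ((-(2 * W.im) ^ 2 : ℝ) : ℂ) := by
      rw [mul_pow]; nth_rw 1 [h3]; rw [mul_pow, I_sq]; push_cast; ring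
    rw [h4, ofReal_im, ofReal_re]
    refine ⟨rfl, ?_⟩
    have : 0 < (2 * W.im) ^ 2 := by positivity
    linarith

theorem branch_mul_deriv_contour {R : ℂ → ℂ} (hR : IsSqrtBranch arc R) {t : ℝ}
    (ht : t < 0 ∨ 1 < t) : R (contour t) * deriv contour t =
    ((2 : ℝ) : ℂ) * (phiDeriv (graphPoint (2 * t - 1)) * (1 + deriv height (2 * t - 1) * I)) := by
  have h1 : contour t ∉ arc := fun h => by
    rcases contour_mem_arc.1 h with ⟨h1, h2⟩
    rcases ht with h | h <;> linarith
  have h2 : 1 < |2 * t - 1| := by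
    rw [lt_abs]; rcases ht with h | h
    · right; linarith
    · left; linarith
  have h3 : nrm (contour t) ∈ upperRegion := by
    rw [mem_upperRegion, nrm_contour, graphPoint_im]
    exact Or.inl (height_out h2).1
  rw [hR.eq_branch h1, branch_eq_sqrtQ h3, sqrtQ_mul_deriv_contour]

theorem isContourExtension_contour {R : ℂ → ℂ} (hR : IsSqrtBranch arc R) :
    IsContourExtension arc R contour where
  contour := isAnalyticContour_contour
  middle := isArcParam_contour.image_eq
  start := isArcParam_contour.source
  finish := isArcParam_contour.target
  phi_one t ht := by
    have hi := intervalIntegrable_mul_deriv hR isAnalyticContour_contour.analytic ht.le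
      fun u hu h => (contour_mem_arc.1 h).1.not_gt hu.2
    rw [intervalIntegral.integral_symm, neg_im, neg_re]
    have h1 := imCLM.intervalIntegral_comp_comm hi
    have h2 := reCLM.intervalIntegral_comp_comm hi
    simp only [imCLM_apply, reCLM_apply] at h1 h2
    have key : ∀ u ∈ Ioo t 0, (R (contour u) * deriv contour u).im = 0 ∧
        (R (contour u) * deriv contour u).re < 0 := fun u hu => by
      rw [branch_mul_deriv_contour hR (Or.inl hu.2), re_ofReal_mul, im_ofReal_mul]
      obtain ⟨h3, h4⟩ := phiDeriv_graphPoint_lt (x := 2 * u - 1) (by linarith [hu.2])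
      exact ⟨by rw [h3, mul_zero], by linarith⟩
    rw [← h1, ← h2, ← intervalIntegral.integral_neg, ← intervalIntegral.integral_neg]
    constructor
    · rw [intervalIntegral.integral_of_le ht.le, integral_Ioc_eq_integral_Ioo]
      refine setIntegral_eq_zero_of_forall_eq_zero fun u hu => ?_
      simp [(key u hu).1]
    · refine intervalIntegral.intervalIntegral_pos_of_pos_on ?_
        (fun u hu => neg_pos.2 (key u hu).2) ht
      exact IntervalIntegrable.neg ⟨reCLM.integrable_comp hi.1, reCLM.integrable_comp hi.2⟩
  phi_two t ht := by
    have hi := intervalIntegrable_mul_deriv hR isAnalyticContour_contour.analytic ht.le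
      fun u hu h => (contour_mem_arc.1 h).2.not_gt hu.1
    have h1 := imCLM.intervalIntegral_comp_comm hi
    have h2 := reCLM.intervalIntegral_comp_comm hi
    simp only [imCLM_apply, reCLM_apply] at h1 h2
    have key : ∀ u ∈ Ioo 1 t, (R (contour u) * deriv contour u).im = 0 ∧
        0 < (R (contour u) * deriv contour u).re := fun u hu => by
      rw [branch_mul_deriv_contour hR (Or.inr hu.1), re_ofReal_mul, im_ofReal_mul]
      obtain ⟨h3, h4⟩ := phiDeriv_graphPoint_gt (x := 2 * u - 1) (by linarith [hu.1])
      exact ⟨by rw [h3, mul_zero], by linarith⟩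
    rw [← h1, ← h2]
    constructor
    · rw [intervalIntegral.integral_of_le ht.le, integral_Ioc_eq_integral_Ioo]
      refine setIntegral_eq_zero_of_forall_eq_zero fun u hu => ?_
      simp [(key u hu).1]
    · exact intervalIntegral.intervalIntegral_pos_of_pos_on
        ⟨reCLM.integrable_comp hi.1, reCLM.integrable_comp hi.2⟩ (fun u hu => (key u hu).2) ht

/-! ### A Gaussian representation of the logarithmic energy -/

theorem frullani_nonneg {a b t : ℝ} (hab : a ≤ b) (ht : 0 < t) :
    0 ≤ t⁻¹ * (Real.exp (-(a * t)) - Real.exp (-(b * t))) := by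
  have : Real.exp (-(b * t)) ≤ Real.exp (-(a * t)) := Real.exp_le_exp.2 (by nlinarith)
  exact mul_nonneg (by positivity) (by linarith)

theorem frullani_le {a b t : ℝ} (ht : 0 < t) :
    t⁻¹ * (Real.exp (-(a * t)) - Real.exp (-(b * t))) ≤ (b - a) * Real.exp (-(a * t)) := by
  have h1 : Real.exp (-(b * t)) = Real.exp (-(a * t)) * Real.exp (-((b - a) * t)) := by
    rw [← Real.exp_add]; congr 1; ring
  have h2 := Real.add_one_le_exp (-((b - a) * t))
  have h3 := Real.exp_pos (-(a * t))
  rw [h1, inv_mul_le_iff₀ ht]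
  nlinarith

theorem measurable_frullani (a b : ℝ) :
    Measurable fun t : ℝ => t⁻¹ * (Real.exp (-(a * t)) - Real.exp (-(b * t))) := by fun_prop

theorem integrableOn_frullani_of_le {a b : ℝ} (ha : 0 < a) (hab : a ≤ b) :
    IntegrableOn (fun t : ℝ => t⁻¹ * (Real.exp (-(a * t)) - Real.exp (-(b * t)))) (Ioi 0) := by
  have h1 : IntegrableOn (fun t : ℝ => (b - a) * Real.exp (-(a * t))) (Ioi 0) := by
    have := (integrableOn_exp_mul_Ioi (a := -a) (by linarith) 0).const_mul (b - a)
    simp only [neg_mul] at this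
    exact this
  refine h1.mono' (measurable_frullani a b).aestronglyMeasurable ?_
  refine (ae_restrict_iff' measurableSet_Ioi).2 (ae_of_all _ fun t ht => ?_)
  rw [Real.norm_of_nonneg (frullani_nonneg hab ht)]
  exact frullani_le ht

theorem integrableOn_frullani {a b : ℝ} (ha : 0 < a) (hb : 0 < b) :
    IntegrableOn (fun t : ℝ => t⁻¹ * (Real.exp (-(a * t)) - Real.exp (-(b * t)))) (Ioi 0) := by
  rcases le_total a b with h | h
  · exact integrableOn_frullani_of_le ha h
  · refine (integrableOn_frullani_of_le hb h).neg.congr_fun (fun t _ => ?_) measurableSet_Ioi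
    simp only [Pi.neg_apply]; ring

theorem integral_frullani {a b : ℝ} (ha : 0 < a) (hb : 0 < b) :
    ∫ t in Ioi (0 : ℝ), t⁻¹ * (Real.exp (-(a * t)) - Real.exp (-(b * t))) = Real.log (b / a) := by
  have hL : Tendsto (fun t : ℝ => Real.exp (-t)) (𝓝[>] 0) (𝓝 1) := by
    have : Continuous fun t : ℝ => Real.exp (-t) := by fun_prop
    have := (this.tendsto 0).mono_left (nhdsWithin_le_nhds (s := Ioi 0))
    simpa using this
  have h := Frullani.integral_Ioi_eq (f := fun t : ℝ => Real.exp (-t)) (E := ℝ)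
    ((by fun_prop : Continuous fun t : ℝ => Real.exp (-t)).locallyIntegrable.locallyIntegrableOn _)
    ha hb hL Real.tendsto_exp_neg_atTop_nhds_zero (by simpa using integrableOn_frullani ha hb)
  simpa using h

theorem integral_abs_frullani {a b : ℝ} (ha : 0 < a) (hb : 0 < b) :
    ∫ t in Ioi (0 : ℝ), |t⁻¹ * (Real.exp (-(a * t)) - Real.exp (-(b * t)))| =
      |Real.log (b / a)| := by
  rw [← integral_frullani ha hb]
  rcases le_total a b with h | h
  · rw [abs_of_nonneg (setIntegral_nonneg measurableSet_Ioi fun t ht => frullani_nonneg h ht)]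
    exact setIntegral_congr_fun measurableSet_Ioi fun t ht => abs_of_nonneg (frullani_nonneg h ht)
  · have key : ∀ t ∈ Ioi (0 : ℝ), t⁻¹ * (Real.exp (-(a * t)) - Real.exp (-(b * t))) ≤ 0 :=
      fun t ht => by
        have := frullani_nonneg h ht
        linarith
    rw [abs_of_nonpos (setIntegral_nonpos measurableSet_Ioi key), ← integral_neg]
    exact setIntegral_congr_fun measurableSet_Ioi fun t ht => abs_of_nonpos (key t ht)

section

variable {X : Type*} [MeasurableSpace X] {β : Measure X} [IsFiniteMeasure β] {r : X → ℝ}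

/-- For fixed r the Frullani integrand has constant sign in t, so its absolute integral is |log r²|;
Fubini's condition is exactly the integrability of log r. -/
theorem integrable_frullani_prod (hm : Measurable r) (hr : ∀ᵐ x ∂β, 0 < r x)
    (hlog : Integrable (fun x => Real.log (1 / r x)) β) :
    Integrable (fun q : ℝ × X => q.1⁻¹ * (Real.exp (-(r q.2 ^ 2 * q.1)) - Real.exp (-(1 * q.1))))
      ((volume.restrict (Ioi (0 : ℝ))).prod β) := by
  rw [integrable_prod_iff' (by fun_prop)]
  constructor
  · filter_upwards [hr] with x hx
    exact integrableOn_frullani (by positivity) one_pos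
  · refine (hlog.abs.const_mul 2).congr ?_
    filter_upwards [hr] with x hx
    simp only [Real.norm_eq_abs]
    rw [integral_abs_frullani (by positivity) one_pos, one_div, one_div, Real.log_inv, Real.log_inv,
      Real.log_pow, abs_neg, abs_neg, abs_mul]
    simp

theorem integral_frullani_inner (hm : Measurable r) (t : ℝ) (ht : 0 < t) :
    ∫ x, t⁻¹ * (Real.exp (-(r x ^ 2 * t)) - Real.exp (-(1 * t))) ∂β =
      t⁻¹ * ((∫ x, Real.exp (-(r x ^ 2 * t)) ∂β) - β.real univ * Real.exp (-t)) := by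
  rw [integral_const_mul, integral_sub _ (integrable_const _), integral_const, one_mul, smul_eq_mul]
  refine Integrable.of_bound (by fun_prop) 1 (ae_of_all _ fun x => ?_)
  rw [Real.norm_eq_abs, Real.abs_exp, Real.exp_le_one_iff]
  have : 0 ≤ r x ^ 2 * t := by positivity
  linarith

theorem integrableOn_frullani_integral (hm : Measurable r) (hr : ∀ᵐ x ∂β, 0 < r x)
    (hlog : Integrable (fun x => Real.log (1 / r x)) β) :
    IntegrableOn (fun t => t⁻¹ * ((∫ x, Real.exp (-(r x ^ 2 * t)) ∂β) -
      β.real univ * Real.exp (-t))) (Ioi 0) :=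
  IntegrableOn.congr_fun (integrable_frullani_prod hm hr hlog).integral_prod_left
    (fun t ht => integral_frullani_inner hm t ht) measurableSet_Ioi

theorem integral_frullani_integral (hm : Measurable r) (hr : ∀ᵐ x ∂β, 0 < r x)
    (hlog : Integrable (fun x => Real.log (1 / r x)) β) :
    ∫ t in Ioi (0 : ℝ), t⁻¹ * ((∫ x, Real.exp (-(r x ^ 2 * t)) ∂β) -
      β.real univ * Real.exp (-t)) = 2 * ∫ x, Real.log (1 / r x) ∂β := by
  rw [← setIntegral_congr_fun measurableSet_Ioi fun t ht =>
    integral_frullani_inner (β := β) hm t ht,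
    integral_integral_swap (integrable_frullani_prod hm hr hlog), ← integral_const_mul]
  refine integral_congr_ae ?_
  filter_upwards [hr] with x hx
  rw [integral_frullani (by positivity) one_pos, one_div, one_div, Real.log_inv, Real.log_inv,
    Real.log_pow]
  push_cast; ring

end

/-- The Gaussian interaction of two measures. -/
def gaussPair (α β : Measure ℂ) (t : ℝ) : ℝ :=
  ∫ p : ℂ × ℂ, Real.exp (-(‖p.1 - p.2‖ ^ 2 * t)) ∂(α.prod β)

section

variable {α β : Measure ℂ} [IsFiniteMeasure α] [IsFiniteMeasure β]

theorem gaussPair_comm (t : ℝ) : gaussPair α β t = gaussPair β α t := by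
  rw [gaussPair, gaussPair, ← integral_prod_swap]
  simp only [Prod.fst_swap, Prod.snd_swap, norm_sub_rev]

/-- A Gaussian is the Fourier transform of a Gaussian; the normalization 4πt is that of real
dimension two. -/
theorem exp_neg_sq_mul_eq (w : ℂ) {t : ℝ} (ht : 0 < t) :
    ((Real.exp (-(‖w‖ ^ 2 * t)) : ℝ) : ℂ) = ((4 * Real.pi * t : ℝ) : ℂ)⁻¹ *
      ∫ ξ : ℂ, Complex.exp (-((1 / (4 * t) : ℝ) : ℂ) * ‖ξ‖ ^ 2 + I * inner ℝ w ξ) := by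
  have hb : 0 < (((1 / (4 * t) : ℝ) : ℂ)).re := by rw [ofReal_re]; positivity
  have ht' : (t : ℂ) ≠ 0 := ofReal_ne_zero.2 ht.ne'
  have hpi : (Real.pi : ℂ) ≠ 0 := ofReal_ne_zero.2 Real.pi_ne_zero
  rw [GaussianFourier.integral_cexp_neg_mul_sq_norm_add hb I w, finrank_real_complex]
  have h1 : ((2 : ℕ) / 2 : ℂ) = 1 := by norm_num
  rw [h1, cpow_one, I_sq]
  push_cast
  field_simp

theorem charFun_mul_conj (ξ : ℂ) : charFun α ξ * (starRingEnd ℂ) (charFun β ξ) =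
    ∫ p : ℂ × ℂ, Complex.exp (I * inner ℝ (p.1 - p.2) ξ) ∂(α.prod β) := by
  rw [charFun_apply, charFun_apply, ← integral_conj, ← integral_prod_mul]
  refine integral_congr_ae (ae_of_all _ fun p => ?_)
  simp only
  rw [← exp_conj, ← Complex.exp_add, inner_sub_left]
  congr 1
  simp
  ring

theorem gaussPair_eq {t : ℝ} (ht : 0 < t) : ((gaussPair α β t : ℝ) : ℂ) =
    ((4 * Real.pi * t : ℝ) : ℂ)⁻¹ * ∫ ξ : ℂ, ((Real.exp (-(1 / (4 * t)) * ‖ξ‖ ^ 2) : ℝ) : ℂ) *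
      (charFun α ξ * (starRingEnd ℂ) (charFun β ξ)) := by
  rw [gaussPair, ← integral_complex_ofReal (μ := α.prod β)]
  have hcc : ∀ ξ, charFun α ξ * (starRingEnd ℂ) (charFun β ξ) =
      ∫ p : ℂ × ℂ, Complex.exp (I * inner ℝ (p.1 - p.2) ξ) ∂(α.prod β) := fun ξ =>
    charFun_mul_conj ξ
  simp_rw [exp_neg_sq_mul_eq _ ht, hcc]
  rw [integral_const_mul, integral_integral_swap]
  · congr 1
    refine integral_congr_ae (ae_of_all _ fun ξ => ?_)
    simp only
    rw [← integral_const_mul]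
    refine integral_congr_ae (ae_of_all _ fun p => ?_)
    simp only
    rw [ofReal_exp, ← Complex.exp_add]
    push_cast
    rfl
  · have hg : Integrable (fun q : (ℂ × ℂ) × ℂ => (1 : ℝ) * Real.exp (-(1 / (4 * t)) * ‖q.2‖ ^ 2))
        ((α.prod β).prod volume) := by
      have h1 : Integrable fun ξ : ℂ => Real.exp (-(1 / (4 * t)) * ‖ξ‖ ^ 2) := by
        have := GaussianFourier.integrable_cexp_neg_mul_sq_norm_add (V := ℂ)
          (b := ((1 / (4 * t) : ℝ) : ℂ)) (by rw [ofReal_re]; positivity) 0 0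
        refine this.norm.congr (ae_of_all _ fun ξ => ?_)
        simp only
        rw [norm_exp]
        congr 1
        rw [← ofReal_neg, ← ofReal_pow, zero_mul, add_zero, ← ofReal_mul, ofReal_re]
      exact (integrable_const (μ := α.prod β) (1 : ℝ)).mul_prod h1
    refine hg.mono' (by fun_prop) (ae_of_all _ fun q => ?_)
    simp only [Function.uncurry]
    rw [norm_exp, one_mul]
    apply le_of_eq
    congr 1
    rw [add_re, I_mul_re, ofReal_im, neg_zero, add_zero, ← ofReal_neg, ← ofReal_pow, ← ofReal_mul,
      ofReal_re]

theorem integrable_gauss_mul {f : ℂ → ℂ} (hf : StronglyMeasurable f) {C : ℝ} (hC : ∀ ξ, ‖f ξ‖ ≤ C)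
    {t : ℝ} (ht : 0 < t) :
    Integrable fun ξ : ℂ => ((Real.exp (-(1 / (4 * t)) * ‖ξ‖ ^ 2) : ℝ) : ℂ) * f ξ := by
  have := GaussianFourier.integrable_cexp_neg_mul_sq_norm_add (V := ℂ)
    (b := ((1 / (4 * t) : ℝ) : ℂ)) (by rw [ofReal_re]; positivity) 0 0
  refine (this.mul_bdd hf.aestronglyMeasurable (ae_of_all _ hC)).congr (ae_of_all _ fun ξ => ?_)
  simp only
  rw [ofReal_exp]
  push_cast
  simp

/-- The Gaussian energy of the signed measure `α - α(ℂ) β`. -/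
def gaussEnergy (α β : Measure ℂ) (t : ℝ) : ℝ :=
  gaussPair α α t - 2 * α.real univ * gaussPair α β t + α.real univ ^ 2 * gaussPair β β t

theorem integral_linear_combination {X : Type*} [MeasurableSpace X] {μ : Measure X}
    {𝕜 : Type*} [RCLike 𝕜] {f₁ f₂ f₃ f₄ : X → 𝕜} (h₁ : Integrable f₁ μ) (h₂ : Integrable f₂ μ) (h₃ : Integrable f₃ μ)
    (h₄ : Integrable f₄ μ) (a b : 𝕜) :
    ∫ x, (f₁ x - a * f₂ x - a * f₃ x + b * f₄ x) ∂μ =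
      (∫ x, f₁ x ∂μ) - a * (∫ x, f₂ x ∂μ) - a * (∫ x, f₃ x ∂μ) + b * ∫ x, f₄ x ∂μ := by
  rw [integral_add (f := fun x => f₁ x - a * f₂ x - a * f₃ x)
    ((h₁.sub (h₂.const_mul a)).sub (h₃.const_mul a)) (h₄.const_mul b),
    integral_sub (f := fun x => f₁ x - a * f₂ x) (h₁.sub (h₂.const_mul a)) (h₃.const_mul a),
    integral_sub h₁ (h₂.const_mul a), integral_const_mul, integral_const_mul, integral_const_mul]

/-- With a = α(ℂ), inserting the Fourier representation in the four pairings completes the square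
|α̂ - aβ̂|². This exhibits the sign of the energy and the case of equality. -/
theorem gaussEnergy_eq {t : ℝ} (ht : 0 < t) : gaussEnergy α β t = (4 * Real.pi * t)⁻¹ *
    ∫ ξ : ℂ, Real.exp (-(1 / (4 * t)) * ‖ξ‖ ^ 2) *
      ‖charFun α ξ - α.real univ * charFun β ξ‖ ^ 2 := by
  set a := α.real univ with ha
  have hi : ∀ α β : Measure ℂ, IsFiniteMeasure α → IsFiniteMeasure β →
      Integrable fun ξ : ℂ => ((Real.exp (-(1 / (4 * t)) * ‖ξ‖ ^ 2) : ℝ) : ℂ) *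
        (charFun α ξ * (starRingEnd ℂ) (charFun β ξ)) := fun α β _ _ => by
    refine integrable_gauss_mul (C := α.real univ * β.real univ) ?_ (fun ξ => ?_) ht
    · exact stronglyMeasurable_charFun.mul
        (continuous_conj.comp_stronglyMeasurable stronglyMeasurable_charFun)
    · rw [norm_mul, RCLike.norm_conj]
      exact mul_le_mul (norm_charFun_le ξ) (norm_charFun_le ξ) (norm_nonneg _) (by positivity)
  have e : ((gaussEnergy α β t : ℝ) : ℂ) = gaussPair α α t - a * gaussPair α β t
      - a * gaussPair β α t + a ^ 2 * gaussPair β β t := by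
    rw [gaussEnergy, gaussPair_comm (α := β) (β := α)]; push_cast; ring
  rw [← ofReal_inj, e, gaussPair_eq ht, gaussPair_eq ht, gaussPair_eq ht, gaussPair_eq ht]
  have h1 := hi α α inferInstance inferInstance
  have h2 := hi α β inferInstance inferInstance
  have h3 := hi β α inferInstance inferInstance
  have h4 := hi β β inferInstance inferInstance
  rw [ofReal_mul (4 * Real.pi * t)⁻¹, ← integral_complex_ofReal, ofReal_inv]
  have key : ∫ ξ : ℂ, ((Real.exp (-(1 / (4 * t)) * ‖ξ‖ ^ 2) *
      ‖charFun α ξ - a * charFun β ξ‖ ^ 2 : ℝ) : ℂ) =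
      (∫ ξ : ℂ, ((Real.exp (-(1 / (4 * t)) * ‖ξ‖ ^ 2) : ℝ) : ℂ) *
        (charFun α ξ * (starRingEnd ℂ) (charFun α ξ)))
      - a * (∫ ξ : ℂ, ((Real.exp (-(1 / (4 * t)) * ‖ξ‖ ^ 2) : ℝ) : ℂ) *
        (charFun α ξ * (starRingEnd ℂ) (charFun β ξ)))
      - a * (∫ ξ : ℂ, ((Real.exp (-(1 / (4 * t)) * ‖ξ‖ ^ 2) : ℝ) : ℂ) *
        (charFun β ξ * (starRingEnd ℂ) (charFun α ξ)))
      + a ^ 2 * (∫ ξ : ℂ, ((Real.exp (-(1 / (4 * t)) * ‖ξ‖ ^ 2) : ℝ) : ℂ) *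
        (charFun β ξ * (starRingEnd ℂ) (charFun β ξ))) := by
    rw [← integral_linear_combination h1 h2 h3 h4]
    refine integral_congr_ae (ae_of_all _ fun ξ => ?_)
    simp only
    rw [ofReal_mul, ofReal_pow, ← mul_conj', map_sub, map_mul, conj_ofReal]
    ring
  rw [key]
  ring

theorem gaussEnergy_nonneg {t : ℝ} (ht : 0 < t) : 0 ≤ gaussEnergy α β t := by
  rw [gaussEnergy_eq ht]
  exact mul_nonneg (by positivity) (integral_nonneg fun ξ => by positivity)

theorem continuous_charFun_measure : Continuous (charFun α) := by
  refine continuous_of_dominated (bound := fun _ => (1 : ℝ)) (fun ξ => by fun_prop) (fun ξ => ?_)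
    (integrable_const _) (ae_of_all _ fun x => by fun_prop)
  refine ae_of_all _ fun x => ?_
  rw [norm_exp_ofReal_mul_I]

/-- A continuous nonnegative integrand with zero integral vanishes identically; the Gaussian weight
is positive, so the characteristic functions agree. -/
theorem eq_of_gaussEnergy_eq_zero [IsProbabilityMeasure α] {t : ℝ} (ht : 0 < t)
    (h : gaussEnergy α β t = 0) : α = β := by
  have hα : Continuous (charFun α) := continuous_charFun_measure
  have hβ : Continuous (charFun β) := continuous_charFun_measure
  have hint : Integrable fun ξ : ℂ => Real.exp (-(1 / (4 * t)) * ‖ξ‖ ^ 2) *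
      ‖charFun α ξ - α.real univ * charFun β ξ‖ ^ 2 := by
    have h1 := (integrable_gauss_mul (f := fun ξ => ((‖charFun α ξ - α.real univ *
      charFun β ξ‖ ^ 2 : ℝ) : ℂ)) (C := (1 + β.real univ) ^ 2) (by fun_prop) ?_ ht).norm
    · refine h1.congr (ae_of_all _ fun ξ => ?_)
      simp only
      rw [norm_mul, norm_real, norm_real, Real.norm_of_nonneg (by positivity),
        Real.norm_of_nonneg (by positivity)]
    · intro ξ
      rw [norm_real, Real.norm_of_nonneg (by positivity)]
      refine pow_le_pow_left₀ (norm_nonneg _) ((norm_sub_le _ _).trans ?_) 2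
      rw [norm_mul, probReal_univ, ofReal_one, norm_one, one_mul]
      exact add_le_add (norm_charFun_le_one ξ) (norm_charFun_le ξ)
  rw [gaussEnergy_eq ht, mul_eq_zero] at h
  have h1 := h.resolve_left (inv_ne_zero (by positivity))
  rw [integral_eq_zero_iff_of_nonneg (fun ξ => by positivity) hint] at h1
  have h2 := Continuous.ae_eq_iff_eq volume (by fun_prop) (by fun_prop) |>.1 h1
  refine Measure.ext_of_charFun (funext fun ξ => ?_)
  have h3 := congrFun h2 ξ
  simp only [Pi.zero_apply, mul_eq_zero, Real.exp_ne_zero, false_or, probReal_univ, ofReal_one,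
    one_mul] at h3
  exact sub_eq_zero.1 (norm_eq_zero.1 (pow_eq_zero_iff two_ne_zero |>.1 h3))

end

/-! ### Positivity of the reduced energy -/

instance nullSingletonClass_mu : NullSingletonClass mu := ⟨fun z => by
  rw [mu, Measure.map_apply continuous_pt.measurable (measurableSet_singleton z)]
  refine withDensity_absolutelyContinuous _ _ (Measure.restrict_le_self.absolutelyContinuous ?_)
  refine Set.Subsingleton.measure_zero (fun x hx y hy => ?_) _
  have h1 := congrArg (fun z => (nrm z).re) ((mem_preimage.1 hx).trans (mem_preimage.1 hy).symm)
  simpa only [nrm_pt, graphPoint_re] using h1⟩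

/-- The logarithmic kernel. -/
def logK (p : ℂ × ℂ) : ℝ := Real.log (1 / ‖p.1 - p.2‖)

theorem measurable_logK : Measurable logK := by unfold logK; fun_prop

theorem ae_prod_mu_ne (α : Measure ℂ) [SFinite α] : ∀ᵐ p ∂(α.prod mu), p.1 ≠ p.2 := by
  have hm : MeasurableSet {p : ℂ × ℂ | p.1 = p.2} := measurableSet_eq_fun measurable_fst measurable_snd
  refine (Measure.measure_prod_null ?_).2 (ae_of_all _ fun z => ?_)
  · exact hm.compl.compl
  · have : Prod.mk z ⁻¹' {p : ℂ × ℂ | p.1 ≠ p.2}ᶜ = {z} := by ext w; simp [eq_comm]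
    rw [Pi.zero_apply]
    exact (congrArg mu this).trans (measure_singleton z)

section

variable {α : Measure ℂ} [IsFiniteMeasure α] {A : Set ℂ}

theorem integrable_of_ae_mem_compact (hA : IsCompact A) (hα : ∀ᵐ z ∂α, z ∈ A) {f : ℂ → ℝ}
    (hf : Continuous f) : Integrable f α := by
  obtain ⟨M, hM⟩ := hA.exists_bound_of_continuousOn hf.continuousOn
  exact Integrable.of_bound hf.aestronglyMeasurable M (hα.mono hM)

theorem integrable_logK_prod_mu (hA : IsCompact A) (hα : ∀ᵐ z ∂α, z ∈ A) :
    Integrable logK (α.prod mu) := by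
  rw [integrable_prod_iff measurable_logK.aestronglyMeasurable]
  exact ⟨ae_of_all _ integrable_log_mu,
    integrable_of_ae_mem_compact hA hα continuous_integral_abs_log_mu⟩

theorem integral_logK_prod_mu (hA : IsCompact A) (hα : ∀ᵐ z ∂α, z ∈ A) :
    ∫ p, logK p ∂(α.prod mu) = ∫ z, logPotential mu z ∂α :=
  integral_prod _ (integrable_logK_prod_mu hA hα)

/-- The logarithmic energy of the measure. -/
def muEnergy : ℝ := ∫ z, logPotential mu z ∂mu

/-- The logarithmic kernel reduced by the potentials of the measure. -/
def reducedK (p : ℂ × ℂ) : ℝ := logK p - logPotential mu p.1 - logPotential mu p.2 + muEnergy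

theorem integrable_reducedK (hA : IsCompact A) (hα : ∀ᵐ z ∂α, z ∈ A)
    (h : Integrable logK (α.prod α)) : Integrable reducedK (α.prod α) := by
  have hU := integrable_of_ae_mem_compact hA hα continuous_logPotential_mu
  exact ((h.sub (hU.comp_fst α)).sub (hU.comp_snd α)).add (integrable_const _)

/-- The right-hand side is the logarithmic energy of the signed measure α - α(ℂ) μ, of total mass
zero. -/
theorem integral_reducedK (hA : IsCompact A) (hα : ∀ᵐ z ∂α, z ∈ A)
    (h : Integrable logK (α.prod α)) : ∫ p, reducedK p ∂(α.prod α) =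
      (∫ p, logK p ∂(α.prod α)) - 2 * α.real univ * (∫ z, logPotential mu z ∂α) +
        α.real univ ^ 2 * muEnergy := by
  have hU := integrable_of_ae_mem_compact hA hα continuous_logPotential_mu
  have h1 : ∫ p : ℂ × ℂ, logPotential mu p.1 ∂(α.prod α) =
      α.real univ * ∫ z, logPotential mu z ∂α := by
    rw [integral_fun_fst, smul_eq_mul]
  have h2 : ∫ p : ℂ × ℂ, logPotential mu p.2 ∂(α.prod α) =
      α.real univ * ∫ z, logPotential mu z ∂α := by
    rw [integral_fun_snd, smul_eq_mul]
  have h3 : (α.prod α).real univ = α.real univ ^ 2 := by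
    rw [← univ_prod_univ, measureReal_prod_prod, sq]
  unfold reducedK
  rw [integral_add (f := fun p => logK p - logPotential mu p.1 - logPotential mu p.2)
    ((h.sub (hU.comp_fst α)).sub (hU.comp_snd α)) (integrable_const _),
    integral_sub (f := fun p => logK p - logPotential mu p.1)
    (h.sub (hU.comp_fst α)) (hU.comp_snd α), integral_sub h (hU.comp_fst α), h1, h2,
    integral_const, h3, smul_eq_mul]
  ring

theorem frullani_gaussPair {α β : Measure ℂ} [IsFiniteMeasure α] [IsFiniteMeasure β]
    (hne : ∀ᵐ p ∂(α.prod β), p.1 ≠ p.2) (h : Integrable logK (α.prod β)) :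
    IntegrableOn (fun t => t⁻¹ * (gaussPair α β t - α.real univ * β.real univ * Real.exp (-t)))
      (Ioi 0) ∧
    ∫ t in Ioi (0 : ℝ), t⁻¹ * (gaussPair α β t - α.real univ * β.real univ * Real.exp (-t)) =
      2 * ∫ p, logK p ∂(α.prod β) := by
  have hm : Measurable fun p : ℂ × ℂ => ‖p.1 - p.2‖ := by fun_prop
  have hr : ∀ᵐ p ∂(α.prod β), 0 < ‖p.1 - p.2‖ :=
    hne.mono fun p hp => norm_pos_iff.2 (sub_ne_zero.2 hp)
  have h3 : (α.prod β).real univ = α.real univ * β.real univ := by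
    rw [← univ_prod_univ, measureReal_prod_prod]
  have h1 := integrableOn_frullani_integral hm hr h
  have h2 := integral_frullani_integral hm hr h
  rw [h3] at h1 h2
  exact ⟨h1, h2⟩

/-- The terms e^{-t} of the Frullani integrals have total coefficient a² - 2a² + a² = 0 with a =
α(ℂ), so only the Gaussian energy is left. -/
theorem frullani_gaussEnergy (hA : IsCompact A) (hα : ∀ᵐ z ∂α, z ∈ A)
    (hne : ∀ᵐ p ∂(α.prod α), p.1 ≠ p.2) (h : Integrable logK (α.prod α)) :
    IntegrableOn (fun t => t⁻¹ * gaussEnergy α mu t) (Ioi 0) ∧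
    ∫ t in Ioi (0 : ℝ), t⁻¹ * gaussEnergy α mu t = 2 * ∫ p, reducedK p ∂(α.prod α) := by
  obtain ⟨h1, h1'⟩ := frullani_gaussPair hne h
  obtain ⟨h2, h2'⟩ := frullani_gaussPair (ae_prod_mu_ne α) (integrable_logK_prod_mu hA hα)
  obtain ⟨h3, h3'⟩ := frullani_gaussPair (ae_prod_mu_ne mu)
    (integrable_logK_prod_mu isCompact_arc ae_mem_arc)
  rw [integral_logK_prod_mu hA hα] at h2'
  rw [integral_logK_prod_mu isCompact_arc ae_mem_arc] at h3'
  have e : ∀ t : ℝ, t⁻¹ * gaussEnergy α mu t =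
      t⁻¹ * (gaussPair α α t - α.real univ * α.real univ * Real.exp (-t)) -
      α.real univ * (t⁻¹ * (gaussPair α mu t - α.real univ * mu.real univ * Real.exp (-t))) -
      α.real univ * (t⁻¹ * (gaussPair α mu t - α.real univ * mu.real univ * Real.exp (-t))) +
      α.real univ ^ 2 * (t⁻¹ * (gaussPair mu mu t - mu.real univ * mu.real univ * Real.exp (-t))) :=
    fun t => by
      rw [gaussEnergy, probReal_univ (μ := mu)]; ring
  simp_rw [e]
  refine ⟨((h1.sub (h2.const_mul _)).sub (h2.const_mul _)).add (h3.const_mul _), ?_⟩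
  rw [integral_linear_combination h1 h2 h2 h3, h1', h2', h3', integral_reducedK hA hα h, muEnergy]
  ring

end

theorem measurable_gaussPair (α β : Measure ℂ) [SFinite α] [SFinite β] :
    Measurable (gaussPair α β) := by
  have h : StronglyMeasurable fun q : ℝ × (ℂ × ℂ) =>
      Real.exp (-(‖q.2.1 - q.2.2‖ ^ 2 * q.1)) := Measurable.stronglyMeasurable (by fun_prop)
  exact (h.integral_prod_right' (ν := α.prod β)).measurable

theorem measurable_gaussEnergy (α β : Measure ℂ) [SFinite α] [SFinite β] :
    Measurable (gaussEnergy α β) := by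
  have h1 := measurable_gaussPair α α
  have h2 := measurable_gaussPair α β
  have h3 := measurable_gaussPair β β
  unfold gaussEnergy
  fun_prop

/-! ### Truncation and measures without compact support -/

section

variable {ν : Measure ℂ} [IsProbabilityMeasure ν]

/-- The restriction of a measure to the disk of radius `n`. -/
def truncation (ν : Measure ℂ) (n : ℕ) : Measure ℂ := ν.restrict (Metric.closedBall 0 n)

instance (n : ℕ) : IsFiniteMeasure (truncation ν n) := by unfold truncation; infer_instance

theorem monotone_closedBall : Monotone fun n : ℕ => Metric.closedBall (0 : ℂ) n := fun _ _ h =>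
  Metric.closedBall_subset_closedBall (by exact_mod_cast h)

theorem iUnion_closedBall : ⋃ n : ℕ, Metric.closedBall (0 : ℂ) n = univ :=
  Metric.iUnion_closedBall_nat 0

theorem iUnion_closedBall_prod :
    ⋃ n : ℕ, Metric.closedBall (0 : ℂ) n ×ˢ Metric.closedBall (0 : ℂ) n = univ := by
  rw [iUnion_prod_of_monotone monotone_closedBall monotone_closedBall, iUnion_closedBall,
    univ_prod_univ]

theorem truncation_prod_truncation (n : ℕ) : (truncation ν n).prod (truncation ν n) =
    (ν.prod ν).restrict (Metric.closedBall 0 n ×ˢ Metric.closedBall 0 n) :=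
  Measure.prod_restrict _ _

theorem truncation_prod (n : ℕ) (β : Measure ℂ) [SFinite β] : (truncation ν n).prod β =
    (ν.prod β).restrict (Metric.closedBall 0 n ×ˢ univ) := by
  rw [← Measure.prod_restrict, Measure.restrict_univ]; rfl

theorem tendsto_integral_truncation_prod {f : ℂ × ℂ → ℝ} (hf : Integrable f (ν.prod ν)) :
    Tendsto (fun n => ∫ p, f p ∂((truncation ν n).prod (truncation ν n))) atTop
      (𝓝 (∫ p, f p ∂(ν.prod ν))) := by
  simp_rw [truncation_prod_truncation]
  have := tendsto_setIntegral_of_monotone (μ := ν.prod ν) (f := f)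
    (s := fun n : ℕ => Metric.closedBall (0 : ℂ) n ×ˢ Metric.closedBall (0 : ℂ) n)
    (fun n => measurableSet_closedBall.prod measurableSet_closedBall)
    (fun m n h => prod_mono (monotone_closedBall h) (monotone_closedBall h)) hf.integrableOn
  rwa [iUnion_closedBall_prod, setIntegral_univ] at this

theorem integrable_gauss (α : Measure (ℂ × ℂ)) [IsFiniteMeasure α] {t : ℝ} (ht : 0 < t) :
    Integrable (fun p : ℂ × ℂ => Real.exp (-(‖p.1 - p.2‖ ^ 2 * t))) α := by
  refine Integrable.of_bound (by fun_prop) 1 (ae_of_all _ fun p => ?_)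
  rw [Real.norm_eq_abs, Real.abs_exp, Real.exp_le_one_iff]
  have : 0 ≤ ‖p.1 - p.2‖ ^ 2 * t := by positivity
  linarith

theorem tendsto_gaussEnergy_truncation (β : Measure ℂ) [IsFiniteMeasure β] {t : ℝ} (ht : 0 < t) :
    Tendsto (fun n => gaussEnergy (truncation ν n) β t) atTop (𝓝 (gaussEnergy ν β t)) := by
  have h1 : Tendsto (fun n => gaussPair (truncation ν n) (truncation ν n) t) atTop
      (𝓝 (gaussPair ν ν t)) := tendsto_integral_truncation_prod (integrable_gauss _ ht)
  have h2 : Tendsto (fun n => gaussPair (truncation ν n) β t) atTop (𝓝 (gaussPair ν β t)) := by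
    unfold gaussPair
    simp_rw [truncation_prod]
    have := tendsto_setIntegral_of_monotone (μ := ν.prod β)
      (f := fun p : ℂ × ℂ => Real.exp (-(‖p.1 - p.2‖ ^ 2 * t)))
      (s := fun n : ℕ => Metric.closedBall (0 : ℂ) n ×ˢ (univ : Set ℂ))
      (fun n => measurableSet_closedBall.prod MeasurableSet.univ)
      (fun m n h => prod_mono (monotone_closedBall h) le_rfl)
      (integrable_gauss _ ht).integrableOn
    rwa [← iUnion_prod_const, iUnion_closedBall, univ_prod_univ, setIntegral_univ] at this
  have h3 : Tendsto (fun n => (truncation ν n).real univ) atTop (𝓝 (ν.real univ)) := by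
    have h4 := tendsto_measure_iUnion_atTop (μ := ν) monotone_closedBall
    rw [iUnion_closedBall] at h4
    have h5 := (ENNReal.tendsto_toReal (measure_ne_top ν univ)).comp h4
    refine h5.congr fun n => ?_
    simp [truncation, Measure.real]
  exact (h1.sub ((h3.const_mul 2).mul h2)).add ((h3.pow 2).mul_const _)

/-- For unbounded support `logK` and the potentials need not be integrable separately, so the
Frullani formula is applied to truncations, where they are. Fatou's lemma bounds the Gaussian
energies of ν - μ by the limit. If the latter is not positive, some Gaussian energy at t > 0
vanishes and ν = μ. -/
theorem integral_reducedK_pos (hne : ∀ᵐ p ∂(ν.prod ν), p.1 ≠ p.2)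
    (hint : Integrable reducedK (ν.prod ν)) (h : ν ≠ mu) : 0 < ∫ p, reducedK p ∂(ν.prod ν) := by
  by_contra! hle
  refine h ?_
  have hA : ∀ n : ℕ, IsCompact (Metric.closedBall (0 : ℂ) n) := fun n => isCompact_closedBall 0 n
  have hα : ∀ n : ℕ, ∀ᵐ z ∂(truncation ν n), z ∈ Metric.closedBall (0 : ℂ) n := fun n =>
    ae_restrict_mem measurableSet_closedBall
  have hle' : ∀ n, (truncation ν n).prod (truncation ν n) ≤ ν.prod ν := fun n => by
    rw [truncation_prod_truncation]; exact Measure.restrict_le_self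
  have hlog : ∀ n, Integrable logK ((truncation ν n).prod (truncation ν n)) := fun n => by
    have hU := integrable_of_ae_mem_compact (hA n) (hα n) continuous_logPotential_mu
    have h1 := (((hint.mono_measure (hle' n)).add (hU.comp_fst (truncation ν n))).add
      (hU.comp_snd (truncation ν n))).sub (integrable_const muEnergy)
    refine h1.congr (ae_of_all _ fun p => ?_)
    simp only [Pi.add_apply, Pi.sub_apply, reducedK]
    ring
  have hF := fun n => frullani_gaussEnergy (hA n) (hα n)
    (ae_mono (hle' n) hne) (hlog n)
  have hlim : ∀ᵐ t ∂(volume.restrict (Ioi (0 : ℝ))),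
      liminf (fun n => ENNReal.ofReal (t⁻¹ * gaussEnergy (truncation ν n) mu t)) atTop =
        ENNReal.ofReal (t⁻¹ * gaussEnergy ν mu t) :=
    (ae_restrict_iff' measurableSet_Ioi).2 (ae_of_all _ fun t ht =>
      (ENNReal.tendsto_ofReal ((tendsto_gaussEnergy_truncation mu ht).const_mul t⁻¹)).liminf_eq)
  have hval : ∀ n, ∫⁻ t in Ioi (0 : ℝ), ENNReal.ofReal (t⁻¹ * gaussEnergy (truncation ν n) mu t) =
      ENNReal.ofReal (2 * ∫ p, reducedK p ∂((truncation ν n).prod (truncation ν n))) := fun n => by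
    rw [← (hF n).2]
    refine (ofReal_integral_eq_lintegral_ofReal (hF n).1 ?_).symm
    exact (ae_restrict_iff' measurableSet_Ioi).2 (ae_of_all _ fun t ht =>
      mul_nonneg (inv_nonneg.2 (le_of_lt ht)) (gaussEnergy_nonneg ht))
  have hfatou := lintegral_liminf_le (μ := volume.restrict (Ioi (0 : ℝ)))
    (f := fun n t => ENNReal.ofReal (t⁻¹ * gaussEnergy (truncation ν n) mu t)) (u := atTop)
    fun n => ENNReal.measurable_ofReal.comp
      (measurable_inv.mul (measurable_gaussEnergy (truncation ν n) mu))
  simp_rw [hval] at hfatou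
  rw [lintegral_congr_ae hlim, (ENNReal.tendsto_ofReal
    ((tendsto_integral_truncation_prod hint).const_mul 2)).liminf_eq,
    ENNReal.ofReal_of_nonpos (by linarith), nonpos_iff_eq_zero,
    lintegral_eq_zero_iff (by have := measurable_gaussEnergy ν mu; fun_prop)] at hfatou
  have hbot : (ae (volume.restrict (Ioi (0 : ℝ)))).NeBot :=
    ae_neBot.2 (by rw [Ne, Measure.restrict_eq_zero]; simp)
  obtain ⟨t, h1, ht⟩ := (hfatou.and (ae_restrict_mem measurableSet_Ioi)).exists
  rw [Pi.zero_apply, ENNReal.ofReal_eq_zero] at h1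
  have ht' : 0 < t := ht
  have h2 := gaussEnergy_nonneg (α := ν) (β := mu) ht'
  exact eq_of_gaussEnergy_eq_zero ht' (le_antisymm (by
    rw [inv_mul_le_iff₀ ht', mul_zero] at h1; exact h1) h2)

end

/-! ### The equilibrium problem -/

/-- The weighted kernel, off the diagonal. -/
def weightedK (p : ℂ × ℂ) : ℝ := logK p + (field p.1 + field p.2) / 2

theorem continuous_field : Continuous field := by unfold field V; fun_prop

theorem measurable_weightedK : Measurable weightedK := by
  have h1 := measurable_logK
  have h2 := continuous_field.measurable
  unfold weightedK
  fun_prop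

theorem weightedK_eq (p : ℂ × ℂ) : weightedK p =
    reducedK p + (totalPotential field mu p.1 + totalPotential field mu p.2) / 2 - muEnergy := by
  simp only [weightedK, reducedK, totalPotential]; ring

theorem energyKernel_of_ne (h : ℂ → ℝ) {z s : ℂ} (hzs : z ≠ s) :
    energyKernel h z s = ((Real.log (1 / ‖z - s‖) + (h z + h s) / 2 : ℝ) : EReal) := by
  have h1 : 0 < ‖z - s‖ := norm_pos_iff.2 (sub_ne_zero.2 hzs)
  rw [energyKernel, edist_dist, dist_eq, ENNReal.log_ofReal_of_pos h1, one_div, Real.log_inv,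
    EReal.coe_add, EReal.coe_neg]

theorem energyKernel_self (h : ℂ → ℝ) (z : ℂ) : energyKernel h z z = ⊤ := by
  rw [energyKernel, edist_self, ENNReal.log_zero, EReal.neg_bot, EReal.top_add_coe]

/-- Far from the arc ‖z - s‖ ≥ (1 + ‖z‖)/4; on the remaining disk continuity suffices. -/
theorem exists_logPotential_le : ∃ C, ∀ z, logPotential mu z ≤ C - Real.log (1 + ‖z‖) := by
  obtain ⟨M, hM, hM'⟩ := exists_norm_arc_le
  have hc : Continuous fun z : ℂ => logPotential mu z + Real.log (1 + ‖z‖) := by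
    have := continuous_logPotential_mu
    exact this.add (Continuous.log (by fun_prop) fun z => by positivity)
  obtain ⟨C, hC⟩ := (isCompact_closedBall (0 : ℂ) (2 * M + 1)).exists_bound_of_continuousOn
    hc.continuousOn
  refine ⟨max C (Real.log 4), fun z => ?_⟩
  rcases le_or_gt ‖z‖ (2 * M + 1) with h | h
  · have h1 := (le_abs_self _).trans (hC z (by simpa using h))
    linarith [le_max_left C (Real.log 4)]
  · have h1 : logPotential mu z ≤ Real.log 4 - Real.log (1 + ‖z‖) := by
      have h2 : ∫ _, (Real.log 4 - Real.log (1 + ‖z‖)) ∂mu = Real.log 4 - Real.log (1 + ‖z‖) := by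
        simp
      rw [← h2]
      refine integral_mono_ae (integrable_log_mu z) (integrable_const _) ?_
      filter_upwards [ae_mem_arc] with s hs
      have h3 : (1 + ‖z‖) / 4 ≤ ‖z - s‖ := by linarith [norm_sub_norm_le z s, hM' s hs]
      have h4 := Real.log_le_log (by positivity) h3
      rw [Real.log_div (by positivity) (by norm_num)] at h4
      rw [one_div, Real.log_inv]
      linarith
    linarith [le_max_right C (Real.log 4)]

/-- ‖z - s‖ ≤ (1 + ‖z‖)(1 + ‖s‖), and the logarithmic growth of the two subtracted potentials
compensates the negative part of the kernel. -/
theorem exists_le_reducedK : ∃ C, ∀ p, C ≤ reducedK p := by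
  obtain ⟨C, hC⟩ := exists_logPotential_le
  refine ⟨-2 * C + muEnergy, fun p => ?_⟩
  have h1 : -(Real.log (1 + ‖p.1‖) + Real.log (1 + ‖p.2‖)) ≤ logK p := by
    have h2 := Real.log_nonneg (le_add_of_nonneg_right (a := (1 : ℝ)) (norm_nonneg p.1))
    have h3 := Real.log_nonneg (le_add_of_nonneg_right (a := (1 : ℝ)) (norm_nonneg p.2))
    rw [logK, one_div, Real.log_inv]
    -- On the diagonal `logK` takes the value 0, because `1 / 0 = 0` and `Real.log 0 = 0`.
    rcases (norm_nonneg (p.1 - p.2)).eq_or_lt with h | h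
    · rw [← h, Real.log_zero]; linarith
    · rw [← Real.log_mul (by positivity) (by positivity)]
      refine neg_le_neg (Real.log_le_log h ?_)
      nlinarith [norm_sub_le p.1 p.2, norm_nonneg p.1, norm_nonneg p.2]
  rw [reducedK]
  linarith [hC p.1, hC p.2]

theorem measurable_energyKernel : Measurable fun p : ℂ × ℂ => energyKernel field p.1 p.2 := by
  have hd : MeasurableSet {p : ℂ × ℂ | p.1 = p.2} :=
    measurableSet_eq_fun measurable_fst measurable_snd
  classical
  have e : (fun p : ℂ × ℂ => energyKernel field p.1 p.2) =
      fun p => if p.1 = p.2 then ⊤ else ((weightedK p : ℝ) : EReal) := by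
    funext p
    split_ifs with h
    · rw [h, energyKernel_self]
    · rw [energyKernel_of_ne _ h]; rfl
  rw [e]
  exact Measurable.ite hd measurable_const (measurable_coe_real_ereal.comp measurable_weightedK)

theorem weightedEnergy_eq {ν : Measure ℂ} (hne : ∀ᵐ p ∂(ν.prod ν), p.1 ≠ p.2)
    (h : Integrable weightedK (ν.prod ν)) :
    weightedEnergy field ν = ((∫ p, weightedK p ∂(ν.prod ν) : ℝ) : EReal) := by
  have h1 : ∫⁻ p : ℂ × ℂ, (energyKernel field p.1 p.2).toENNReal ∂(ν.prod ν) =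
      ∫⁻ p, ENNReal.ofReal (weightedK p) ∂(ν.prod ν) := by
    refine lintegral_congr_ae (hne.mono fun p hp => ?_)
    simp only
    rw [energyKernel_of_ne _ hp, EReal.toENNReal_of_ne_top (EReal.coe_ne_top _), EReal.toReal_coe]
    rfl
  have h2 : ∫⁻ p : ℂ × ℂ, (-energyKernel field p.1 p.2).toENNReal ∂(ν.prod ν) =
      ∫⁻ p, ENNReal.ofReal (-weightedK p) ∂(ν.prod ν) := by
    refine lintegral_congr_ae (hne.mono fun p hp => ?_)
    simp only
    rw [energyKernel_of_ne _ hp, ← EReal.coe_neg, EReal.toENNReal_of_ne_top (EReal.coe_ne_top _),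
      EReal.toReal_coe]
    rfl
  have h3 : ∫⁻ p, ENNReal.ofReal (weightedK p) ∂(ν.prod ν) ≠ ⊤ := h.lintegral_lt_top.ne
  have h4 : ∫⁻ p, ENNReal.ofReal (-weightedK p) ∂(ν.prod ν) ≠ ⊤ := h.neg.lintegral_lt_top.ne
  rw [weightedEnergy, h1, h2, integral_eq_lintegral_pos_part_sub_lintegral_neg_part h,
    EReal.coe_sub, EReal.coe_ennreal_toReal h3, EReal.coe_ennreal_toReal h4]

theorem weightedEnergy_mu {l : ℝ} (hl : ∀ z ∈ arc, totalPotential field mu z = l) :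
    weightedEnergy field mu = ((l - muEnergy : ℝ) : EReal) := by
  have hlog := integrable_logK_prod_mu isCompact_arc ae_mem_arc
  have hred := integrable_reducedK isCompact_arc ae_mem_arc hlog
  have hz : ∫ p, reducedK p ∂(mu.prod mu) = 0 := by
    rw [integral_reducedK isCompact_arc ae_mem_arc hlog,
      integral_logK_prod_mu isCompact_arc ae_mem_arc, probReal_univ, muEnergy]
    ring
  have hfst : ∀ᵐ p ∂(mu.prod mu), p.1 ∈ arc :=
    Measure.quasiMeasurePreserving_fst.ae ae_mem_arc
  have hsnd : ∀ᵐ p ∂(mu.prod mu), p.2 ∈ arc :=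
    Measure.quasiMeasurePreserving_snd.ae ae_mem_arc
  have hae : (fun p => reducedK p + (l - muEnergy)) =ᵐ[mu.prod mu] weightedK := by
    filter_upwards [hfst, hsnd] with p h1 h2
    rw [weightedK_eq, hl _ h1, hl _ h2]; ring
  have hint := (hred.add (integrable_const (l - muEnergy))).congr hae
  rw [weightedEnergy_eq (ae_prod_mu_ne mu) hint, ← integral_congr_ae hae,
    integral_add hred (integrable_const _), hz, zero_add, integral_const, probReal_univ, one_smul]

/-- The weighted kernel is `reducedK` plus a nonnegative function f plus the energy l - muEnergy of
μ. For ν ≠ μ the first integral is positive and the second nonnegative. -/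
theorem isEquilibriumMeasure_mu {S : Set ℂ} (hS : arc ⊆ S) {l : ℝ}
    (hl : ∀ z ∈ arc, totalPotential field mu z = l)
    (hle : ∀ z ∈ S, l ≤ totalPotential field mu z) : IsEquilibriumMeasure S field mu where
  isProbability := inferInstance
  carried := measure_mono_null (compl_subset_compl.2 hS) mu_compl_arc
  minimal ν _ hν hne := by
    rw [weightedEnergy_mu hl]
    obtain ⟨C, hC⟩ := exists_le_reducedK
    have hmem : ∀ᵐ z ∂ν, z ∈ S := by rw [ae_iff]; exact hν
    have hfst : ∀ᵐ p ∂(ν.prod ν), p.1 ∈ S := Measure.quasiMeasurePreserving_fst.ae hmem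
    have hsnd : ∀ᵐ p ∂(ν.prod ν), p.2 ∈ S := Measure.quasiMeasurePreserving_snd.ae hmem
    set f : ℂ × ℂ → ℝ := fun p =>
      (totalPotential field mu p.1 + totalPotential field mu p.2) / 2 - l with hf
    have hf0 : ∀ᵐ p ∂(ν.prod ν), 0 ≤ f p := by
      filter_upwards [hfst, hsnd] with p h1 h2
      rw [hf]
      linarith [hle _ h1, hle _ h2]
    have hK : ∀ p, weightedK p = reducedK p + f p + (l - muEnergy) := fun p => by
      rw [weightedK_eq, hf]; ring
    set D : ℝ := C + (l - muEnergy) with hD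
    have hlow : ∀ᵐ p ∂(ν.prod ν), D ≤ weightedK p := by
      filter_upwards [hf0] with p h1
      rw [hK]; linarith [hC p]
    have hneg : ∫⁻ p : ℂ × ℂ, (-energyKernel field p.1 p.2).toENNReal ∂(ν.prod ν) ≠ ⊤ := by
      refine ne_top_of_le_ne_top (b := ∫⁻ _, ENNReal.ofReal (-D) ∂(ν.prod ν)) (by simp) ?_
      refine lintegral_mono_ae (hlow.mono fun p hp => ?_)
      by_cases h : p.1 = p.2
      · rw [h, energyKernel_self]; simp
      · rw [energyKernel_of_ne _ h, ← EReal.coe_neg, EReal.toENNReal_of_ne_top (EReal.coe_ne_top _),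
          EReal.toReal_coe]
        exact ENNReal.ofReal_le_ofReal (neg_le_neg hp)
    -- The negative part is finite, so a competitor whose positive part is infinite has energy +∞.
    by_cases hpos : ∫⁻ p : ℂ × ℂ, (energyKernel field p.1 p.2).toENNReal ∂(ν.prod ν) = ⊤
    · rw [weightedEnergy, hpos, EReal.coe_ennreal_top, EReal.top_sub]
      · exact EReal.coe_lt_top _
      · simpa using hneg
    -- The kernel is +∞ on the diagonal, so finite energy makes the diagonal null.
    have hoff : ∀ᵐ p ∂(ν.prod ν), p.1 ≠ p.2 := by
      filter_upwards [ae_lt_top measurable_energyKernel.ereal_toENNReal hpos] with p hp h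
      rw [h, energyKernel_self] at hp
      simp at hp
    have hint : Integrable weightedK (ν.prod ν) := by
      refine ⟨measurable_weightedK.aestronglyMeasurable, ?_⟩
      calc ∫⁻ p, ‖weightedK p‖ₑ ∂(ν.prod ν)
          ≤ ∫⁻ p : ℂ × ℂ, ((energyKernel field p.1 p.2).toENNReal + ENNReal.ofReal |D|)
            ∂(ν.prod ν) := by
            refine lintegral_mono_ae ?_
            filter_upwards [hoff, hlow] with p h1 h2
            rw [energyKernel_of_ne _ h1, EReal.real_coe_toENNReal, Real.enorm_eq_ofReal_abs]
            change _ ≤ ENNReal.ofReal (weightedK p) + _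
            rcases le_total 0 (weightedK p) with h3 | h3
            · rw [abs_of_nonneg h3]; exact le_self_add
            · rw [abs_of_nonpos h3, abs_of_nonpos (h2.trans h3)]
              exact (ENNReal.ofReal_le_ofReal (neg_le_neg h2)).trans le_add_self
        _ < ⊤ := by
            rw [lintegral_add_right _ measurable_const, ENNReal.add_lt_top]
            exact ⟨lt_top_iff_ne_top.2 hpos, by simp⟩
    -- Since `reducedK` is bounded below by C, f lies between 0 and the integrable function
    -- weightedK - D; the energy can then be split.
    have hfint : Integrable f (ν.prod ν) := by
      refine ((hint.sub (integrable_const D))).mono' ?_ ?_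
      · have := continuous_totalPotential
        exact Continuous.aestronglyMeasurable (by fun_prop)
      · filter_upwards [hf0] with p h1
        rw [Real.norm_of_nonneg h1]
        simp only [Pi.sub_apply]
        rw [hK, hD]; linarith [hC p]
    have hred : Integrable reducedK (ν.prod ν) := by
      refine ((hint.sub hfint).sub (integrable_const (l - muEnergy))).congr (ae_of_all _ fun p => ?_)
      simp only [Pi.sub_apply]
      rw [hK]; ring
    rw [weightedEnergy_eq hoff hint, EReal.coe_lt_coe_iff]
    simp_rw [hK]
    have hsum : Integrable (fun p => reducedK p + f p) (ν.prod ν) := hred.add hfint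
    rw [integral_add hsum (integrable_const _), integral_add hred hfint, integral_const,
      probReal_univ, one_smul]
    have h1 := integral_reducedK_pos hoff hred hne
    have h2 := integral_nonneg_of_ae hf0
    linarith

theorem IsArcParam.density_pos {c : ℝ → ℂ} (hc : IsArcParam c) {t : ℝ} (ht : t ∈ Ioo (0 : ℝ) 1) :
    (1 / (Real.pi * I) * sqrtQ (c t) * deriv c t).im = 0 ∧
      0 < (1 / (Real.pi * I) * sqrtQ (c t) * deriv c t).re := by
  obtain ⟨h1, h2⟩ := phiDeriv_graphPoint_mid (hc.absc_mem ht)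
  have h3 := hc.deriv_absc_pos ht
  have h4 := hc.sqrtQ_mul_deriv ht
  set W := phiDeriv (graphPoint (absc c t)) * (1 + deriv height (absc c t) * I) with hW
  have h5 : W = W.im * I := by apply Complex.ext <;> simp [h1]
  have hpi : (Real.pi : ℂ) ≠ 0 := ofReal_ne_zero.2 Real.pi_ne_zero
  have e : 1 / (Real.pi * I) * sqrtQ (c t) * deriv c t =
      ((deriv (absc c) t * W.im / Real.pi : ℝ) : ℂ) := by
    rw [mul_assoc, h4]
    nth_rw 1 [h5]
    push_cast
    field_simp
  rw [e, ofReal_im, ofReal_re]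
  exact ⟨rfl, by positivity⟩

end CubicSCurve

end

/-! ### The theorem -/

open CubicSCurve in
theorem theorem2p2 :
    (∃ c : ℝ → ℂ, IsCriticalTrajectory Q z₁ z₂ c) ∧
    ∀ c : ℝ → ℂ, IsCriticalTrajectory Q z₁ z₂ c →
      (∃ R : ℂ → ℂ, IsSqrtBranch (c '' Icc 0 1) R) ∧
      ∀ R : ℂ → ℂ, IsSqrtBranch (c '' Icc 0 1) R →
        (∃ G : ℝ → ℂ, IsContourExtension (c '' Icc 0 1) R G) ∧
        ∃ Rplus : ℂ → ℂ,
          (∀ t ∈ Ioo (0 : ℝ) 1, HasLeftLimit R c t (Rplus (c t))) ∧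
          (∀ t ∈ Ioo (0 : ℝ) 1,
            (1 / (Real.pi * I) * Rplus (c t) * deriv c t).im = 0 ∧
            0 < (1 / (Real.pi * I) * Rplus (c t) * deriv c t).re) ∧
          IsProbabilityMeasure (arcMeasure c fun s => 1 / (Real.pi * I) * Rplus s) ∧
          (arcMeasure c fun s => 1 / (Real.pi * I) * Rplus s).support = c '' Icc 0 1 ∧
          ∀ G : ℝ → ℂ, IsContourExtension (c '' Icc 0 1) R G →
            IsEquilibriumMeasure (range G) field
              (arcMeasure c fun s => 1 / (Real.pi * I) * Rplus s) ∧
            HasSProperty G field := by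
  refine ⟨⟨contour, isCriticalTrajectory_contour⟩, fun c hct => ?_⟩
  have hc := hct.isArcParam
  -- Every critical trajectory has the same image, so the remaining claims concern the fixed set
  -- `arc`.
  rw [hc.image_eq]
  refine ⟨⟨branch, isSqrtBranch_branch⟩, fun R hR => ⟨⟨contour, isContourExtension_contour hR⟩,
    sqrtQ, fun t ht => hc.hasLeftLimit hR ht, fun t ht => hc.density_pos ht, ?_⟩⟩
  rw [hc.arcMeasure_eq]
  refine ⟨inferInstance, support_mu, fun G hG => ?_⟩
  obtain ⟨l, -, -, hl⟩ := exists_totalPotential_eq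
  have hsub : arc ⊆ range G := by rw [← hG.middle]; exact image_subset_range _ _
  have heq : IsEquilibriumMeasure (range G) field mu :=
    isEquilibriumMeasure_mu hsub hl fun z hz => hG.le_totalPotential hR hl hz
  -- The support is a single arc, over the parameter interval [0, 1].
  refine ⟨heq, hG.contour, mu, heq, 1, fun _ => 0, fun _ => 1, fun _ => one_pos,
    Subsingleton.pairwise, ?_, fun _ t ht => ⟨integrable_log_mu _, hG.exists_normal_derivatives ht⟩⟩
  rw [support_mu, iUnion_const, hG.middle]
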